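/- Let $m_1,m_2,n\ge 1$ be integers. Write $B^{k+1}$ for the open unit ball of $\mathbb{R}^{k+1}$ with the Poincaré metric $4|dx|^2/(1-|x|^2)^2$, and put $$X=B^{m_1+1}\times B^{m_2+1},\qquad \overline X=\overline{B^{m_1+1}}\times\overline{B^{m_2+1}},$$ $$\partial X=(\partial B^{m_1+1}\times\overline{B^{m_2+1}})\cup(\overline{B^{m_1+1}}\times\partial B^{m_2+1}),\qquad \angle X=\partial B^{m_1+1}\times\partial B^{m_2+1},$$ where $X$ carries the product of the Poincaré metrics. For a $C^2$ map $u\colon X\to B^{n+1}$ let $\tau(u)=-\nabla^*du=\operatorname{tr}\nabla du$ be its tension field; $u$ is harmonic if $\tau(u)=0$ on $X$. **Theorem.** Let $u,\tilde u\colon\overline X\to\overline{B^{n+1}}$ be two maps whose restrictions to $X$ are harmonic maps $X\to B^{n+1}$. Assume that each $w\in\{u,\tilde u\}$ satisfies: 1. $w(\angle X)\subset\partial B^{n+1}$ and $w(\overline X\setminus\angle X)\subset B^{n+1}$; 2. $w\in C^2(\overline X\setminus\angle X, B^{n+1})$; 3. the pointwise norm $|\tau(w)|$, taken with respect to the Poincaré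 metric of $B^{n+1}$, tends to zero uniformly at $\partial X$; 4. $w\in C^1(\overline X,\overline{B^{n+1}})$; 5. the corner value $\varphi=w|_{\angle X}\colon\angle X\to\partial B^{n+1}$ is $C^1$, and the differentials $d_1\varphi$ and $d_2\varphi$ of $\varphi$ with respect to its first variable in $\partial B^{m_1+1}$ and its second variable in $\partial B^{m_2+1}$ are both nowhere vanishing, i.e. at every point of $\angle X$ each of them is a nonzero linear map. If $u|_{\angle X}=\tilde u|_{\angle X}$, then $u=\tilde u$ in $X$. -/

import Mathlib

open scoped Manifold ContDiff Topology

noncomputable section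

namespace CornerHarmonic

/-! ### Tension fields in coordinates

A Riemannian metric on an open subset of a finite dimensional real vector space `E` is given by
`g : E → E → E → ℝ`, where `g x v w` is the inner product of the tangent vectors `v`, `w` at `x`
(values at points outside the open subset are irrelevant).
Coordinates on `E` are the linear ones given by a basis of `E`. -/

section Coordinates

variable {E F ι κ : Type*} [NormedAddCommGroup E] [NormedSpace ℝ E]
  [NormedAddCommGroup F] [NormedSpace ℝ F] [Fintype ι] [DecidableEq ι] [Fintype κ] [DecidableEq κ]

/-- The partial derivative `∂ᵢ f` at `x` in the coordinates given by the basis `b`. -/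
def partialDeriv (b : Module.Basis ι ℝ E) (i : ι) (f : E → ℝ) (x : E) : ℝ :=
  fderiv ℝ f x (b i)

/-- The matrix `(g_ij)` of the metric `g` at `x`. -/
def metricMatrix (b : Module.Basis ι ℝ E) (g : E → E → E → ℝ) (x : E) : Matrix ι ι ℝ :=
  Matrix.of fun i j => g x (b i) (b j)

/-- The Christoffel symbol `Γ^k_ij` of the Levi-Civita connection of `g` at `x`:
`Γ^k_ij = (1/2) ∑_l g^kl (∂ᵢ g_jl + ∂ⱼ g_il - ∂ₗ g_ij)`. -/
def christoffel (b : Module.Basis ι ℝ E) (g : E → E → E → ℝ) (k i j : ι) (x : E) : ℝ :=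
  (1 / 2 : ℝ) * ∑ l, (metricMatrix b g x)⁻¹ k l *
    (partialDeriv b i (fun y => metricMatrix b g y j l) x
      + partialDeriv b j (fun y => metricMatrix b g y i l) x
      - partialDeriv b l (fun y => metricMatrix b g y i j) x)

/-- The component `τ^k(u)` at `x` of the tension field of `u : (E, g) → (F, h)`:
`τ^k(u) = ∑ g^ij (∂ᵢ∂ⱼ u^k - Γ^l_ij ∂ₗ u^k + (Γ^k_pq ∘ u) ∂ᵢ u^p ∂ⱼ u^q)`. -/
def tensionComponent (b : Module.Basis ι ℝ E) (c : Module.Basis κ ℝ F)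
    (g : E → E → E → ℝ) (h : F → F → F → ℝ) (u : E → F) (k : κ) (x : E) : ℝ :=
  ∑ i, ∑ j, (metricMatrix b g x)⁻¹ i j *
    (partialDeriv b i (partialDeriv b j (fun y => c.coord k (u y))) x
      - ∑ l, christoffel b g l i j x * partialDeriv b l (fun y => c.coord k (u y)) x
      + ∑ p, ∑ q, christoffel c h k p q (u x)
          * partialDeriv b i (fun y => c.coord p (u y)) x
          * partialDeriv b j (fun y => c.coord q (u y)) x)

/-- The tension field of `u`, a vector field along `u`. -/
def tensionField (b : Module.Basis ι ℝ E) (c : Module.Basis κ ℝ F)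
    (g : E → E → E → ℝ) (h : F → F → F → ℝ) (u : E → F) (x : E) : F :=
  ∑ k, tensionComponent b c g h u k x • c k

end Coordinates

/-! ### The Poincaré ball and products of two Poincaré balls -/

/-- The Euclidean space `ℝ^(m+1)`. -/
abbrev Euc (m : ℕ) : Type := EuclideanSpace ℝ (Fin (m + 1))

/-- The open unit ball `B^(m+1)`. -/
def openBall (m : ℕ) : Set (Euc m) := Metric.ball 0 1

/-- The closed unit ball. -/
def closedUnitBall (m : ℕ) : Set (Euc m) := Metric.closedBall 0 1

/-- The unit sphere, as a set; it is also a smooth manifold. -/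
abbrev unitSphere (m : ℕ) : Set (Euc m) := Metric.sphere 0 1

/-- The Poincaré metric `4 |dx|² / (1 - |x|²)²` on the open unit ball, of curvature `-1`. -/
def poincareMetric (m : ℕ) (x v w : Euc m) : ℝ :=
  4 / (1 - ‖x‖ ^ 2) ^ 2 * inner ℝ v w

/-- The product of the two Poincaré metrics on `B^(m₁+1) × B^(m₂+1)`. -/
def productMetric (m₁ m₂ : ℕ) (x v w : Euc m₁ × Euc m₂) : ℝ :=
  poincareMetric m₁ x.1 v.1 w.1 + poincareMetric m₂ x.2 v.2 w.2

/-- The standard basis of `ℝ^(m+1)`. -/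
def stdBasis (m : ℕ) : Module.Basis (Fin (m + 1)) ℝ (Euc m) :=
  (EuclideanSpace.basisFun (Fin (m + 1)) ℝ).toBasis

/-- The space `X = B^(m₁+1) × B^(m₂+1)`. -/
def domain (m₁ m₂ : ℕ) : Set (Euc m₁ × Euc m₂) := openBall m₁ ×ˢ openBall m₂

/-- The closure of `X`, the product of the closed balls. -/
def closedDomain (m₁ m₂ : ℕ) : Set (Euc m₁ × Euc m₂) := closedUnitBall m₁ ×ˢ closedUnitBall m₂

/-- The topological boundary of `X`. -/
def topBoundary (m₁ m₂ : ℕ) : Set (Euc m₁ × Euc m₂) :=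
  (unitSphere m₁ ×ˢ closedUnitBall m₂) ∪ (closedUnitBall m₁ ×ˢ unitSphere m₂)

/-- The corner (distinguished boundary) of `X`, the product of the unit spheres. -/
def corner (m₁ m₂ : ℕ) : Set (Euc m₁ × Euc m₂) := unitSphere m₁ ×ˢ unitSphere m₂

/-- The tension field of `u : X → B^(n+1)` with respect to the product of the Poincaré metrics on
`X` and the Poincaré metric on `B^(n+1)`. -/
def tension {m₁ m₂ n : ℕ} (u : Euc m₁ × Euc m₂ → Euc n) (p : Euc m₁ × Euc m₂) : Euc n :=
  tensionField ((stdBasis m₁).prod (stdBasis m₂)) (stdBasis n)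
    (productMetric m₁ m₂) (poincareMetric n) u p

/-- The pointwise norm `|τ(u)|`, taken in the Poincaré metric at `u p`. -/
def tensionNorm {m₁ m₂ n : ℕ} (u : Euc m₁ × Euc m₂ → Euc n) (p : Euc m₁ × Euc m₂) : ℝ :=
  Real.sqrt (poincareMetric n (u p) (tension u p) (tension u p))

/-- `u` restricts to a harmonic map `X → B^(n+1)`: it is `C²` with vanishing tension field. -/
structure IsHarmonic {m₁ m₂ n : ℕ} (u : Euc m₁ × Euc m₂ → Euc n) : Prop where
  mapsTo : Set.MapsTo u (domain m₁ m₂) (openBall n)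
  contDiffOn : ContDiffOn ℝ 2 u (domain m₁ m₂)
  tension_eq_zero : ∀ p ∈ domain m₁ m₂, tension u p = 0

/-- The restriction `φ` of `u` to the corner, as a map on the product of the two spheres. -/
def cornerValue {m₁ m₂ n : ℕ} (u : Euc m₁ × Euc m₂ → Euc n)
    (q : unitSphere m₁ × unitSphere m₂) : Euc n :=
  u ((q.1 : Euc m₁), (q.2 : Euc m₂))

/-- `d₁φ` and `d₂φ` are nowhere vanishing. Here `φ` has values in the unit sphere, which is
embedded in Euclidean space, so that its differential may be taken as a map into the latter. -/
def Nondegenerate {m₁ m₂ n : ℕ} (φ : unitSphere m₁ × unitSphere m₂ → Euc n) : Prop :=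
  ∀ q : unitSphere m₁ × unitSphere m₂,
    mfderiv (𝓡 m₁) 𝓘(ℝ, Euc n) (fun q₁ => φ (q₁, q.2)) q.1 ≠ 0 ∧
    mfderiv (𝓡 m₂) 𝓘(ℝ, Euc n) (fun q₂ => φ (q.1, q₂)) q.2 ≠ 0

/-- The assumptions imposed on a map `u` from the closure of `X` to the closed ball.
Only the values of `u` on the closure of `X` matter. -/
structure Admissible {m₁ m₂ n : ℕ} (u : Euc m₁ × Euc m₂ → Euc n) : Prop where
  /-- The corner goes to the boundary sphere. -/
  mapsTo_corner : Set.MapsTo u (corner m₁ m₂) (unitSphere n)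
  /-- Everything else goes to the open ball. -/
  mapsTo_off_corner : Set.MapsTo u (closedDomain m₁ m₂ \ corner m₁ m₂) (openBall n)
  /-- `u` is `C²` up to the topological boundary, away from the corner. -/
  contDiffOn_two : ContDiffOn ℝ 2 u (closedDomain m₁ m₂ \ corner m₁ m₂)
  /-- `|τ(u)|` tends to zero uniformly at the (compact) topological boundary. -/
  tension_tendsto : Filter.Tendsto (tensionNorm u)
    (𝓝ˢ (topBoundary m₁ m₂) ⊓ Filter.principal (domain m₁ m₂)) (𝓝 0)
  /-- `u` is `C¹` up to the whole boundary, including the corner. -/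
  contDiffOn_one : ContDiffOn ℝ 1 u (closedDomain m₁ m₂)
  /-- The corner value is `C¹` with nowhere vanishing factorwise differentials. -/
  contMDiff_cornerValue :
    ContMDiff ((𝓡 m₁).prod (𝓡 m₂)) 𝓘(ℝ, Euc n) 1 (cornerValue (m₁ := m₁) (m₂ := m₂) u)
  nondegenerate : Nondegenerate (cornerValue (m₁ := m₁) (m₂ := m₂) u)

end CornerHarmonic

end

/-! The function `distFun u v = (cosh d(u, v) - 1) / 2`, with `d` the hyperbolic distance, is
subharmonic for the product metric when `u` and `v` are harmonic (`laplacian_distFun_nonneg`). A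
maximum principle would make it vanish, but two things stand in the way: nothing is prescribed on
the open faces of the boundary, and at the corner both maps run off to infinity, so that equal
corner values do not by themselves bound `d`.

The faces are harmless because the Laplacian degenerates there. Where `‖x₁‖ = 1` the coefficients
belonging to the first factor all vanish, and what remains is the Laplacian of the second factor,
which differentiates along the face. A function that is `C²` up to the face therefore obeys the
usual second derivative test there, and after adding `ε ‖x‖²` its maximum can only lie on the corner
(`nonpos_of_laplacian_nonneg`).

At the corner the first derivative is determined by the corner value (`cornerDeriv_eq`). Dilating
the harmonic map equation about a corner point should give equations between first derivatives, but
second derivatives of a map that is only `C¹` there may blow up. The limit is justified instead by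
comparison with a quadratic barrier: a function of order `o(|p - q|^s)` cannot have a Laplacian
whose rescaling by `t^(-s)` has a nonzero limit (`limit_laplacian_eq_zero`). Applied to the square
of the height `1 - ‖u‖²`, this gives `(mⱼ + 1) aⱼ² = 4 |Dⱼu|²` for the two inward slopes `aⱼ` of the
height, which are then positive by nondegeneracy. Applied to the components tangent to the sphere,
it shows that the normal derivatives of `u` are multiples of `u q`. The slopes are thus expressed by
the differential of the corner value, and the whole derivative is known.

Consequently, with `δ` the distance from `p` to its radial projection on the corner, `‖u - v‖ =
o(δ)`, while both heights are at least a constant times `δ`. Hence `distFun u v → 0` at the corner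
(`tendsto_distFun_corner`), and the maximum principle applies. -/

noncomputable section

namespace CornerHarmonic

/-! ### Calculus of second order operators -/

section SecondOrder

variable {E F G H ι : Type*} [NormedAddCommGroup E] [NormedSpace ℝ E]
  [NormedAddCommGroup F] [NormedSpace ℝ F] [NormedAddCommGroup G] [NormedSpace ℝ G]
  [NormedAddCommGroup H] [NormedSpace ℝ H] [Fintype ι]

/-- The second derivative of `f` at `p` in the direction `e`. -/
def secondDeriv (f : E → F) (p e : E) : F :=
  fderiv ℝ (fun x => fderiv ℝ f x e) p e

/-- The second order operator `∑ wᵢ ∂ᵢ∂ᵢ + V`. -/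
def secondOrderOp (b : ι → E) (w : ι → ℝ) (V : E) (f : E → F) (p : E) : F :=
  ∑ i, w i • secondDeriv f p (b i) + fderiv ℝ f p V

theorem differentiableAt_fderiv_apply {f : E → F} {p : E} (hf : ContDiffAt ℝ 2 f p) (e : E) :
    DifferentiableAt ℝ (fun x => fderiv ℝ f x e) p := by
  have h : ContDiffAt ℝ 1 (fderiv ℝ f) p := hf.fderiv_right (by norm_num)
  exact (h.differentiableAt (by norm_num)).clm_apply (differentiableAt_const e)

theorem eventually_differentiableAt {f : E → F} {p : E} (hf : ContDiffAt ℝ 2 f p) :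
    ∀ᶠ x in 𝓝 p, DifferentiableAt ℝ f x := by
  filter_upwards [hf.eventually (by simp)] with x hx
  exact hx.differentiableAt (by norm_num)

theorem fderiv_bilinear_apply (B : F →L[ℝ] G →L[ℝ] H) {f : E → F} {g : E → G} {p : E}
    (hf : DifferentiableAt ℝ f p) (hg : DifferentiableAt ℝ g p) (e : E) :
    fderiv ℝ (fun x => B (f x) (g x)) p e
      = B (f p) (fderiv ℝ g p e) + B (fderiv ℝ f p e) (g p) := by
  rw [B.fderiv_of_bilinear hf hg]
  simp

theorem secondDeriv_bilinear (B : F →L[ℝ] G →L[ℝ] H) {f : E → F} {g : E → G} {p : E}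
    (hf : ContDiffAt ℝ 2 f p) (hg : ContDiffAt ℝ 2 g p) (e : E) :
    secondDeriv (fun x => B (f x) (g x)) p e
      = B (f p) (secondDeriv g p e) + B (secondDeriv f p e) (g p)
        + (2 : ℝ) • B (fderiv ℝ f p e) (fderiv ℝ g p e) := by
  have h : (fun x => fderiv ℝ (fun x => B (f x) (g x)) x e) =ᶠ[𝓝 p]
      fun x => B (f x) (fderiv ℝ g x e) + B (fderiv ℝ f x e) (g x) := by
    filter_upwards [eventually_differentiableAt hf, eventually_differentiableAt hg] with x h1 h2
    exact fderiv_bilinear_apply B h1 h2 e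
  have f1 := hf.differentiableAt (by norm_num)
  have g1 := hg.differentiableAt (by norm_num)
  have f2 := differentiableAt_fderiv_apply hf e
  have g2 := differentiableAt_fderiv_apply hg e
  have k1 : DifferentiableAt ℝ (fun x => B (f x) (fderiv ℝ g x e)) p :=
    (B.differentiableAt.comp p f1).clm_apply g2
  have k2 : DifferentiableAt ℝ (fun x => B (fderiv ℝ f x e) (g x)) p :=
    (B.differentiableAt.comp p f2).clm_apply g1
  unfold secondDeriv
  rw [h.fderiv_eq, fderiv_fun_add k1 k2, add_apply,
    fderiv_bilinear_apply B f1 g2, fderiv_bilinear_apply B f2 g1, two_smul]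
  abel

/-- The weights and the drift are constants here, frozen at the point of evaluation, so only `f` and
`g` are differentiated. This one Leibniz rule serves for products, scalar multiples and inner
products alike. -/
theorem secondOrderOp_bilinear (B : F →L[ℝ] G →L[ℝ] H) {f : E → F} {g : E → G} {p : E}
    (hf : ContDiffAt ℝ 2 f p) (hg : ContDiffAt ℝ 2 g p) (b : ι → E) (w : ι → ℝ) (V : E) :
    secondOrderOp b w V (fun x => B (f x) (g x)) p
      = B (f p) (secondOrderOp b w V g p) + B (secondOrderOp b w V f p) (g p)
        + (2 : ℝ) • ∑ i, w i • B (fderiv ℝ f p (b i)) (fderiv ℝ g p (b i)) := by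
  unfold secondOrderOp
  rw [fderiv_bilinear_apply B (hf.differentiableAt (by norm_num))
    (hg.differentiableAt (by norm_num))]
  simp only [secondDeriv_bilinear B hf hg, smul_add, Finset.sum_add_distrib, map_add, map_sum,
    map_smul, add_apply, sum_apply,
    smul_apply, Finset.smul_sum, smul_comm (2 : ℝ)]
  abel

theorem secondOrderOp_add {f g : E → F} {p : E}
    (hf : ContDiffAt ℝ 2 f p) (hg : ContDiffAt ℝ 2 g p) (b : ι → E) (w : ι → ℝ) (V : E) :
    secondOrderOp b w V (fun x => f x + g x) p
      = secondOrderOp b w V f p + secondOrderOp b w V g p := by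
  have h (e : E) : secondDeriv (fun x => f x + g x) p e
      = secondDeriv f p e + secondDeriv g p e := by
    have h : (fun x => fderiv ℝ (fun x => f x + g x) x e) =ᶠ[𝓝 p]
        fun x => fderiv ℝ f x e + fderiv ℝ g x e := by
      filter_upwards [eventually_differentiableAt hf, eventually_differentiableAt hg] with x h1 h2
      rw [fderiv_fun_add h1 h2, add_apply]
    unfold secondDeriv
    rw [h.fderiv_eq, fderiv_fun_add (differentiableAt_fderiv_apply hf e)
      (differentiableAt_fderiv_apply hg e), add_apply]
  unfold secondOrderOp
  rw [fderiv_fun_add (hf.differentiableAt (by norm_num)) (hg.differentiableAt (by norm_num))]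
  simp only [h, smul_add, Finset.sum_add_distrib, add_apply]
  abel

theorem secondOrderOp_clm_comp (A : F →L[ℝ] G) {f : E → F} {p : E}
    (hf : ContDiffAt ℝ 2 f p) (b : ι → E) (w : ι → ℝ) (V : E) :
    secondOrderOp b w V (fun x => A (f x)) p = A (secondOrderOp b w V f p) := by
  have h0 {g : E → F} {x : E} (hx : DifferentiableAt ℝ g x) (e : E) :
      fderiv ℝ (fun x => A (g x)) x e = A (fderiv ℝ g x e) :=
    congrArg (fun T => T e) (A.hasFDerivAt.comp x hx.hasFDerivAt).fderiv
  have h (e : E) : secondDeriv (fun x => A (f x)) p e = A (secondDeriv f p e) := by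
    have h : (fun x => fderiv ℝ (fun x => A (f x)) x e) =ᶠ[𝓝 p]
        fun x => A (fderiv ℝ f x e) := by
      filter_upwards [eventually_differentiableAt hf] with x h1
      exact h0 h1 e
    unfold secondDeriv
    rw [h.fderiv_eq, h0 (differentiableAt_fderiv_apply hf e)]
  unfold secondOrderOp
  rw [h0 (hf.differentiableAt (by norm_num))]
  simp [h]

theorem secondOrderOp_const (c : F) (p : E) (b : ι → E) (w : ι → ℝ) (V : E) :
    secondOrderOp b w V (fun _ => c) p = 0 := by
  simp [secondOrderOp, secondDeriv]

theorem secondOrderOp_clm (A : E →L[ℝ] F) (p : E) (b : ι → E) (w : ι → ℝ) (V : E) :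
    secondOrderOp b w V A p = A V := by
  simp [secondOrderOp, secondDeriv]

theorem secondOrderOp_const_mul {f : E → ℝ} {p : E}
    (hf : ContDiffAt ℝ 2 f p) (c : ℝ) (b : ι → E) (w : ι → ℝ) (V : E) :
    secondOrderOp b w V (fun x => c * f x) p = c * secondOrderOp b w V f p := by
  have := secondOrderOp_clm_comp (c • ContinuousLinearMap.id ℝ ℝ) hf b w V
  simpa using this

theorem secondOrderOp_sub {f g : E → F} {p : E}
    (hf : ContDiffAt ℝ 2 f p) (hg : ContDiffAt ℝ 2 g p) (b : ι → E) (w : ι → ℝ) (V : E) :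
    secondOrderOp b w V (fun x => f x - g x) p
      = secondOrderOp b w V f p - secondOrderOp b w V g p := by
  have h1 := secondOrderOp_add hf hg.neg b w V
  have h2 := secondOrderOp_clm_comp (-ContinuousLinearMap.id ℝ F) hg b w V
  simp only [neg_apply, ContinuousLinearMap.id_apply] at h2
  simp only [sub_eq_add_neg]
  rw [← h2]
  exact h1

theorem secondOrderOp_mul {f g : E → ℝ} {p : E}
    (hf : ContDiffAt ℝ 2 f p) (hg : ContDiffAt ℝ 2 g p) (b : ι → E) (w : ι → ℝ) (V : E) :
    secondOrderOp b w V (fun x => f x * g x) p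
      = f p * secondOrderOp b w V g p + secondOrderOp b w V f p * g p
        + 2 * ∑ i, w i * (fderiv ℝ f p (b i) * fderiv ℝ g p (b i)) := by
  simpa using secondOrderOp_bilinear (ContinuousLinearMap.mul ℝ ℝ) hf hg b w V

theorem secondOrderOp_smul {f : E → ℝ} {g : E → F} {p : E}
    (hf : ContDiffAt ℝ 2 f p) (hg : ContDiffAt ℝ 2 g p) (b : ι → E) (w : ι → ℝ) (V : E) :
    secondOrderOp b w V (fun x => f x • g x) p
      = f p • secondOrderOp b w V g p + secondOrderOp b w V f p • g p
        + (2 : ℝ) • ∑ i, w i • (fderiv ℝ f p (b i) • fderiv ℝ g p (b i)) := by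
  simpa using secondOrderOp_bilinear (ContinuousLinearMap.lsmul ℝ ℝ) hf hg b w V

theorem secondOrderOp_inner {F : Type*} [NormedAddCommGroup F] [InnerProductSpace ℝ F]
    {f g : E → F} {p : E}
    (hf : ContDiffAt ℝ 2 f p) (hg : ContDiffAt ℝ 2 g p) (b : ι → E) (w : ι → ℝ) (V : E) :
    secondOrderOp b w V (fun x => inner ℝ (f x) (g x)) p
      = inner ℝ (f p) (secondOrderOp b w V g p) + inner ℝ (secondOrderOp b w V f p) (g p)
        + 2 * ∑ i, w i * inner ℝ (fderiv ℝ f p (b i)) (fderiv ℝ g p (b i)) := by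
  have h := secondOrderOp_bilinear (innerSL ℝ : F →L[ℝ] F →L[ℝ] ℝ) hf hg b w V
  simp only [smul_eq_mul] at h
  exact h

/-! ### Maxima -/

/-- The operator `∑ wᵢ ∂ᵢ∂ᵢ + V` for functions on a set `S`. -/
def secondOrderOpWithin (b : ι → E) (w : ι → ℝ) (V : E) (S : Set E) (f : E → F) (p : E) : F :=
  ∑ i, w i • fderivWithin ℝ (fun x => fderivWithin ℝ f S x (b i)) S p (b i)
    + fderivWithin ℝ f S p V

theorem secondOrderOpWithin_of_mem_nhds {b : ι → E} {w : ι → ℝ} {V : E} {S : Set E}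
    {f : E → F} {p : E} (h : S ∈ 𝓝 p) :
    secondOrderOpWithin b w V S f p = secondOrderOp b w V f p := by
  unfold secondOrderOpWithin secondOrderOp secondDeriv
  rw [fderivWithin_of_mem_nhds h]
  congr 1
  refine Finset.sum_congr rfl fun i _ => ?_
  rw [fderivWithin_of_mem_nhds h]
  have : (fun x => fderivWithin ℝ f S x (b i)) =ᶠ[𝓝 p] fun x => fderiv ℝ f x (b i) := by
    filter_upwards [eventually_mem_nhds_iff.2 h] with x hx
    rw [fderivWithin_of_mem_nhds hx]
  rw [this.fderiv_eq]

theorem second_derivative_nonpos_of_isLocalMax {g g' : ℝ → ℝ} {c : ℝ} (h : IsLocalMax g 0)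
    (hg : ∀ᶠ t in 𝓝 0, HasDerivAt g (g' t) t) (hc : HasDerivAt g' c 0) : c ≤ 0 := by
  by_contra! hpos
  have h0 : g' 0 = 0 := h.hasDerivAt_eq_zero hg.self_of_nhds
  have hs : ∀ᶠ t in 𝓝[>] (0 : ℝ), 0 < g' t := by
    have := hc.tendsto_slope.eventually (lt_mem_nhds hpos)
    have h2 : 𝓝[>] (0 : ℝ) ≤ 𝓝[≠] 0 := nhdsWithin_mono _ fun x hx => ne_of_gt hx
    filter_upwards [h2 this, self_mem_nhdsWithin] with t ht ht0
    simp only [slope_def_field, h0, sub_zero] at ht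
    have : 0 < t := ht0
    exact (div_pos_iff_of_pos_right this).1 ht
  have hall : ∀ᶠ t in 𝓝[>] (0 : ℝ), 0 < g' t ∧ HasDerivAt g (g' t) t ∧ g t ≤ g 0 :=
    by
    filter_upwards [hs, nhdsWithin_le_nhds hg, nhdsWithin_le_nhds h] with t h1 h2 h3
    exact ⟨h1, h2, h3⟩
  obtain ⟨δ, hδ, hsub⟩ := mem_nhdsGT_iff_exists_Ioc_subset.1 hall
  have hδ' : (0 : ℝ) < δ := hδ
  -- A positive second derivative makes `g'` positive just to the right of `0`. By the mean value
  -- theorem `g` then exceeds `g 0`, against maximality.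
  obtain ⟨ξ, hξ, he⟩ := exists_hasDerivAt_eq_slope g g' hδ'
    (fun t ht => by
      rcases eq_or_lt_of_le ht.1 with rfl | h1
      · exact hg.self_of_nhds.continuousAt.continuousWithinAt
      · exact (hsub ⟨h1, ht.2⟩).2.1.continuousAt.continuousWithinAt)
    (fun t ht => (hsub ⟨ht.1, ht.2.le⟩).2.1)
  have h1 := (hsub ⟨hξ.1, hξ.2.le⟩).1
  have h2 := (hsub ⟨hδ', le_rfl⟩).2.2
  rw [he] at h1
  have := (div_pos_iff_of_pos_right (by linarith : (0 : ℝ) < δ - 0)).1 h1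
  linarith

/-- The point may lie on the boundary of `S`. Only the line through it in the direction `e` has to
stay in `S` on both sides, and the one-variable test is applied along that line. -/
theorem fderivWithin_eq_zero_and_second_nonpos {S : Set E} (hS : UniqueDiffOn ℝ S) {f : E → ℝ}
    (hf : ContDiffOn ℝ 2 f S) {p e : E} (hmax : IsMaxOn f S p)
    (he : ∀ᶠ t : ℝ in 𝓝 0, p + t • e ∈ S) :
    fderivWithin ℝ f S p e = 0 ∧
      fderivWithin ℝ (fun x => fderivWithin ℝ f S x e) S p e ≤ 0 := by
  have hf1 : ContDiffOn ℝ 1 (fderivWithin ℝ f S) S := hf.fderivWithin hS (by norm_num)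
  have hf2 : DifferentiableOn ℝ (fun x => fderivWithin ℝ f S x e) S :=
    (hf1.differentiableOn (by norm_num)).clm_apply (differentiableOn_const e)
  have hline (t : ℝ) : HasDerivAt (fun t : ℝ => p + t • e) e t := by
    simpa using ((hasDerivAt_id t).smul_const e).const_add p
  have key {h : E → ℝ} (hh : DifferentiableOn ℝ h S) :
      ∀ᶠ t in 𝓝 (0 : ℝ), HasDerivAt (fun t : ℝ => h (p + t • e))
        (fderivWithin ℝ h S (p + t • e) e) t := by
    filter_upwards [eventually_eventually_nhds.2 he] with t ht
    have h1 := (hh _ ht.self_of_nhds).hasFDerivWithinAt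
    have h2 := h1.comp_hasDerivWithinAt_of_eq (s := {t : ℝ | p + t • e ∈ S}) t
      (hline t).hasDerivWithinAt (fun x hx => hx) rfl
    exact h2.hasDerivAt ht
  have hd := key (hf.differentiableOn (by norm_num))
  have hd2 := (key hf2).self_of_nhds
  have hm : IsLocalMax (fun t : ℝ => f (p + t • e)) 0 := by
    filter_upwards [he] with t ht
    simpa using hmax ht
  have h1 := hm.hasDerivAt_eq_zero hd.self_of_nhds
  have h2 := second_derivative_nonpos_of_isLocalMax hm hd hd2
  simp only [zero_smul, add_zero] at h1 h2
  exact ⟨h1, h2⟩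

end SecondOrder

/-! ### Christoffel symbols and tension for diagonal metrics -/

theorem partialDeriv_diagonal {E ι : Type*} [NormedAddCommGroup E] [NormedSpace ℝ E]
    [DecidableEq ι] (b : Module.Basis ι ℝ E) (d : E → ι → ℝ) (k i j : ι)
    (x : E) : partialDeriv b k (fun y => Matrix.diagonal (d y) i j) x
      = if i = j then partialDeriv b k (fun y => d y i) x else 0 := by
  unfold partialDeriv
  by_cases h : i = j
  · subst h; simp
  · simp [h]

section DiagonalMetrics

variable {E F ι κ : Type*} [NormedAddCommGroup E] [NormedSpace ℝ E]
  [NormedAddCommGroup F] [NormedSpace ℝ F] [Fintype ι] [DecidableEq ι] [Fintype κ] [DecidableEq κ]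

theorem inv_diagonal_of_ne_zero {d : ι → ℝ} (hd : ∀ i, d i ≠ 0) :
    (Matrix.diagonal d)⁻¹ = Matrix.diagonal fun i => (d i)⁻¹ := by
  refine Matrix.inv_eq_left_inv ?_
  rw [Matrix.diagonal_mul_diagonal, ← Matrix.diagonal_one]
  congr 1
  ext i
  exact inv_mul_cancel₀ (hd i)

theorem christoffel_of_diagonal {b : Module.Basis ι ℝ E} {g : E → E → E → ℝ} {d : E → ι → ℝ}
    (hg : ∀ y, metricMatrix b g y = Matrix.diagonal (d y)) {x : E} (hx : ∀ i, d x i ≠ 0)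
    (k i j : ι) :
    christoffel b g k i j x = 1 / 2 * (d x k)⁻¹ *
      ((if j = k then partialDeriv b i (fun y => d y j) x else 0)
        + (if i = k then partialDeriv b j (fun y => d y i) x else 0)
        - (if i = j then partialDeriv b k (fun y => d y i) x else 0)) := by
  unfold christoffel
  simp only [hg, partialDeriv_diagonal, inv_diagonal_of_ne_zero hx]
  rw [Finset.sum_eq_single k]
  · simp [mul_assoc]
  · intro l _ hl
    simp [Matrix.diagonal_apply_ne _ hl.symm]
  · simp

theorem tensionComponent_of_diagonal {b : Module.Basis ι ℝ E} {c : Module.Basis κ ℝ F}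
    {g : E → E → E → ℝ} {h : F → F → F → ℝ} {d : E → ι → ℝ}
    (hg : ∀ y, metricMatrix b g y = Matrix.diagonal (d y)) {x : E} (hx : ∀ i, d x i ≠ 0)
    (u : E → F) (k : κ) :
    tensionComponent b c g h u k x = ∑ i, (d x i)⁻¹ *
      (partialDeriv b i (partialDeriv b i (fun y => c.coord k (u y))) x
      - ∑ l, christoffel b g l i i x * partialDeriv b l (fun y => c.coord k (u y)) x
      + ∑ p, ∑ q, christoffel c h k p q (u x)
          * partialDeriv b i (fun y => c.coord p (u y)) x
          * partialDeriv b i (fun y => c.coord q (u y)) x) := by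
  unfold tensionComponent
  simp only [hg, inv_diagonal_of_ne_zero hx]
  refine Finset.sum_congr rfl fun i _ => ?_
  rw [Finset.sum_eq_single i]
  · simp
  · intro l _ hl
    simp [Matrix.diagonal_apply_ne _ hl.symm]
  · simp

end DiagonalMetrics

/-! ### The tension field in ball coordinates -/

section Poincare

variable {m₁ m₂ n : ℕ}

/-- The standard basis of `ℝ^(m₁+1) × ℝ^(m₂+1)`. -/
def prodBasis (m₁ m₂ : ℕ) : Fin (m₁ + 1) ⊕ Fin (m₂ + 1) → Euc m₁ × Euc m₂ :=
  (stdBasis m₁).prod (stdBasis m₂)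

/-- The diagonal entries of the inverse of the product of the Poincaré metrics. -/
def weight (p : Euc m₁ × Euc m₂) : Fin (m₁ + 1) ⊕ Fin (m₂ + 1) → ℝ :=
  Sum.elim (fun _ => (1 - ‖p.1‖ ^ 2) ^ 2 / 4) (fun _ => (1 - ‖p.2‖ ^ 2) ^ 2 / 4)

/-- The first order part of the Laplacian of the product of the Poincaré metrics. -/
def drift (p : Euc m₁ × Euc m₂) : Euc m₁ × Euc m₂ :=
  ((((m₁ : ℝ) - 1) / 2 * (1 - ‖p.1‖ ^ 2)) • p.1, (((m₂ : ℝ) - 1) / 2 * (1 - ‖p.2‖ ^ 2)) • p.2)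

/-- The Laplacian of the product of the Poincaré metrics. -/
def laplacian {F : Type*} [NormedAddCommGroup F] [NormedSpace ℝ F]
    (f : Euc m₁ × Euc m₂ → F) (p : Euc m₁ × Euc m₂) : F :=
  secondOrderOp (prodBasis m₁ m₂) (weight p) (drift p) f p

theorem stdBasis_apply (i : Fin (n + 1)) : stdBasis n i = EuclideanSpace.single i (1 : ℝ) := by
  simp [stdBasis]

theorem stdBasis_coord (k : Fin (n + 1)) (y : Euc n) : (stdBasis n).coord k y = y k := by
  simp [stdBasis]

theorem inner_stdBasis_right (x : Euc n) (i : Fin (n + 1)) : inner ℝ x (stdBasis n i) = x i := by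
  rw [stdBasis_apply, EuclideanSpace.inner_single_right]
  simp

theorem inner_stdBasis_stdBasis (i j : Fin (n + 1)) :
    inner ℝ (stdBasis n i) (stdBasis n j) = if i = j then (1 : ℝ) else 0 := by
  rw [inner_stdBasis_right, stdBasis_apply, PiLp.single_apply]
  simp [eq_comm]

theorem prodBasis_inl (i : Fin (m₁ + 1)) : prodBasis m₁ m₂ (Sum.inl i) = (stdBasis m₁ i, 0) := by
  ext <;> simp [prodBasis]

theorem prodBasis_inr (i : Fin (m₂ + 1)) : prodBasis m₁ m₂ (Sum.inr i) = (0, stdBasis m₂ i) := by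
  ext <;> simp [prodBasis]

theorem sum_smul_stdBasis (x : Euc n) : ∑ i, x i • stdBasis n i = x := by
  simpa [stdBasis] using (stdBasis n).sum_repr x

theorem clm_eq_sum_stdBasis {F : Type*} [NormedAddCommGroup F] [NormedSpace ℝ F]
    (A : Euc m₁ × Euc m₂ →L[ℝ] F) (x : Euc m₁ × Euc m₂) :
    A x = ∑ i, x.1 i • A (prodBasis m₁ m₂ (Sum.inl i))
      + ∑ i, x.2 i • A (prodBasis m₁ m₂ (Sum.inr i)) := by
  have h : x = ∑ i, x.1 i • prodBasis m₁ m₂ (Sum.inl i)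
      + ∑ i, x.2 i • prodBasis m₁ m₂ (Sum.inr i) := by
    refine Prod.ext ?_ ?_
    · simp [prodBasis_inl, prodBasis_inr, Prod.fst_sum, sum_smul_stdBasis]
    · simp [prodBasis_inl, prodBasis_inr, Prod.snd_sum, sum_smul_stdBasis]
  conv_lhs => rw [h]
  simp

theorem metricMatrix_poincareMetric (y : Euc n) :
    metricMatrix (stdBasis n) (poincareMetric n) y
      = Matrix.diagonal fun _ => 4 / (1 - ‖y‖ ^ 2) ^ 2 := by
  ext i j
  simp only [metricMatrix, poincareMetric, Matrix.of_apply, inner_stdBasis_stdBasis,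
    Matrix.diagonal_apply]
  split_ifs <;> simp

theorem metricMatrix_productMetric (y : Euc m₁ × Euc m₂) :
    metricMatrix ((stdBasis m₁).prod (stdBasis m₂)) (productMetric m₁ m₂) y
      = Matrix.diagonal (Sum.elim (fun _ => 4 / (1 - ‖y.1‖ ^ 2) ^ 2)
          (fun _ => 4 / (1 - ‖y.2‖ ^ 2) ^ 2)) := by
  have h1 := fun i => prodBasis_inl (m₁ := m₁) (m₂ := m₂) i
  have h2 := fun i => prodBasis_inr (m₁ := m₁) (m₂ := m₂) i
  unfold prodBasis at h1 h2
  ext i j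
  simp only [metricMatrix, productMetric, poincareMetric, Matrix.of_apply, Matrix.diagonal_apply]
  rcases i with i | i <;> rcases j with j | j <;>
    simp only [h1, h2, inner_stdBasis_stdBasis, Sum.inl.injEq, Sum.inr.injEq]
  all_goals first | (by_cases h : i = j <;> simp [h]) | simp

theorem hasFDerivAt_conformalFactor {x : Euc n} (hx : ‖x‖ < 1) :
    HasFDerivAt (fun y : Euc n => 4 / (1 - ‖y‖ ^ 2) ^ 2)
      ((16 / (1 - ‖x‖ ^ 2) ^ 3) • innerSL ℝ x) x := by
  have h0 : 1 - ‖x‖ ^ 2 ≠ 0 := by nlinarith [norm_nonneg x]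
  have h1 : HasFDerivAt (fun y : Euc n => ‖y‖ ^ 2) (2 • innerSL ℝ x) x :=
    (hasStrictFDerivAt_norm_sq x).hasFDerivAt
  have h2 : HasDerivAt (fun t : ℝ => 4 / (1 - t) ^ 2) (8 / (1 - ‖x‖ ^ 2) ^ 3) (‖x‖ ^ 2) := by
    have h3 : HasDerivAt (fun t : ℝ => (1 - t) ^ 2) (2 * (1 - ‖x‖ ^ 2) * (-1)) (‖x‖ ^ 2) := by
      simpa using ((hasDerivAt_id' (‖x‖ ^ 2)).const_sub 1).fun_pow 2
    have h4 := (hasDerivAt_const (‖x‖ ^ 2) (4 : ℝ)).fun_div h3 (pow_ne_zero 2 h0)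
    refine h4.congr_deriv ?_
    field_simp
    ring
  refine (h2.comp_hasFDerivAt x h1).congr_fderiv ?_
  ext y
  simp
  ring

theorem fderiv_conformalFactor {x : Euc n} (hx : ‖x‖ < 1) (e : Euc n) :
    fderiv ℝ (fun y : Euc n => 4 / (1 - ‖y‖ ^ 2) ^ 2) x e
      = 16 / (1 - ‖x‖ ^ 2) ^ 3 * inner ℝ x e := by
  rw [(hasFDerivAt_conformalFactor hx).fderiv]
  simp

theorem fderiv_conformalFactor_fst {p : Euc m₁ × Euc m₂} (hx : ‖p.1‖ < 1) (e : Euc m₁ × Euc m₂) :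
    fderiv ℝ (fun y : Euc m₁ × Euc m₂ => 4 / (1 - ‖y.1‖ ^ 2) ^ 2) p e
      = 16 / (1 - ‖p.1‖ ^ 2) ^ 3 * inner ℝ p.1 e.1 := by
  have h := (hasFDerivAt_conformalFactor hx).comp p
    (hasFDerivAt_fst (𝕜 := ℝ) (E := Euc m₁) (F := Euc m₂))
  rw [show fderiv ℝ (fun y : Euc m₁ × Euc m₂ => 4 / (1 - ‖y.1‖ ^ 2) ^ 2) p = _ from h.fderiv]
  simp

theorem fderiv_conformalFactor_snd {p : Euc m₁ × Euc m₂} (hx : ‖p.2‖ < 1) (e : Euc m₁ × Euc m₂) :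
    fderiv ℝ (fun y : Euc m₁ × Euc m₂ => 4 / (1 - ‖y.2‖ ^ 2) ^ 2) p e
      = 16 / (1 - ‖p.2‖ ^ 2) ^ 3 * inner ℝ p.2 e.2 := by
  have h := (hasFDerivAt_conformalFactor hx).comp p
    (hasFDerivAt_snd (𝕜 := ℝ) (E := Euc m₁) (F := Euc m₂))
  rw [show fderiv ℝ (fun y : Euc m₁ × Euc m₂ => 4 / (1 - ‖y.2‖ ^ 2) ^ 2) p = _ from h.fderiv]
  simp

theorem one_sub_sq_pos {x : Euc n} (hx : ‖x‖ < 1) : 0 < 1 - ‖x‖ ^ 2 := by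
  nlinarith [norm_nonneg x]

theorem sum_christoffel_poincareMetric {x : Euc n} (hx : ‖x‖ < 1) (k : Fin (n + 1)) (a : Euc n) :
    ∑ p, ∑ q, christoffel (stdBasis n) (poincareMetric n) k p q x * a p * a q
      = 2 / (1 - ‖x‖ ^ 2) * (2 * inner ℝ x a * a k - ‖a‖ ^ 2 * x k) := by
  have h0 := (one_sub_sq_pos hx).ne'
  have hne : ∀ _ : Fin (n + 1), 4 / (1 - ‖x‖ ^ 2) ^ 2 ≠ 0 := fun _ =>
    div_ne_zero (by norm_num) (pow_ne_zero 2 h0)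
  simp only [christoffel_of_diagonal (metricMatrix_poincareMetric (n := n)) hne, partialDeriv,
    fderiv_conformalFactor hx, inner_stdBasis_right]
  have e1 : inner ℝ x a = ∑ i, a i * x i := by simp [PiLp.inner_apply]
  have e2 : ‖a‖ ^ 2 = ∑ i, a i * a i := by
    rw [EuclideanSpace.real_norm_sq_eq]; simp only [sq]
  rw [e1, e2]
  have key (p q : Fin (n + 1)) : 1 / 2 * (4 / (1 - ‖x‖ ^ 2) ^ 2)⁻¹ *
      ((if q = k then 16 / (1 - ‖x‖ ^ 2) ^ 3 * x p else 0)
        + (if p = k then 16 / (1 - ‖x‖ ^ 2) ^ 3 * x q else 0)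
        - (if p = q then 16 / (1 - ‖x‖ ^ 2) ^ 3 * x k else 0)) * a p * a q
      = 2 / (1 - ‖x‖ ^ 2) * ((if q = k then a p * x p * a q else 0)
        + (if p = k then a q * x q * a p else 0) - (if p = q then a p * a q * x k else 0)) := by
    split_ifs <;> field_simp <;> ring
  simp only [key, ← Finset.mul_sum, Finset.sum_add_distrib, Finset.sum_sub_distrib]
  simp only [Finset.sum_ite_eq', Finset.sum_ite_eq, Finset.mem_univ, if_true, ← Finset.sum_mul]
  have : ∑ p, ∑ q, (if p = k then a q * x q * a p else 0) = (∑ i, a i * x i) * a k := by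
    rw [Finset.sum_eq_single k]
    · simp [Finset.sum_mul]
    · intro l _ hl; simp [hl]
    · simp
  rw [this]
  ring

/-- For a conformal metric `λ² |dx|²` in dimension `m + 1` the trace of the Christoffel symbols is
`-(m - 1) λ⁻² ∇ log λ`. With `λ = 2 / (1 - ‖x‖²)` this is the negative of the drift. The two factors
do not interact. -/
theorem sum_weight_christoffel_productMetric {x : Euc m₁ × Euc m₂}
    (h1 : ‖x.1‖ < 1) (h2 : ‖x.2‖ < 1) (f : Fin (m₁ + 1) ⊕ Fin (m₂ + 1) → ℝ) :
    ∑ i, weight x i * ∑ l, christoffel ((stdBasis m₁).prod (stdBasis m₂))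
        (productMetric m₁ m₂) l i i x * f l
      = -(∑ i, (drift x).1 i * f (Sum.inl i) + ∑ i, (drift x).2 i * f (Sum.inr i)) := by
  have h01 := (one_sub_sq_pos h1).ne'
  have h02 := (one_sub_sq_pos h2).ne'
  have hne : ∀ i : Fin (m₁ + 1) ⊕ Fin (m₂ + 1), Sum.elim (fun _ => 4 / (1 - ‖x.1‖ ^ 2) ^ 2)
          (fun _ => 4 / (1 - ‖x.2‖ ^ 2) ^ 2) i ≠ 0 := by
    rintro (i | i)
    · exact div_ne_zero (by norm_num) (pow_ne_zero 2 h01)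
    · exact div_ne_zero (by norm_num) (pow_ne_zero 2 h02)
  have b1 := fun i => prodBasis_inl (m₁ := m₁) (m₂ := m₂) i
  have b2 := fun i => prodBasis_inr (m₁ := m₁) (m₂ := m₂) i
  unfold prodBasis at b1 b2
  simp only [christoffel_of_diagonal (metricMatrix_productMetric (m₁ := m₁) (m₂ := m₂)) hne,
    partialDeriv, Fintype.sum_sum_type, Sum.elim_inl, Sum.elim_inr, fderiv_conformalFactor_fst h1,
    fderiv_conformalFactor_snd h2, b1, b2, inner_stdBasis_right, weight, inner_zero_right,
    mul_zero, if_true, reduceCtorEq, if_false, Sum.inl.injEq, Sum.inr.injEq, add_zero,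
    sub_self, zero_mul, Finset.sum_const_zero, zero_add, drift, PiLp.smul_apply, smul_eq_mul]
  have key {k : ℕ} {c : ℝ} (hc : c ≠ 0) (y : Fin (k + 1) → ℝ) (f : Fin (k + 1) → ℝ) :
      ∑ i : Fin (k + 1), c ^ 2 / 4 * ∑ l, 1 / 2 * (4 / c ^ 2)⁻¹ *
        ((if i = l then 16 / c ^ 3 * y i else 0) + (if i = l then 16 / c ^ 3 * y i else 0)
          - 16 / c ^ 3 * y l) * f l
      = -∑ i, ((k : ℝ) - 1) / 2 * c * y i * f i := by
    have (i l : Fin (k + 1)) : c ^ 2 / 4 * (1 / 2 * (4 / c ^ 2)⁻¹ *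
        ((if i = l then 16 / c ^ 3 * y i else 0) + (if i = l then 16 / c ^ 3 * y i else 0)
          - 16 / c ^ 3 * y l) * f l)
        = (if i = l then c * y l * f l else 0) - c / 2 * (y l * f l) := by
      split_ifs with h
      · subst h; field_simp; ring
      · field_simp; ring
    simp only [Finset.mul_sum, this, Finset.sum_sub_distrib, Finset.sum_ite_eq, Finset.mem_univ,
      if_true, ← Finset.sum_neg_distrib, Finset.sum_const, Finset.card_univ, Fintype.card_fin,
      nsmul_eq_mul]
    rw [← Finset.sum_sub_distrib]
    refine Finset.sum_congr rfl fun i _ => ?_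
    push_cast
    ring
  have k1 := key h01 x.1 (fun i => f (Sum.inl i))
  have k2 := key h02 x.2 (fun i => f (Sum.inr i))
  simp only at k1 k2 ⊢
  rw [neg_add, ← k1, ← k2]

/-- Passage from the coordinate definition to vector form. The Christoffel symbols of the domain
become the drift, and those of the target become the quadratic term in `du`. -/
theorem tension_eq {u : Euc m₁ × Euc m₂ → Euc n} {p : Euc m₁ × Euc m₂} (hp : p ∈ domain m₁ m₂)
    (hu : ContDiffAt ℝ 2 u p) (hup : ‖u p‖ < 1) :
    tension u p = laplacian u p + ∑ i, weight p i • (2 / (1 - ‖u p‖ ^ 2)) •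
      ((2 * inner ℝ (u p) (fderiv ℝ u p (prodBasis m₁ m₂ i))) • fderiv ℝ u p (prodBasis m₁ m₂ i)
        - ‖fderiv ℝ u p (prodBasis m₁ m₂ i)‖ ^ 2 • u p) := by
  have h1 : ‖p.1‖ < 1 := by simpa [openBall] using hp.1
  have h2 : ‖p.2‖ < 1 := by simpa [openBall] using hp.2
  have h01 := (one_sub_sq_pos h1).ne'
  have h02 := (one_sub_sq_pos h2).ne'
  have hne : ∀ i : Fin (m₁ + 1) ⊕ Fin (m₂ + 1), Sum.elim (fun _ => 4 / (1 - ‖p.1‖ ^ 2) ^ 2)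
          (fun _ => 4 / (1 - ‖p.2‖ ^ 2) ^ 2) i ≠ 0 := by
    rintro (i | i)
    · exact div_ne_zero (by norm_num) (pow_ne_zero 2 h01)
    · exact div_ne_zero (by norm_num) (pow_ne_zero 2 h02)
  have hw (i) : (Sum.elim (fun _ : Fin (m₁ + 1) => 4 / (1 - ‖p.1‖ ^ 2) ^ 2)
          (fun _ : Fin (m₂ + 1) => 4 / (1 - ‖p.2‖ ^ 2) ^ 2) i)⁻¹ = weight p i := by
    rcases i with i | i <;> simp [weight]
  ext k
  have hk : tension u p k = tensionComponent ((stdBasis m₁).prod (stdBasis m₂)) (stdBasis n)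
      (productMetric m₁ m₂) (poincareMetric n) u k p := by
    unfold tension tensionField
    simp [stdBasis_apply, Pi.single_apply]
  rw [hk, tensionComponent_of_diagonal (metricMatrix_productMetric (m₁ := m₁) (m₂ := m₂)) hne]
  simp only [stdBasis_coord, hw]
  have hd (k : Fin (n + 1)) {x} (hx : DifferentiableAt ℝ u x) (e) :
      fderiv ℝ (fun y => u y k) x e = fderiv ℝ u x e k :=
    congrArg (fun T => T e) ((EuclideanSpace.proj (𝕜 := ℝ) k).hasFDerivAt.comp x
      hx.hasFDerivAt).fderiv
  have hd2 (e) : fderiv ℝ (fun x => fderiv ℝ (fun y => u y k) x e) p e = secondDeriv u p e k := by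
    have : (fun x => fderiv ℝ (fun y => u y k) x e) =ᶠ[𝓝 p] fun x => fderiv ℝ u x e k := by
      filter_upwards [eventually_differentiableAt hu] with x hx
      exact hd k hx e
    rw [this.fderiv_eq]
    exact congrArg (fun T => T e) ((EuclideanSpace.proj (𝕜 := ℝ) k).hasFDerivAt.comp p
      (differentiableAt_fderiv_apply hu e).hasFDerivAt).fderiv
  have hu1 := hu.differentiableAt (n := 2) (by norm_num)
  have hpd (i) : partialDeriv ((stdBasis m₁).prod (stdBasis m₂)) i
      (partialDeriv ((stdBasis m₁).prod (stdBasis m₂)) i (fun y => u y k)) p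
      = secondDeriv u p (prodBasis m₁ m₂ i) k := hd2 _
  have hpd1 (i) (k) : partialDeriv ((stdBasis m₁).prod (stdBasis m₂)) i (fun y => u y k) p
      = fderiv ℝ u p (prodBasis m₁ m₂ i) k := hd k hu1 _
  simp only [hpd, hpd1, sum_christoffel_poincareMetric hup, mul_add, mul_sub,
    Finset.sum_add_distrib, Finset.sum_sub_distrib]
  rw [sum_weight_christoffel_productMetric h1 h2
    (fun l => fderiv ℝ u p (prodBasis m₁ m₂ l) k)]
  unfold laplacian secondOrderOp
  rw [clm_eq_sum_stdBasis (fderiv ℝ u p) (drift p)]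
  simp [mul_sub, Finset.sum_sub_distrib]
  ring

end Poincare

/-! ### A Cauchy-Schwarz inequality on the hyperboloid -/

section PointwiseInequality

variable {F : Type*} [NormedAddCommGroup F] [InnerProductSpace ℝ F]

/-- The Lorentzian product of two tangent vectors of the hyperboloid model, in ball coordinates,
is at most the product of their norms and the Lorentzian product of the base points. -/
theorem lorentz_inner_le {x y : F} (hx : ‖x‖ < 1) (hy : ‖y‖ < 1) (v w : F) {a b : ℝ}
    (ha : a * (1 - ‖x‖ ^ 2) = 1) (hb : b * (1 - ‖y‖ ^ 2) = 1) :
    inner ℝ v w + 2 * a * inner ℝ x v * inner ℝ x w + 2 * b * inner ℝ y v * inner ℝ y w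
        + 4 * a * b * (inner ℝ x y - 1) * inner ℝ x v * inner ℝ y w
      ≤ ‖v‖ * ‖w‖ * ((2 * a - 1) * (2 * b - 1) - 4 * a * b * inner ℝ x y) := by
  -- `C` is `cosh` of the hyperbolic distance: minus the Lorentzian product of the hyperboloid
  -- points `(2a - 1, 2a x)` and `(2b - 1, 2b y)`.
  set C := (2 * a - 1) * (2 * b - 1) - 4 * a * b * inner ℝ x y with hC
  have ha0 : 0 < a := by
    have : 0 < 1 - ‖x‖ ^ 2 := by nlinarith [norm_nonneg x]
    exact pos_of_mul_pos_left (by rw [ha]; norm_num) this.le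
  have hb0 : 0 < b := by
    have : 0 < 1 - ‖y‖ ^ 2 := by nlinarith [norm_nonneg y]
    exact pos_of_mul_pos_left (by rw [hb]; norm_num) this.le
  have hC1 : 1 ≤ C := by
    have h : ‖x - y‖ ^ 2 = ‖x‖ ^ 2 - 2 * inner ℝ x y + ‖y‖ ^ 2 := norm_sub_sq_real x y
    have : C = 1 + 2 * (a * b * ‖x - y‖ ^ 2) := by
      rw [h, hC]
      linear_combination (2 * b) * ha + (2 * a) * hb
    have : 0 ≤ a * b * ‖x - y‖ ^ 2 := by positivity
    linarith
  -- The left side is linear in `v`, and `z` is the vector representing it. The vector `k` is chosen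
  -- so that `‖z‖² = ‖w‖² + ⟨k, w⟩²` with `‖k‖² = C² - 1`, whence `‖z‖ ≤ C ‖w‖`.
  set z := w + (2 * a * inner ℝ x w + 4 * a * b * (inner ℝ x y - 1) * inner ℝ y w) • x
    + (2 * b * inner ℝ y w) • y with hz
  set k := (2 * a) • x + (4 * a * b * inner ℝ x y - 2 * b * (2 * a - 1)) • y with hk
  have hxx : inner ℝ x x = ‖x‖ ^ 2 := real_inner_self_eq_norm_sq x
  have hyy : inner ℝ y y = ‖y‖ ^ 2 := real_inner_self_eq_norm_sq y
  have hax : a * ‖x‖ ^ 2 = a - 1 := by linarith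
  have hby : b * ‖y‖ ^ 2 = b - 1 := by linarith
  have hkn : ‖k‖ ^ 2 = C ^ 2 - 1 := by
    rw [← real_inner_self_eq_norm_sq, hk]
    simp only [inner_add_left, inner_add_right, real_inner_smul_left, real_inner_smul_right, hxx,
      hyy, real_inner_comm x y]
    rw [hC]
    linear_combination (4 * a) * hax
      + (b * (2 * (2 * a * inner ℝ x y - (2 * a - 1))) ^ 2) * hby
  have hzn : ‖z‖ ^ 2 = ‖w‖ ^ 2 + inner ℝ k w ^ 2 := by
    rw [← real_inner_self_eq_norm_sq, hz, hk]
    simp only [inner_add_left, inner_add_right, real_inner_smul_left, real_inner_smul_right, hxx,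
      hyy, real_inner_comm x y, real_inner_self_eq_norm_sq w, real_inner_comm x w,
      real_inner_comm y w]
    linear_combination (a * (2 * inner ℝ x w + 4 * b * (inner ℝ x y - 1) * inner ℝ y w) ^ 2) * hax
      + (b * (2 * inner ℝ y w) ^ 2) * hby
  have hzw : ‖z‖ ≤ ‖w‖ * C := by
    refine le_of_sq_le_sq ?_ (by positivity)
    have h1 : inner ℝ k w ^ 2 ≤ ‖k‖ ^ 2 * ‖w‖ ^ 2 := by
      rw [← mul_pow]
      exact sq_le_sq' (by linarith [neg_abs_le (inner ℝ k w), abs_real_inner_le_norm k w])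
        (real_inner_le_norm k w)
    rw [hzn, mul_pow]
    rw [hkn] at h1
    linarith
  calc _ = inner ℝ v z := by
        rw [hz]
        simp only [inner_add_right, real_inner_smul_right, real_inner_comm x v,
          real_inner_comm y v]
        ring
    _ ≤ ‖v‖ * ‖z‖ := real_inner_le_norm v z
    _ ≤ ‖v‖ * (‖w‖ * C) := by gcongr
    _ = _ := by ring

end PointwiseInequality

/-! ### Subharmonicity of the distance function -/

section Harmonic

variable {m₁ m₂ n : ℕ} {u v : Euc m₁ × Euc m₂ → Euc n} {p : Euc m₁ × Euc m₂}

/-- `u` is harmonic at `p`, with a value in the open ball. -/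
def IsHarmonicAt (u : Euc m₁ × Euc m₂ → Euc n) (p : Euc m₁ × Euc m₂) : Prop :=
  ContDiffAt ℝ 2 u p ∧ ‖u p‖ < 1 ∧
    laplacian u p = -∑ i, weight p i • (2 / (1 - ‖u p‖ ^ 2)) •
      ((2 * inner ℝ (u p) (fderiv ℝ u p (prodBasis m₁ m₂ i))) • fderiv ℝ u p (prodBasis m₁ m₂ i)
        - ‖fderiv ℝ u p (prodBasis m₁ m₂ i)‖ ^ 2 • u p)

theorem IsHarmonicAt.contDiffAt (hu : IsHarmonicAt u p) : ContDiffAt ℝ 2 u p := hu.1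

theorem IsHarmonicAt.norm_lt (hu : IsHarmonicAt u p) : ‖u p‖ < 1 := hu.2.1

theorem IsHarmonicAt.laplacian_eq (hu : IsHarmonicAt u p) :
    laplacian u p = -∑ i, weight p i • (2 / (1 - ‖u p‖ ^ 2)) •
      ((2 * inner ℝ (u p) (fderiv ℝ u p (prodBasis m₁ m₂ i))) • fderiv ℝ u p (prodBasis m₁ m₂ i)
        - ‖fderiv ℝ u p (prodBasis m₁ m₂ i)‖ ^ 2 • u p) := hu.2.2

theorem isOpen_domain : IsOpen (domain m₁ m₂) := Metric.isOpen_ball.prod Metric.isOpen_ball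

theorem IsHarmonic.isHarmonicAt (hu : IsHarmonic u) (hp : p ∈ domain m₁ m₂) :
    IsHarmonicAt u p := by
  have h1 : ContDiffAt ℝ 2 u p := hu.contDiffOn.contDiffAt (isOpen_domain.mem_nhds hp)
  have h2 : ‖u p‖ < 1 := by simpa [openBall] using hu.mapsTo hp
  exact ⟨h1, h2, by
    rw [eq_neg_iff_add_eq_zero, ← tension_eq hp h1 h2, hu.tension_eq_zero p hp]⟩

theorem weight_nonneg (p : Euc m₁ × Euc m₂) (i) : 0 ≤ weight p i := by
  rcases i with i | i <;> simp only [weight, Sum.elim_inl, Sum.elim_inr] <;> positivity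

theorem laplacian_inner (hu : ContDiffAt ℝ 2 u p) (hv : ContDiffAt ℝ 2 v p) :
    laplacian (fun x => inner ℝ (u x) (v x)) p
      = inner ℝ (u p) (laplacian v p) + inner ℝ (laplacian u p) (v p)
        + 2 * ∑ i, weight p i *
          inner ℝ (fderiv ℝ u p (prodBasis m₁ m₂ i)) (fderiv ℝ v p (prodBasis m₁ m₂ i)) :=
  secondOrderOp_inner hu hv _ _ _

theorem laplacian_mul {f g : Euc m₁ × Euc m₂ → ℝ} (hf : ContDiffAt ℝ 2 f p)
    (hg : ContDiffAt ℝ 2 g p) :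
    laplacian (fun x => f x * g x) p = f p * laplacian g p + laplacian f p * g p
        + 2 * ∑ i, weight p i *
          (fderiv ℝ f p (prodBasis m₁ m₂ i) * fderiv ℝ g p (prodBasis m₁ m₂ i)) :=
  secondOrderOp_mul hf hg _ _ _

theorem contDiffAt_one_sub_norm_sq (hu : ContDiffAt ℝ 2 u p) :
    ContDiffAt ℝ 2 (fun x => 1 - ‖u x‖ ^ 2) p :=
  contDiffAt_const.sub (hu.norm_sq ℝ)

theorem fderiv_one_sub_norm_sq (hu : DifferentiableAt ℝ u p) (e : Euc m₁ × Euc m₂) :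
    fderiv ℝ (fun x => 1 - ‖u x‖ ^ 2) p e = -(2 * inner ℝ (u p) (fderiv ℝ u p e)) := by
  have h := (hu.hasFDerivAt.norm_sq).const_sub 1
  rw [h.fderiv]
  simp

theorem IsHarmonicAt.inner_laplacian (hu : IsHarmonicAt u p) (e : Euc n) :
    inner ℝ e (laplacian u p) = -∑ i, weight p i * (2 / (1 - ‖u p‖ ^ 2) *
      (2 * inner ℝ (u p) (fderiv ℝ u p (prodBasis m₁ m₂ i))
          * inner ℝ e (fderiv ℝ u p (prodBasis m₁ m₂ i))
        - ‖fderiv ℝ u p (prodBasis m₁ m₂ i)‖ ^ 2 * inner ℝ e (u p))) := by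
  rw [hu.laplacian_eq, inner_neg_right, inner_sum]
  simp only [real_inner_smul_right, inner_sub_right]

theorem IsHarmonicAt.laplacian_one_sub_norm_sq (hu : IsHarmonicAt u p) :
    laplacian (fun x => 1 - ‖u x‖ ^ 2) p = ∑ i, weight p i *
      (2 / (1 - ‖u p‖ ^ 2) * fderiv ℝ (fun x => 1 - ‖u x‖ ^ 2) p (prodBasis m₁ m₂ i) ^ 2
        - 4 / (1 - ‖u p‖ ^ 2) * ‖fderiv ℝ u p (prodBasis m₁ m₂ i)‖ ^ 2
        + 2 * ‖fderiv ℝ u p (prodBasis m₁ m₂ i)‖ ^ 2) := by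
  have h0 := (one_sub_sq_pos hu.norm_lt).ne'
  have h1 : laplacian (fun x => 1 - ‖u x‖ ^ 2) p
      = -laplacian (fun x => inner ℝ (u x) (u x)) p := by
    have h := secondOrderOp_sub (contDiffAt_const (c := (1 : ℝ)))
      (hu.contDiffAt.inner ℝ hu.contDiffAt) (prodBasis m₁ m₂) (weight p) (drift p)
    rw [secondOrderOp_const, zero_sub] at h
    simp only [real_inner_self_eq_norm_sq] at h ⊢
    exact h
  rw [h1, laplacian_inner hu.contDiffAt hu.contDiffAt, real_inner_comm (u p) (laplacian u p),
    hu.inner_laplacian]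
  simp only [fderiv_one_sub_norm_sq (hu.contDiffAt.differentiableAt (by norm_num)),
    real_inner_self_eq_norm_sq, Finset.mul_sum, ← Finset.sum_neg_distrib, ← Finset.sum_add_distrib]
  refine Finset.sum_congr rfl fun i _ => ?_
  field_simp
  ring

theorem contDiffAt_inv_one_sub_norm_sq (hu : ContDiffAt ℝ 2 u p) (h : ‖u p‖ < 1) :
    ContDiffAt ℝ 2 (fun x => (1 - ‖u x‖ ^ 2)⁻¹) p :=
  (contDiffAt_one_sub_norm_sq hu).inv (one_sub_sq_pos h).ne'

theorem fderiv_inv_one_sub_norm_sq (hu : DifferentiableAt ℝ u p) (h : ‖u p‖ < 1)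
    (e : Euc m₁ × Euc m₂) :
    fderiv ℝ (fun x => (1 - ‖u x‖ ^ 2)⁻¹) p e
      = 2 * ((1 - ‖u p‖ ^ 2)⁻¹) ^ 2 * inner ℝ (u p) (fderiv ℝ u p e) := by
  have h1 := (hu.hasFDerivAt.norm_sq).const_sub 1
  have h2 := (hasDerivAt_inv (one_sub_sq_pos h).ne').comp_hasFDerivAt p h1
  rw [show fderiv ℝ (fun x => (1 - ‖u x‖ ^ 2)⁻¹) p = _ from h2.fderiv]
  simp
  ring

/-- With `a = (1 - ‖u‖²)⁻¹`, the hyperboloid point is `U = (2a - 1, 2a u)`, and in that model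
harmonicity reads `ΔU = |dU|² U` with `|dU|² = 4 a² ∑ wᵢ ‖∂ᵢu‖²`. This is the time component;
`laplacian_smul` is the space component. -/
theorem IsHarmonicAt.laplacian_inv (hu : IsHarmonicAt u p) :
    laplacian (fun x => (1 - ‖u x‖ ^ 2)⁻¹) p =
      (∑ i, weight p i * ‖fderiv ℝ u p (prodBasis m₁ m₂ i)‖ ^ 2)
        * (4 * ((1 - ‖u p‖ ^ 2)⁻¹) ^ 3 - 2 * ((1 - ‖u p‖ ^ 2)⁻¹) ^ 2) := by
  have h0 := (one_sub_sq_pos hu.norm_lt).ne'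
  have hd := hu.contDiffAt.differentiableAt (n := 2) (by norm_num)
  have h1 := laplacian_mul (contDiffAt_one_sub_norm_sq hu.contDiffAt)
    (contDiffAt_inv_one_sub_norm_sq hu.contDiffAt hu.norm_lt)
  -- The Laplacian of the reciprocal is solved for from the product rule applied to the constant
  -- `1`.
  have h2 : laplacian (fun x => (1 - ‖u x‖ ^ 2) * (1 - ‖u x‖ ^ 2)⁻¹) p = 0 := by
    have h3 : (fun x => (1 - ‖u x‖ ^ 2) * (1 - ‖u x‖ ^ 2)⁻¹) =ᶠ[𝓝 p] fun _ => (1 : ℝ) := by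
      have : ∀ᶠ x in 𝓝 p, 1 - ‖u x‖ ^ 2 ≠ 0 :=
        (contDiffAt_one_sub_norm_sq hu.contDiffAt).continuousAt.eventually_ne h0
      filter_upwards [this] with x hx
      exact mul_inv_cancel₀ hx
    have h4 (e : Euc m₁ × Euc m₂) :
        (fun x => fderiv ℝ (fun x => (1 - ‖u x‖ ^ 2) * (1 - ‖u x‖ ^ 2)⁻¹) x e) =ᶠ[𝓝 p]
          fun _ => (0 : ℝ) := by
      filter_upwards [eventually_eventually_nhds.2 h3] with x hx
      rw [Filter.EventuallyEq.fderiv_eq hx]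
      simp
    unfold laplacian secondOrderOp secondDeriv
    simp only [(h4 _).fderiv_eq, h3.fderiv_eq]
    simp
  rw [h2, hu.laplacian_one_sub_norm_sq] at h1
  simp only [fderiv_one_sub_norm_sq hd, fderiv_inv_one_sub_norm_sq hd hu.norm_lt] at h1
  set A := 1 - ‖u p‖ ^ 2
  have h5 : A * laplacian (fun x => (1 - ‖u x‖ ^ 2)⁻¹) p
      = (∑ i, weight p i * ‖fderiv ℝ u p (prodBasis m₁ m₂ i)‖ ^ 2) * (4 * A⁻¹ ^ 2 - 2 * A⁻¹) := by
    rw [eq_neg_of_add_eq_zero_left ((add_assoc _ _ _).symm.trans h1.symm)]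
    simp only [Finset.sum_mul, Finset.mul_sum, ← Finset.sum_add_distrib, ← Finset.sum_neg_distrib]
    refine Finset.sum_congr rfl fun i _ => ?_
    field_simp
    ring
  refine mul_left_cancel₀ h0 (h5.trans ?_)
  field_simp

theorem IsHarmonicAt.laplacian_smul (hu : IsHarmonicAt u p) :
    laplacian (fun x => (1 - ‖u x‖ ^ 2)⁻¹ • u x) p =
      ((∑ i, weight p i * ‖fderiv ℝ u p (prodBasis m₁ m₂ i)‖ ^ 2)
        * (4 * ((1 - ‖u p‖ ^ 2)⁻¹) ^ 3)) • u p := by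
  have h0 := (one_sub_sq_pos hu.norm_lt).ne'
  have hd := hu.contDiffAt.differentiableAt (n := 2) (by norm_num)
  have h1 : laplacian (fun x => (1 - ‖u x‖ ^ 2)⁻¹ • u x) p = _ :=
    secondOrderOp_smul (contDiffAt_inv_one_sub_norm_sq hu.contDiffAt hu.norm_lt) hu.contDiffAt
      (prodBasis m₁ m₂) (weight p) (drift p)
  rw [h1]
  change (1 - ‖u p‖ ^ 2)⁻¹ • laplacian u p + laplacian (fun x => (1 - ‖u x‖ ^ 2)⁻¹) p • u p + _ = _
  rw [hu.laplacian_inv, hu.laplacian_eq]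
  simp only [fderiv_inv_one_sub_norm_sq hd hu.norm_lt, Finset.sum_mul, Finset.sum_smul,
    Finset.smul_sum, smul_neg, ← Finset.sum_add_distrib, ← Finset.sum_neg_distrib, smul_sub,
    smul_smul]
  refine Finset.sum_congr rfl fun i _ => ?_
  set A := 1 - ‖u p‖ ^ 2
  match_scalars <;> field_simp <;> ring

theorem fderiv_smul_self (hu : IsHarmonicAt u p) (e : Euc m₁ × Euc m₂) :
    fderiv ℝ (fun x => (1 - ‖u x‖ ^ 2)⁻¹ • u x) p e
      = (1 - ‖u p‖ ^ 2)⁻¹ • fderiv ℝ u p e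
        + (2 * ((1 - ‖u p‖ ^ 2)⁻¹) ^ 2 * inner ℝ (u p) (fderiv ℝ u p e)) • u p := by
  have hd := hu.contDiffAt.differentiableAt (n := 2) (by norm_num)
  have ha := (contDiffAt_inv_one_sub_norm_sq hu.contDiffAt hu.norm_lt).differentiableAt
    (n := 2) (by norm_num)
  rw [fderiv_fun_smul ha hd]
  simp [fderiv_inv_one_sub_norm_sq hd hu.norm_lt]

/-- `(cosh d - 1) / 2`, where `d` is the hyperbolic distance of `u` and `v`. -/
def distFun (u v : Euc m₁ × Euc m₂ → Euc n) (p : Euc m₁ × Euc m₂) : ℝ :=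
  ‖u p - v p‖ ^ 2 * ((1 - ‖u p‖ ^ 2)⁻¹ * (1 - ‖v p‖ ^ 2)⁻¹)

/-- Since `cosh d = -⟨U, V⟩` in the Lorentzian product, the equations for `U` and `V` give `Δ cosh d
= (|dU|² + |dV|²) cosh d - 2 ⟨dU, dV⟩`. By `lorentz_inner_le` this is at least `∑ wᵢ (|∂ᵢU| -
|∂ᵢV|)² cosh d`. -/
theorem laplacian_distFun_nonneg (hu : IsHarmonicAt u p) (hv : IsHarmonicAt v p) :
    0 ≤ laplacian (distFun u v) p := by
  have hau := contDiffAt_inv_one_sub_norm_sq hu.contDiffAt hu.norm_lt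
  have hav := contDiffAt_inv_one_sub_norm_sq hv.contDiffAt hv.norm_lt
  have hdu := hu.contDiffAt.differentiableAt (n := 2) (by norm_num)
  have hdv := hv.contDiffAt.differentiableAt (n := 2) (by norm_num)
  have hsu : ContDiffAt ℝ 2 (fun x => (1 - ‖u x‖ ^ 2)⁻¹ • u x) p := hau.smul hu.contDiffAt
  have hsv : ContDiffAt ℝ 2 (fun x => (1 - ‖v x‖ ^ 2)⁻¹ • v x) p := hav.smul hv.contDiffAt
  have hnu := (one_sub_sq_pos hu.norm_lt).ne'
  have hnv := (one_sub_sq_pos hv.norm_lt).ne'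
  -- The same function expanded in hyperboloid coordinates, so that the Laplacian formulas for `a`
  -- and `a • u` apply term by term.
  let Q : Euc m₁ × Euc m₂ → ℝ := fun x =>
    ((2 * ((1 - ‖u x‖ ^ 2)⁻¹ * (1 - ‖v x‖ ^ 2)⁻¹) - (1 - ‖u x‖ ^ 2)⁻¹) - (1 - ‖v x‖ ^ 2)⁻¹)
      - 2 * inner ℝ ((1 - ‖u x‖ ^ 2)⁻¹ • u x) ((1 - ‖v x‖ ^ 2)⁻¹ • v x)
  have hQ : distFun u v =ᶠ[𝓝 p] Q := by
    have h1 := (contDiffAt_one_sub_norm_sq hu.contDiffAt).continuousAt.eventually_ne hnu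
    have h2 := (contDiffAt_one_sub_norm_sq hv.contDiffAt).continuousAt.eventually_ne hnv
    filter_upwards [h1, h2] with x hx1 hx2
    simp only [distFun, Q, norm_sub_sq_real, real_inner_smul_left, real_inner_smul_right]
    field_simp
    ring
  have hQ2 : laplacian (distFun u v) p = laplacian Q p := by
    have h4 (e : Euc m₁ × Euc m₂) :
        (fun x => fderiv ℝ (distFun u v) x e) =ᶠ[𝓝 p] fun x => fderiv ℝ Q x e := by
      filter_upwards [eventually_eventually_nhds.2 hQ] with x hx
      rw [Filter.EventuallyEq.fderiv_eq hx]
    unfold laplacian secondOrderOp secondDeriv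
    simp only [(h4 _).fderiv_eq, hQ.fderiv_eq]
  set a := (1 - ‖u p‖ ^ 2)⁻¹ with ha
  set b := (1 - ‖v p‖ ^ 2)⁻¹ with hb
  have ha0 : 0 < a := inv_pos.2 (one_sub_sq_pos hu.norm_lt)
  have hb0 : 0 < b := inv_pos.2 (one_sub_sq_pos hv.norm_lt)
  set du := fun i => fderiv ℝ u p (prodBasis m₁ m₂ i) with hdu'
  set dv := fun i => fderiv ℝ v p (prodBasis m₁ m₂ i) with hdv'
  have hL : laplacian Q p =
      2 * (a * laplacian (fun x => (1 - ‖v x‖ ^ 2)⁻¹) p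
        + laplacian (fun x => (1 - ‖u x‖ ^ 2)⁻¹) p * b
        + 2 * ∑ i, weight p i * ((2 * a ^ 2 * inner ℝ (u p) (du i))
          * (2 * b ^ 2 * inner ℝ (v p) (dv i))))
      - laplacian (fun x => (1 - ‖u x‖ ^ 2)⁻¹) p - laplacian (fun x => (1 - ‖v x‖ ^ 2)⁻¹) p
      - 2 * (inner ℝ (a • u p) (laplacian (fun x => (1 - ‖v x‖ ^ 2)⁻¹ • v x) p)
        + inner ℝ (laplacian (fun x => (1 - ‖u x‖ ^ 2)⁻¹ • u x) p) (b • v p)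
        + 2 * ∑ i, weight p i * inner ℝ (a • du i + (2 * a ^ 2 * inner ℝ (u p) (du i)) • u p)
          (b • dv i + (2 * b ^ 2 * inner ℝ (v p) (dv i)) • v p)) := by
    have e1 := laplacian_mul hau hav
    simp only [fderiv_inv_one_sub_norm_sq hdu hu.norm_lt,
      fderiv_inv_one_sub_norm_sq hdv hv.norm_lt] at e1
    have e2 := laplacian_inner hsu hsv
    simp only [fderiv_smul_self hu, fderiv_smul_self hv] at e2
    rw [← e1, ← e2]
    have hab := hau.mul hav
    have hin := hsu.inner ℝ hsv
    have s1 := secondOrderOp_sub ((((contDiffAt_const (c := (2 : ℝ))).mul hab).sub hau).sub hav)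
      ((contDiffAt_const (c := (2 : ℝ))).mul hin) (prodBasis m₁ m₂) (weight p) (drift p)
    have s2 := secondOrderOp_sub (((contDiffAt_const (c := (2 : ℝ))).mul hab).sub hau) hav
      (prodBasis m₁ m₂) (weight p) (drift p)
    have s3 := secondOrderOp_sub ((contDiffAt_const (c := (2 : ℝ))).mul hab) hau
      (prodBasis m₁ m₂) (weight p) (drift p)
    have s4 := secondOrderOp_const_mul hab 2 (prodBasis m₁ m₂) (weight p) (drift p)
    have s5 := secondOrderOp_const_mul hin 2 (prodBasis m₁ m₂) (weight p) (drift p)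
    refine s1.trans ?_
    rw [s2, s3, s4, s5]
    rfl
  rw [hQ2, hL, hu.laplacian_inv, hv.laplacian_inv, hu.laplacian_smul, hv.laplacian_smul]
  simp only [← ha, ← hb]
  have hsum : ∀ i, 0 ≤ weight p i *
      (2 * (‖du i‖ ^ 2 * a ^ 2 + ‖dv i‖ ^ 2 * b ^ 2)
        * ((2 * a - 1) * (2 * b - 1) - 4 * a * b * inner ℝ (u p) (v p))
        - 4 * (a * b * (inner ℝ (du i) (dv i) + 2 * a * inner ℝ (u p) (du i) * inner ℝ (u p) (dv i)
          + 2 * b * inner ℝ (v p) (du i) * inner ℝ (v p) (dv i)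
          + 4 * a * b * (inner ℝ (u p) (v p) - 1) * inner ℝ (u p) (du i) * inner ℝ (v p) (dv i))))
      := by
    intro i
    refine mul_nonneg (weight_nonneg p i) ?_
    have h1 := lorentz_inner_le hu.norm_lt hv.norm_lt (du i) (dv i)
      (inv_mul_cancel₀ hnu) (inv_mul_cancel₀ hnv)
    rw [← ha, ← hb] at h1
    set C := (2 * a - 1) * (2 * b - 1) - 4 * a * b * inner ℝ (u p) (v p) with hC
    have hC0 : 0 ≤ C := by
      have h2 := norm_sub_sq_real (u p) (v p)
      have e1 : a * (1 - ‖u p‖ ^ 2) = 1 := inv_mul_cancel₀ hnu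
      have e2 : b * (1 - ‖v p‖ ^ 2) = 1 := inv_mul_cancel₀ hnv
      have : C = 1 + 2 * (a * b * ‖u p - v p‖ ^ 2) := by
        rw [h2, hC]
        linear_combination (2 * b) * e1 + (2 * a) * e2
      have : 0 ≤ a * b * ‖u p - v p‖ ^ 2 := by positivity
      linarith
    have h2 := mul_le_mul_of_nonneg_left h1 (by positivity : 0 ≤ 4 * (a * b))
    have h3 := mul_nonneg hC0 (sq_nonneg (a * ‖du i‖ - b * ‖dv i‖))
    nlinarith [h2, h3]
  have := Finset.sum_nonneg fun i (_ : i ∈ Finset.univ) => hsum i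
  refine this.trans_eq ?_
  simp only [inner_add_left, inner_add_right, real_inner_smul_left, real_inner_smul_right,
    Finset.sum_mul, Finset.mul_sum, ← Finset.sum_add_distrib, ← Finset.sum_sub_distrib]
  refine Finset.sum_congr rfl fun i _ => ?_
  rw [real_inner_comm (v p) (du i)]
  simp only [hdu', hdv']
  ring

end Harmonic

/-! ### A maximum principle with data on the corner only -/

section MaximumPrinciple

variable {m₁ m₂ n : ℕ}

/-- The closed domain without the corner. -/
def offCorner (m₁ m₂ : ℕ) : Set (Euc m₁ × Euc m₂) := closedDomain m₁ m₂ \ corner m₁ m₂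

theorem mem_domain_iff {p : Euc m₁ × Euc m₂} : p ∈ domain m₁ m₂ ↔ ‖p.1‖ < 1 ∧ ‖p.2‖ < 1 := by
  simp [domain, openBall, Set.mem_prod]

theorem mem_closedDomain_iff {p : Euc m₁ × Euc m₂} :
    p ∈ closedDomain m₁ m₂ ↔ ‖p.1‖ ≤ 1 ∧ ‖p.2‖ ≤ 1 := by
  simp [closedDomain, closedUnitBall, Set.mem_prod]

theorem mem_corner_iff {p : Euc m₁ × Euc m₂} : p ∈ corner m₁ m₂ ↔ ‖p.1‖ = 1 ∧ ‖p.2‖ = 1 := by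
  simp [corner, Set.mem_prod]

theorem corner_subset_closedDomain : corner m₁ m₂ ⊆ closedDomain m₁ m₂ := fun p hp => by
  rw [mem_corner_iff] at hp
  exact mem_closedDomain_iff.2 ⟨hp.1.le, hp.2.le⟩

theorem domain_subset_offCorner : domain m₁ m₂ ⊆ offCorner m₁ m₂ := fun p hp => by
  rw [mem_domain_iff] at hp
  exact ⟨mem_closedDomain_iff.2 ⟨hp.1.le, hp.2.le⟩, fun h => by
    rw [mem_corner_iff] at h; linarith [h.1, hp.1]⟩

theorem domain_subset_closedDomain : domain m₁ m₂ ⊆ closedDomain m₁ m₂ :=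
  fun _ hp => (domain_subset_offCorner hp).1

theorem closure_domain : closure (domain m₁ m₂) = closedDomain m₁ m₂ := by
  unfold domain closedDomain openBall closedUnitBall
  rw [closure_prod_eq, closure_ball _ one_ne_zero, closure_ball _ one_ne_zero]

theorem isCompact_closedDomain : IsCompact (closedDomain m₁ m₂) :=
  (isCompact_closedBall _ _).prod (isCompact_closedBall _ _)

theorem isClosed_corner : IsClosed (corner m₁ m₂) :=
  Metric.isClosed_sphere.prod Metric.isClosed_sphere

theorem convex_closedDomain : Convex ℝ (closedDomain m₁ m₂) :=
  (convex_closedBall _ _).prod (convex_closedBall _ _)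

theorem uniqueDiffOn_closedDomain : UniqueDiffOn ℝ (closedDomain m₁ m₂) := by
  refine uniqueDiffOn_convex convex_closedDomain ⟨0, ?_⟩
  refine mem_interior_iff_mem_nhds.2 (Filter.mem_of_superset
    (isOpen_domain.mem_nhds (?_ : (0 : Euc m₁ × Euc m₂) ∈ domain m₁ m₂))
    domain_subset_closedDomain)
  rw [mem_domain_iff]
  simp

theorem uniqueDiffOn_offCorner : UniqueDiffOn ℝ (offCorner m₁ m₂) :=
  uniqueDiffOn_closedDomain.inter isClosed_corner.isOpen_compl

/-- The sum of the squared distances of the two components to those of `c`. -/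
def sqDist (c x : Euc m₁ × Euc m₂) : ℝ := ‖x.1 - c.1‖ ^ 2 + ‖x.2 - c.2‖ ^ 2

theorem contDiff_sqDist (c : Euc m₁ × Euc m₂) {k : WithTop ℕ∞} : ContDiff ℝ k (sqDist c) :=
  ((contDiff_fst.sub contDiff_const).norm_sq ℝ).add ((contDiff_snd.sub contDiff_const).norm_sq ℝ)

theorem laplacian_sqDist (c p : Euc m₁ × Euc m₂) :
    laplacian (sqDist c) p
      = 2 * inner ℝ (p.1 - c.1) (drift p).1 + 2 * inner ℝ (p.2 - c.2) (drift p).2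
        + ((m₁ + 1) * (1 - ‖p.1‖ ^ 2) ^ 2 + (m₂ + 1) * (1 - ‖p.2‖ ^ 2) ^ 2) / 2 := by
  have hf1 : ContDiffAt ℝ 2 (fun x : Euc m₁ × Euc m₂ => x.1 - c.1) p :=
    contDiffAt_fst.sub contDiffAt_const
  have hf2 : ContDiffAt ℝ 2 (fun x : Euc m₁ × Euc m₂ => x.2 - c.2) p :=
    contDiffAt_snd.sub contDiffAt_const
  have d1 (e) : fderiv ℝ (fun x : Euc m₁ × Euc m₂ => x.1 - c.1) p e = e.1 := by
    rw [fderiv_sub_const, fderiv_fst]; rfl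
  have d2 (e) : fderiv ℝ (fun x : Euc m₁ × Euc m₂ => x.2 - c.2) p e = e.2 := by
    rw [fderiv_sub_const, fderiv_snd]; rfl
  have l1 : secondOrderOp (prodBasis m₁ m₂) (weight p) (drift p)
      (fun x : Euc m₁ × Euc m₂ => x.1 - c.1) p = (drift p).1 := by
    rw [secondOrderOp_sub contDiffAt_fst contDiffAt_const, secondOrderOp_const, sub_zero]
    exact secondOrderOp_clm (ContinuousLinearMap.fst ℝ (Euc m₁) (Euc m₂)) _ _ _ _
  have l2 : secondOrderOp (prodBasis m₁ m₂) (weight p) (drift p)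
      (fun x : Euc m₁ × Euc m₂ => x.2 - c.2) p = (drift p).2 := by
    rw [secondOrderOp_sub contDiffAt_snd contDiffAt_const, secondOrderOp_const, sub_zero]
    exact secondOrderOp_clm (ContinuousLinearMap.snd ℝ (Euc m₁) (Euc m₂)) _ _ _ _
  have h1 := secondOrderOp_inner hf1 hf1 (prodBasis m₁ m₂) (weight p) (drift p)
  have h2 := secondOrderOp_inner hf2 hf2 (prodBasis m₁ m₂) (weight p) (drift p)
  simp only [d1, l1] at h1
  simp only [d2, l2] at h2
  have h3 := secondOrderOp_add (hf1.inner ℝ hf1) (hf2.inner ℝ hf2) (prodBasis m₁ m₂)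
    (weight p) (drift p)
  rw [h1, h2] at h3
  simp only [real_inner_self_eq_norm_sq] at h3
  refine h3.trans ?_
  rw [real_inner_comm (p.1 - c.1) (drift p).1, real_inner_comm (p.2 - c.2) (drift p).2]
  have nb {k : ℕ} (i : Fin (k + 1)) : ‖stdBasis k i‖ = 1 := by simp [stdBasis_apply]
  simp only [Fintype.sum_sum_type, prodBasis_inl, prodBasis_inr, nb, weight, Sum.elim_inl,
    Sum.elim_inr, norm_zero, Finset.sum_const, Finset.card_univ, Fintype.card_fin, nsmul_eq_mul]
  push_cast
  ring

/-- Supplies the strictly subharmonic perturbation: the lower bound stays positive on the open faces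
and vanishes on the corner alone. The drift contributes with a nonnegative sign because `m₁, m₂ ≥
1`. -/
theorem laplacian_sqDist_zero_ge (hm₁ : 1 ≤ m₁) (hm₂ : 1 ≤ m₂) {p : Euc m₁ × Euc m₂}
    (hp : p ∈ domain m₁ m₂) :
    ((1 - ‖p.1‖ ^ 2) ^ 2 + (1 - ‖p.2‖ ^ 2) ^ 2) / 2 ≤ laplacian (sqDist 0) p := by
  rw [laplacian_sqDist]
  rw [mem_domain_iff] at hp
  have h1 := one_sub_sq_pos hp.1
  have h2 := one_sub_sq_pos hp.2
  have k1 : (1 : ℝ) ≤ m₁ := by exact_mod_cast hm₁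
  have k2 : (1 : ℝ) ≤ m₂ := by exact_mod_cast hm₂
  simp only [Prod.fst_zero, Prod.snd_zero, sub_zero, drift, real_inner_smul_right,
    real_inner_self_eq_norm_sq]
  have a1 : 0 ≤ ((m₁ : ℝ) - 1) / 2 * (1 - ‖p.1‖ ^ 2) * ‖p.1‖ ^ 2 :=
    mul_nonneg (mul_nonneg (by linarith) h1.le) (sq_nonneg _)
  have a2 : 0 ≤ ((m₂ : ℝ) - 1) / 2 * (1 - ‖p.2‖ ^ 2) * ‖p.2‖ ^ 2 :=
    mul_nonneg (mul_nonneg (by linarith) h2.le) (sq_nonneg _)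
  have b1 : 0 ≤ (m₁ : ℝ) * (1 - ‖p.1‖ ^ 2) ^ 2 := by positivity
  have b2 : 0 ≤ (m₂ : ℝ) * (1 - ‖p.2‖ ^ 2) ^ 2 := by positivity
  linarith

theorem eventually_add_smul_mem_offCorner {p : Euc m₁ × Euc m₂} (hp : p ∈ offCorner m₁ m₂)
    {i : Fin (m₁ + 1) ⊕ Fin (m₂ + 1)} (hi : weight p i ≠ 0) :
    ∀ᶠ t : ℝ in 𝓝 0, p + t • prodBasis m₁ m₂ i ∈ offCorner m₁ m₂ := by
  have hc := mem_closedDomain_iff.1 hp.1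
  rcases i with i | i
  · have h1 : ‖p.1‖ < 1 := lt_of_le_of_ne hc.1 fun h => hi (by simp [weight, h])
    have h2 : Continuous fun t : ℝ => ‖p.1 + t • stdBasis m₁ i‖ := by fun_prop
    have h3 : ∀ᶠ t : ℝ in 𝓝 0, ‖p.1 + t • stdBasis m₁ i‖ < 1 :=
      h2.continuousAt.eventually_lt continuousAt_const (by simpa using h1)
    filter_upwards [h3] with t ht
    refine ⟨mem_closedDomain_iff.2 ?_, fun h => ?_⟩
    · simpa [prodBasis_inl] using And.intro ht.le hc.2
    · have := (mem_corner_iff.1 h).1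
      simp only [prodBasis_inl, Prod.fst_add, Prod.smul_fst] at this
      linarith
  · have h1 : ‖p.2‖ < 1 := lt_of_le_of_ne hc.2 fun h => hi (by simp [weight, h])
    have h2 : Continuous fun t : ℝ => ‖p.2 + t • stdBasis m₂ i‖ := by fun_prop
    have h3 : ∀ᶠ t : ℝ in 𝓝 0, ‖p.2 + t • stdBasis m₂ i‖ < 1 :=
      h2.continuousAt.eventually_lt continuousAt_const (by simpa using h1)
    filter_upwards [h3] with t ht
    refine ⟨mem_closedDomain_iff.2 ?_, fun h => ?_⟩
    · simpa [prodBasis_inr] using And.intro hc.1 ht.le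
    · have := (mem_corner_iff.1 h).2
      simp only [prodBasis_inr, Prod.snd_add, Prod.smul_snd] at this
      linarith

/-- A direction with vanishing weight also has vanishing drift, both being governed by the same
factor `1 - ‖pⱼ‖²`. Only directions in which the line stays in `S` on both sides contribute, even
when the point lies on a face. -/
theorem laplacianWithin_nonpos_of_isMaxOn {S : Set (Euc m₁ × Euc m₂)} (hS : UniqueDiffOn ℝ S)
    {f : Euc m₁ × Euc m₂ → ℝ} (hf : ContDiffOn ℝ 2 f S) {p : Euc m₁ × Euc m₂}
    (hmax : IsMaxOn f S p)
    (hdir : ∀ i, weight p i ≠ 0 → ∀ᶠ t : ℝ in 𝓝 0, p + t • prodBasis m₁ m₂ i ∈ S) :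
    secondOrderOpWithin (prodBasis m₁ m₂) (weight p) (drift p) S f p ≤ 0 := by
  have key (i) (hi : weight p i ≠ 0) :=
    fderivWithin_eq_zero_and_second_nonpos hS hf hmax (hdir i hi)
  have h0 : fderivWithin ℝ f S p (drift p) = 0 := by
    rw [clm_eq_sum_stdBasis]
    have h1 (i) : (drift p).1 i • fderivWithin ℝ f S p (prodBasis m₁ m₂ (Sum.inl i)) = 0 := by
      by_cases hi : weight p (Sum.inl i) = 0
      · have : 1 - ‖p.1‖ ^ 2 = 0 := by simpa [weight] using hi
        simp [drift, this]
      · rw [(key _ hi).1, smul_zero]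
    have h2 (i) : (drift p).2 i • fderivWithin ℝ f S p (prodBasis m₁ m₂ (Sum.inr i)) = 0 := by
      by_cases hi : weight p (Sum.inr i) = 0
      · have : 1 - ‖p.2‖ ^ 2 = 0 := by simpa [weight] using hi
        simp [drift, this]
      · rw [(key _ hi).1, smul_zero]
    simp only [h1, h2, Finset.sum_const_zero, add_zero]
  unfold secondOrderOpWithin
  rw [h0, add_zero]
  refine Finset.sum_nonpos fun i _ => ?_
  by_cases hi : weight p i = 0
  · simp [hi]
  · exact mul_nonpos_of_nonneg_of_nonpos (weight_nonneg p i) (key i hi).2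

theorem continuous_weight (i) : Continuous fun p : Euc m₁ × Euc m₂ => weight p i := by
  rcases i with i | i <;> simp only [weight, Sum.elim_inl, Sum.elim_inr] <;> fun_prop

theorem continuous_drift : Continuous (drift : Euc m₁ × Euc m₂ → Euc m₁ × Euc m₂) := by
  unfold drift; fun_prop

theorem continuousOn_laplacianWithin {S : Set (Euc m₁ × Euc m₂)} (hS : UniqueDiffOn ℝ S)
    {f : Euc m₁ × Euc m₂ → ℝ} (hf : ContDiffOn ℝ 2 f S) :
    ContinuousOn (fun p =>
      secondOrderOpWithin (prodBasis m₁ m₂) (weight p) (drift p) S f p) S := by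
  have hf1 : ContDiffOn ℝ 1 (fderivWithin ℝ f S) S := hf.fderivWithin hS (by norm_num)
  refine ContinuousOn.add (continuousOn_finsetSum _ fun i _ => ?_) ?_
  · refine (continuous_weight i).continuousOn.smul ?_
    exact ((hf1.clm_apply contDiffOn_const).continuousOn_fderivWithin hS (by norm_num)).clm_apply
      continuousOn_const
  · exact hf1.continuousOn.clm_apply continuous_drift.continuousOn

/-- A function that is subharmonic for the product of the Poincaré metrics, `C²` up to the
boundary off the corner, and tends to zero at the corner, is nonpositive. -/
theorem nonpos_of_laplacian_nonneg (hm₁ : 1 ≤ m₁) (hm₂ : 1 ≤ m₂) {f : Euc m₁ × Euc m₂ → ℝ}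
    (hf : ContDiffOn ℝ 2 f (offCorner m₁ m₂)) (hlap : ∀ p ∈ domain m₁ m₂, 0 ≤ laplacian f p)
    (hlim : ∀ q ∈ corner m₁ m₂, Filter.Tendsto f (𝓝[offCorner m₁ m₂] q) (𝓝 0))
    {p : Euc m₁ × Euc m₂} (hp : p ∈ offCorner m₁ m₂) : f p ≤ 0 := by
  classical
  by_contra! hpos
  -- On the closed domain `sqDist 0 ≤ 2`, so the perturbed function is at most `2 ε < f p` on the
  -- corner and cannot have its maximum there.
  obtain ⟨ε, hε, hεp⟩ : ∃ ε : ℝ, 0 < ε ∧ 2 * ε < f p := ⟨f p / 4, by linarith, by linarith⟩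
  have hS := uniqueDiffOn_offCorner (m₁ := m₁) (m₂ := m₂)
  set S := offCorner m₁ m₂ with hSdef
  set W : Euc m₁ × Euc m₂ → ℝ := fun x => f x + ε * sqDist 0 x with hW
  have hWS : ContDiffOn ℝ 2 W S := hf.add (contDiffOn_const.mul (contDiff_sqDist 0).contDiffOn)
  -- Extended by zero to the corner, `f` is continuous on a compact set, so a maximum exists.
  have hcont : ContinuousOn (fun x => (if x ∈ corner m₁ m₂ then 0 else f x) + ε * sqDist 0 x)
      (closedDomain m₁ m₂) := by
    refine ContinuousOn.add ?_ (continuous_const.mul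
      (contDiff_sqDist (k := 0) 0).continuous).continuousOn
    intro q hq
    by_cases hqc : q ∈ corner m₁ m₂
    · have hset : closedDomain m₁ m₂ = corner m₁ m₂ ∪ S :=
        (Set.union_sdiff_cancel corner_subset_closedDomain).symm
      rw [hset]
      refine ContinuousWithinAt.union ?_ ?_
      · refine (continuousWithinAt_const (b := (0 : ℝ))).congr (fun x hx => if_pos hx)
          (if_pos hqc)
      · unfold ContinuousWithinAt
        beta_reduce
        rw [if_pos hqc]
        refine (hlim q hqc).congr' ?_
        filter_upwards [self_mem_nhdsWithin] with x hx
        rw [if_neg hx.2]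
    · have h1 : ContinuousWithinAt f (closedDomain m₁ m₂) q := by
        have := hf.continuousOn q ⟨hq, hqc⟩
        refine this.mono_of_mem_nhdsWithin ?_
        exact Filter.inter_mem self_mem_nhdsWithin
          (mem_nhdsWithin_of_mem_nhds (isClosed_corner.isOpen_compl.mem_nhds hqc))
      refine h1.congr_of_eventuallyEq ?_ (if_neg hqc)
      filter_upwards [mem_nhdsWithin_of_mem_nhds (isClosed_corner.isOpen_compl.mem_nhds hqc)]
        with x hx
      exact if_neg hx
  obtain ⟨q, hq, hmax⟩ := isCompact_closedDomain.exists_isMaxOn ⟨p, hp.1⟩ hcont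
  have hsq : ∀ x ∈ closedDomain m₁ m₂, sqDist 0 x ≤ 2 := by
    intro x hx
    rw [mem_closedDomain_iff] at hx
    simp only [sqDist, Prod.fst_zero, Prod.snd_zero, sub_zero]
    nlinarith [norm_nonneg x.1, norm_nonneg x.2]
  have hsq0 : ∀ x : Euc m₁ × Euc m₂, 0 ≤ sqDist 0 x := fun x => by unfold sqDist; positivity
  have hqc : q ∉ corner m₁ m₂ := by
    intro h
    have h1 := hmax hp.1
    simp only [Set.mem_ofPred_eq, if_pos h, if_neg hp.2] at h1
    nlinarith [hsq q hq, hsq0 p]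
  have hqS : q ∈ S := ⟨hq, hqc⟩
  have hmaxW : IsMaxOn W S q := by
    intro x hx
    have h1 := hmax hx.1
    simpa only [Set.mem_ofPred_eq, if_neg hqc, if_neg hx.2] using h1
  have hle := laplacianWithin_nonpos_of_isMaxOn hS hWS hmaxW
    fun i hi => eventually_add_smul_mem_offCorner hqS hi
  -- The inequality is known in the open domain. It passes to the face by continuity of the operator
  -- applied to a function that is `C²` off the corner.
  have hge : ε * (((1 - ‖q.1‖ ^ 2) ^ 2 + (1 - ‖q.2‖ ^ 2) ^ 2) / 2) ≤
      secondOrderOpWithin (prodBasis m₁ m₂) (weight q) (drift q) S W q := by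
    have hcl : q ∈ closure (domain m₁ m₂) := by rw [closure_domain]; exact hq
    have := mem_closure_iff_nhdsWithin_neBot.1 hcl
    have c1 := ((continuousOn_laplacianWithin hS hWS) q hqS).mono domain_subset_offCorner
    have c2 : Continuous fun q : Euc m₁ × Euc m₂ =>
      ε * (((1 - ‖q.1‖ ^ 2) ^ 2 + (1 - ‖q.2‖ ^ 2) ^ 2) / 2) := by fun_prop
    refine le_of_tendsto_of_tendsto c2.continuousWithinAt c1 ?_
    filter_upwards [self_mem_nhdsWithin] with x hx
    have hn : S ∈ 𝓝 x := Filter.mem_of_superset (isOpen_domain.mem_nhds hx) domain_subset_offCorner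
    rw [secondOrderOpWithin_of_mem_nhds hn]
    have h1 := secondOrderOp_add (hf.contDiffAt hn)
      ((contDiffAt_const (c := ε)).mul (contDiff_sqDist 0).contDiffAt)
      (prodBasis m₁ m₂) (weight x) (drift x)
    rw [secondOrderOp_const_mul (contDiff_sqDist 0).contDiffAt] at h1
    change _ ≤ secondOrderOp _ _ _ (fun x => f x + ε * sqDist 0 x) x
    rw [h1]
    have h2 := hlap x hx
    have h3 := mul_le_mul_of_nonneg_left (laplacian_sqDist_zero_ge hm₁ hm₂ hx) hε.le
    unfold laplacian at h2 h3
    linarith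
  have hz : (1 - ‖q.1‖ ^ 2) ^ 2 + (1 - ‖q.2‖ ^ 2) ^ 2 ≤ 0 := by
    have : ε * (((1 - ‖q.1‖ ^ 2) ^ 2 + (1 - ‖q.2‖ ^ 2) ^ 2) / 2) ≤ 0 := hge.trans hle
    by_contra! h
    have : 0 < ε * (((1 - ‖q.1‖ ^ 2) ^ 2 + (1 - ‖q.2‖ ^ 2) ^ 2) / 2) := by positivity
    linarith
  refine hqc (mem_corner_iff.2 ?_)
  have h1 : (1 - ‖q.1‖ ^ 2) ^ 2 = 0 := le_antisymm (by nlinarith [sq_nonneg (1 - ‖q.2‖ ^ 2)])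
    (sq_nonneg _)
  have h2 : (1 - ‖q.2‖ ^ 2) ^ 2 = 0 := le_antisymm (by nlinarith [sq_nonneg (1 - ‖q.1‖ ^ 2)])
    (sq_nonneg _)
  have g (y : ℝ) (hy : 0 ≤ y) (h : (1 - y ^ 2) ^ 2 = 0) : y = 1 := by
    have : 1 - y ^ 2 = 0 := pow_eq_zero_iff (two_ne_zero) |>.1 h
    nlinarith
  exact ⟨g _ (norm_nonneg _) h1, g _ (norm_nonneg _) h2⟩

end MaximumPrinciple

/-! ### Quadratic barriers near a corner point -/

section Dilation

variable {m₁ m₂ n : ℕ}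

theorem norm_sub_le_of_sqDist_le {c x : Euc m₁ × Euc m₂} {r : ℝ} (hr : 0 ≤ r)
    (h : sqDist c x ≤ r ^ 2) : ‖x - c‖ ≤ r := by
  unfold sqDist at h
  rw [Prod.norm_def, max_le_iff]
  exact ⟨le_of_sq_le_sq (by simp only [Prod.fst_sub]; nlinarith [sq_nonneg ‖x.2 - c.2‖]) hr,
    le_of_sq_le_sq (by simp only [Prod.snd_sub]; nlinarith [sq_nonneg ‖x.1 - c.1‖]) hr⟩

/-- `G - κ * sqDist c` has positive Laplacian, so its maximum over the Euclidean ball about `c` lies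
on the bounding sphere. There the barrier is constant, and `G` must have grown by at least `κ ρ²`
from the centre. -/
theorem exists_sqDist_eq_of_laplacian_pos {G : Euc m₁ × Euc m₂ → ℝ}
    (hG : ContDiffOn ℝ 2 G (domain m₁ m₂)) {c : Euc m₁ × Euc m₂} {ρ κ : ℝ} (hρ : 0 < ρ)
    (hdom : ∀ x, sqDist c x ≤ ρ ^ 2 → x ∈ domain m₁ m₂)
    (hlap : ∀ x, sqDist c x ≤ ρ ^ 2 → κ * laplacian (sqDist c) x < laplacian G x) :
    ∃ x, sqDist c x = ρ ^ 2 ∧ G c ≤ G x - κ * ρ ^ 2 := by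
  have hc0 : sqDist c c = 0 := by simp [sqDist]
  have hψ : Continuous (sqDist c) := (contDiff_sqDist (k := 0) c).continuous
  set T := {x | sqDist c x ≤ ρ ^ 2} with hT
  have hTc : IsCompact T := by
    refine Metric.isCompact_of_isClosed_isBounded (isClosed_le hψ continuous_const) ?_
    refine (Metric.isBounded_closedBall (x := c) (r := ρ)).subset fun x hx => ?_
    rw [mem_closedBall_iff_norm]
    exact norm_sub_le_of_sqDist_le hρ.le hx
  have hW : ContDiffOn ℝ 2 (fun x => G x - κ * sqDist c x) (domain m₁ m₂) :=
    hG.sub (contDiffOn_const.mul (contDiff_sqDist c).contDiffOn)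
  obtain ⟨x, hx, hmax⟩ := hTc.exists_isMaxOn ⟨c, by simp [hT, hc0, sq_nonneg]⟩
    (hW.continuousOn.mono hdom)
  have hmaxc := hmax (show c ∈ T by simp [hT, hc0, sq_nonneg])
  simp only [Set.mem_ofPred_eq, hc0, mul_zero, sub_zero] at hmaxc
  rcases lt_or_eq_of_le (show sqDist c x ≤ ρ ^ 2 from hx) with hlt | heq
  · exfalso
    set S := {x | sqDist c x < ρ ^ 2} with hS
    have hSo : IsOpen S := isOpen_lt hψ continuous_const
    have hST : S ⊆ T := fun y hy =>
      (show sqDist c y < ρ ^ 2 from hy).le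
    have hSn : S ∈ 𝓝 x := hSo.mem_nhds hlt
    have h1 := laplacianWithin_nonpos_of_isMaxOn hSo.uniqueDiffOn
      (hW.mono fun y hy => hdom y (hST hy)) (hmax.on_subset hST) (fun i _ => by
        have hl : Continuous fun t : ℝ => x + t • prodBasis m₁ m₂ i := by fun_prop
        exact hl.continuousAt.eventually_mem (by simpa using hSn))
    rw [secondOrderOpWithin_of_mem_nhds hSn, secondOrderOp_sub
      (hG.contDiffAt (isOpen_domain.mem_nhds (hdom x hx)))
      ((contDiffAt_const (c := κ)).mul (contDiff_sqDist c).contDiffAt),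
      secondOrderOp_const_mul (contDiff_sqDist c).contDiffAt] at h1
    have h2 := hlap x hx
    unfold laplacian at h2
    linarith
  · exact ⟨x, heq, by rw [← heq]; exact hmaxc⟩

theorem abs_one_sub_norm_sq_le {k : ℕ} {q z : Euc k} (hq : ‖q‖ = 1) {t R : ℝ} (ht : 0 < t)
    (ht1 : t ≤ 1) (hz : ‖z‖ ≤ R) : |1 - ‖q + t • z‖ ^ 2| ≤ t * (2 * R + R ^ 2) := by
  have h1 : 1 - ‖q + t • z‖ ^ 2 = -(t * (2 * inner ℝ q z + t * ‖z‖ ^ 2)) := by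
    rw [norm_add_sq_real, hq, real_inner_smul_right, norm_smul, Real.norm_eq_abs, mul_pow, sq_abs]
    ring
  have hR : 0 ≤ R := (norm_nonneg z).trans hz
  have h2 : |inner ℝ q z| ≤ R := by
    refine (abs_real_inner_le_norm q z).trans ?_
    rw [hq, one_mul]; exact hz
  rw [h1, abs_neg, abs_mul, abs_of_pos ht]
  refine mul_le_mul_of_nonneg_left ?_ ht.le
  refine (abs_add_le _ _).trans (add_le_add ?_ ?_)
  · rw [abs_mul, abs_two]; linarith
  · rw [abs_of_nonneg (by positivity)]
    have : ‖z‖ ^ 2 ≤ R ^ 2 := pow_le_pow_left₀ (norm_nonneg z) hz 2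
    nlinarith [sq_nonneg ‖z‖]

/-- At distance of order `t` from the corner the weights are `O(t²)`, and the drift is `O(t)` and is
paired with a displacement `O(t)`. -/
theorem exists_laplacian_sqDist_le {q z₀ : Euc m₁ × Euc m₂} (hq : q ∈ corner m₁ m₂) {r : ℝ}
    (hr : 0 < r) : ∃ M : ℝ, 0 < M ∧ ∀ t : ℝ, 0 < t → t ≤ 1 → ∀ z : Euc m₁ × Euc m₂,
      ‖z - z₀‖ ≤ r → q + t • z ∈ domain m₁ m₂ →
        laplacian (sqDist (q + t • z₀)) (q + t • z) ≤ M * t ^ 2 := by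
  rw [mem_corner_iff] at hq
  set R := ‖z₀‖ + r with hR
  have hR0 : 0 < R := by positivity
  set K := 2 * R + R ^ 2 with hK
  have hK0 : 0 < K := by positivity
  refine ⟨(m₁ + 1 + (m₂ + 1)) * r * K + ((m₁ + 1) * K ^ 2 + (m₂ + 1) * K ^ 2) / 2, by positivity, ?_⟩
  intro t ht ht1 z hz hdom
  have hzR : ‖z‖ ≤ R := by
    have := norm_le_norm_add_norm_sub' z z₀
    linarith
  have b1 := abs_one_sub_norm_sq_le hq.1 ht ht1 ((norm_fst_le z).trans hzR)
  have b2 := abs_one_sub_norm_sq_le hq.2 ht ht1 ((norm_snd_le z).trans hzR)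
  have hd := mem_domain_iff.1 hdom
  simp only [Prod.fst_add, Prod.smul_fst, Prod.snd_add, Prod.smul_snd] at hd
  have main {k : ℕ} {y w w₀ : Euc k} (hy : ‖y + t • w‖ < 1) (hw : ‖w - w₀‖ ≤ r)
      (hb : |1 - ‖y + t • w‖ ^ 2| ≤ t * K) :
      2 * inner ℝ ((y + t • w) - (y + t • w₀))
        ((((k : ℝ) - 1) / 2 * (1 - ‖y + t • w‖ ^ 2)) • (y + t • w)) ≤ (k + 1) * r * K * t ^ 2 := by
    have e : (y + t • w) - (y + t • w₀) = t • (w - w₀) := by rw [smul_sub]; abel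
    rw [e]
    have h1 := real_inner_le_norm (t • (w - w₀))
      ((((k : ℝ) - 1) / 2 * (1 - ‖y + t • w‖ ^ 2)) • (y + t • w))
    rw [norm_smul, norm_smul, Real.norm_eq_abs, Real.norm_eq_abs, abs_mul, abs_of_pos ht] at h1
    have h2 : |((k : ℝ) - 1) / 2| ≤ (k + 1) / 2 := by
      have : (0 : ℝ) ≤ k := k.cast_nonneg
      rw [abs_le]; constructor <;> linarith
    have h3 : |((k : ℝ) - 1) / 2| * |1 - ‖y + t • w‖ ^ 2| * ‖y + t • w‖ ≤ (k + 1) / 2 * (t * K) * 1 := by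
      gcongr
    have h4 : t * ‖w - w₀‖ * (|((k : ℝ) - 1) / 2| * |1 - ‖y + t • w‖ ^ 2| * ‖y + t • w‖)
        ≤ t * r * ((k + 1) / 2 * (t * K) * 1) := by
      gcongr
    linarith [h1, h4]
  have c1 := main hd.1 ((norm_fst_le (z - z₀)).trans hz) b1
  have c2 := main hd.2 ((norm_snd_le (z - z₀)).trans hz) b2
  rw [laplacian_sqDist]
  simp only [drift, Prod.fst_add, Prod.smul_fst, Prod.snd_add, Prod.smul_snd] at c1 c2 ⊢
  have s1 : (1 - ‖q.1 + t • z.1‖ ^ 2) ^ 2 ≤ (t * K) ^ 2 := sq_le_sq' (by linarith [abs_le.1 b1])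
    (by linarith [abs_le.1 b1])
  have s2 : (1 - ‖q.2 + t • z.2‖ ^ 2) ^ 2 ≤ (t * K) ^ 2 := sq_le_sq' (by linarith [abs_le.1 b2])
    (by linarith [abs_le.1 b2])
  have s3 := mul_le_mul_of_nonneg_left s1 (by positivity : (0 : ℝ) ≤ m₁ + 1)
  have s4 := mul_le_mul_of_nonneg_left s2 (by positivity : (0 : ℝ) ≤ m₂ + 1)
  linarith

/-- Comparison with a quadratic function: if `G` vanishes to order `s` at `q`, and its Laplacian
rescaled about `q` has a limit in the direction `z₀`, then this limit is not positive. -/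
theorem limit_laplacian_nonpos {G : Euc m₁ × Euc m₂ → ℝ} (hG : ContDiffOn ℝ 2 G (domain m₁ m₂))
    {q z₀ : Euc m₁ × Euc m₂} (hq : q ∈ corner m₁ m₂) (s : ℕ) {k : ℝ}
    (hsmall : G =o[𝓝[domain m₁ m₂] q] fun p => ‖p - q‖ ^ s)
    (hdom : ∀ᶠ y : ℝ × (Euc m₁ × Euc m₂) in 𝓝[>] 0 ×ˢ 𝓝 z₀, q + y.1 • y.2 ∈ domain m₁ m₂)
    (hlap : Filter.Tendsto (fun y : ℝ × (Euc m₁ × Euc m₂) =>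
      (y.1⁻¹) ^ s * laplacian G (q + y.1 • y.2)) (𝓝[>] 0 ×ˢ 𝓝 z₀) (𝓝 k)) : k ≤ 0 := by
  by_contra! hk
  have hev := hdom.and (hlap.eventually (lt_mem_nhds (half_lt_self hk)))
  -- The limit is joint in the scale and the direction, so for each small scale `t` the lower bound
  -- `k / 2` holds on a whole ball of radius `t r` about `q + t z₀`.
  obtain ⟨P₁, hP₁, P₂, hP₂, hP⟩ := Filter.eventually_prod_iff.1 hev
  obtain ⟨δ, hδ, hδP⟩ := mem_nhdsGT_iff_exists_Ioc_subset.1 hP₁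
  have hδ0 : (0 : ℝ) < δ := hδ
  obtain ⟨r, hr, hrP⟩ := Metric.nhds_basis_closedBall.mem_iff.1 hP₂
  obtain ⟨M, hM, hMle⟩ := exists_laplacian_sqDist_le (z₀ := z₀) hq hr
  set R := ‖z₀‖ + r with hR
  have hR0 : 0 < R := by positivity
  -- On the dilated ball `|G| ≤ ε (t R)^s`, so `G` varies by at most `2 ε (t R)^s`. The barrier
  -- forces a growth of `t^s k r² / (4 M)`, which this `ε` makes impossible.
  obtain ⟨ε, hε, hεk⟩ : ∃ ε : ℝ, 0 < ε ∧ 2 * (ε * R ^ s) < k / (4 * M) * r ^ 2 := by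
    refine ⟨k / (4 * M) * r ^ 2 / (4 * R ^ s), by positivity, ?_⟩
    have : 2 * (k / (4 * M) * r ^ 2 / (4 * R ^ s) * R ^ s) = k / (4 * M) * r ^ 2 / 2 := by
      field_simp; ring
    rw [this]
    have : 0 < k / (4 * M) * r ^ 2 := by positivity
    linarith
  have hGε := hsmall.bound hε
  obtain ⟨ρ, hρ, hρG⟩ := Metric.mem_nhdsWithin_iff.1 hGε
  obtain ⟨t, ht0, htδ, ht1, htρ⟩ : ∃ t : ℝ, 0 < t ∧ t ≤ δ ∧ t ≤ 1 ∧ t * R < ρ := by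
    refine ⟨min δ (min 1 (ρ / (2 * R))), by positivity, min_le_left _ _,
      (min_le_right _ _).trans (min_le_left _ _), ?_⟩
    have : min δ (min 1 (ρ / (2 * R))) ≤ ρ / (2 * R) :=
      (min_le_right _ _).trans (min_le_right _ _)
    calc _ ≤ ρ / (2 * R) * R := by gcongr
      _ = ρ / 2 := by field_simp
      _ < ρ := by linarith
  have hrepr (x : Euc m₁ × Euc m₂) (hx : sqDist (q + t • z₀) x ≤ (t * r) ^ 2) :
      ∃ z, ‖z - z₀‖ ≤ r ∧ x = q + t • z := by
    refine ⟨t⁻¹ • (x - q), ?_, ?_⟩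
    · have h1 := norm_sub_le_of_sqDist_le (by positivity) hx
      have h2 : t⁻¹ • (x - q) - z₀ = t⁻¹ • (x - (q + t • z₀)) := by
        rw [← sub_sub, smul_sub _ (x - q), inv_smul_smul₀ ht0.ne']
      rw [h2, norm_smul, norm_inv, Real.norm_eq_abs, abs_of_pos ht0, inv_mul_le_iff₀ ht0]
      exact h1
    · rw [smul_inv_smul₀ ht0.ne']; abel
  have hall {z} (hz : ‖z - z₀‖ ≤ r) : q + t • z ∈ domain m₁ m₂ ∧
      k / 2 < (t⁻¹) ^ s * laplacian G (q + t • z) :=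
    hP (hδP ⟨ht0, htδ⟩) (hrP (by rwa [mem_closedBall_iff_norm]))
  have hbound {z} (hz : ‖z - z₀‖ ≤ r) : |G (q + t • z)| ≤ ε * (t * R) ^ s := by
    have h0 : ‖q + t • z - q‖ ≤ t * R := by
      rw [add_sub_cancel_left, norm_smul, Real.norm_eq_abs, abs_of_pos ht0]
      have := norm_le_norm_add_norm_sub' z z₀
      gcongr
      linarith
    have h1 := hρG ⟨by rw [mem_ball_iff_norm]; linarith, (hall hz).1⟩
    simp only [Set.mem_ofPred_eq, Real.norm_eq_abs, abs_pow, abs_norm] at h1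
    refine h1.trans ?_
    gcongr
  -- With this `κ` the barrier has Laplacian at most `t^s k / 4`, while that of `G` exceeds `t^s k /
  -- 2`.
  obtain ⟨x, hx, hle⟩ := exists_sqDist_eq_of_laplacian_pos hG (c := q + t • z₀)
    (ρ := t * r) (κ := k * t ^ s / (4 * M * t ^ 2)) (by positivity)
    (fun x hx => by
      obtain ⟨z, hz, rfl⟩ := hrepr x hx
      exact (hall hz).1)
    (fun x hx => by
      obtain ⟨z, hz, rfl⟩ := hrepr x hx
      have h1 := (hall hz).2
      have h2 := hMle t ht0 ht1 z hz (hall hz).1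
      calc k * t ^ s / (4 * M * t ^ 2) * laplacian (sqDist (q + t • z₀)) (q + t • z)
          ≤ k * t ^ s / (4 * M * t ^ 2) * (M * t ^ 2) := by gcongr
        _ = t ^ s * (k / 4) := by field_simp
        _ < t ^ s * ((t⁻¹) ^ s * laplacian G (q + t • z)) := by
          gcongr
          linarith
        _ = laplacian G (q + t • z) := by
          rw [← mul_assoc, ← mul_pow, mul_inv_cancel₀ ht0.ne', one_pow, one_mul])
  obtain ⟨z, hz, rfl⟩ := hrepr x hx.le
  have b1 := abs_le.1 (hbound hz)
  have b2 := abs_le.1 (hbound (z := z₀) (by simpa using hr.le))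
  have e : k * t ^ s / (4 * M * t ^ 2) * (t * r) ^ 2 = t ^ s * (k / (4 * M) * r ^ 2) := by
    field_simp
  rw [e] at hle
  have e2 : ε * (t * R) ^ s = t ^ s * (ε * R ^ s) := by rw [mul_pow]; ring
  rw [e2] at b1 b2
  have hts : 0 < t ^ s := by positivity
  nlinarith [mul_lt_mul_of_pos_left hεk hts]

theorem limit_laplacian_eq_zero {G : Euc m₁ × Euc m₂ → ℝ} (hG : ContDiffOn ℝ 2 G (domain m₁ m₂))
    {q z₀ : Euc m₁ × Euc m₂} (hq : q ∈ corner m₁ m₂) (s : ℕ) {k : ℝ}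
    (hsmall : G =o[𝓝[domain m₁ m₂] q] fun p => ‖p - q‖ ^ s)
    (hdom : ∀ᶠ y : ℝ × (Euc m₁ × Euc m₂) in 𝓝[>] 0 ×ˢ 𝓝 z₀, q + y.1 • y.2 ∈ domain m₁ m₂)
    (hlap : Filter.Tendsto (fun y : ℝ × (Euc m₁ × Euc m₂) =>
      (y.1⁻¹) ^ s * laplacian G (q + y.1 • y.2)) (𝓝[>] 0 ×ˢ 𝓝 z₀) (𝓝 k)) : k = 0 := by
  refine le_antisymm (limit_laplacian_nonpos hG hq s hsmall hdom hlap) ?_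
  have h := limit_laplacian_nonpos hG.neg hq s hsmall.neg_left hdom (k := -k) (by
    refine hlap.neg.congr' ?_
    filter_upwards [hdom] with y hy
    have h1 := secondOrderOp_clm_comp (-ContinuousLinearMap.id ℝ ℝ)
      (hG.contDiffAt (isOpen_domain.mem_nhds hy)) (prodBasis m₁ m₂) (weight (q + y.1 • y.2))
      (drift (q + y.1 • y.2))
    simp only [neg_apply, ContinuousLinearMap.id_apply] at h1
    have h2 : laplacian (fun x => -G x) (q + y.1 • y.2) = -laplacian G (q + y.1 • y.2) := h1
    rw [h2, mul_neg])
  linarith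

end Dilation

/-! ### The harmonic map equation in the limit at the corner -/

section CornerLimits

variable {m₁ m₂ n : ℕ} {u : Euc m₁ × Euc m₂ → Euc n} {q z₀ : Euc m₁ × Euc m₂}

theorem tendsto_inv_mul_one_sub_norm_sq {k : ℕ} {α : Type*} {l : Filter α} {t : α → ℝ}
    {z : α → Euc k} {q z₀ : Euc k} (hq : ‖q‖ = 1) (ht : Filter.Tendsto t l (𝓝 0))
    (ht0 : ∀ᶠ y in l, 0 < t y) (hz : Filter.Tendsto z l (𝓝 z₀)) :
    Filter.Tendsto (fun y => (t y)⁻¹ * (1 - ‖q + t y • z y‖ ^ 2)) l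
      (𝓝 (-(2 * inner ℝ q z₀))) := by
  have h1 : Filter.Tendsto (fun y => -(2 * inner ℝ q (z y) + t y * ‖z y‖ ^ 2)) l
      (𝓝 (-(2 * inner ℝ q z₀ + 0 * ‖z₀‖ ^ 2))) :=
    (((tendsto_const_nhds.inner hz).const_mul 2).add (ht.mul (hz.norm.pow 2))).neg
  rw [zero_mul, add_zero] at h1
  refine h1.congr' ?_
  filter_upwards [ht0] with y hy
  rw [norm_add_sq_real, hq, real_inner_smul_right, norm_smul, Real.norm_eq_abs, mul_pow, sq_abs]
  field_simp
  ring

/-- The parameters `(t, z)` of the points `q + t z` that approach `q` in the direction `z₀`. -/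
abbrev dilationFilter (z₀ : Euc m₁ × Euc m₂) : Filter (ℝ × (Euc m₁ × Euc m₂)) :=
  𝓝[>] 0 ×ˢ 𝓝 z₀

theorem tendsto_dilation_fst : Filter.Tendsto Prod.fst (dilationFilter z₀) (𝓝 (0 : ℝ)) :=
  Filter.tendsto_fst.mono_right nhdsWithin_le_nhds

theorem eventually_dilation_pos : ∀ᶠ y in dilationFilter z₀, 0 < y.1 :=
  Filter.tendsto_fst.eventually self_mem_nhdsWithin

theorem tendsto_dilation_one_sub_fst (hq : q ∈ corner m₁ m₂) :
    Filter.Tendsto (fun y => y.1⁻¹ * (1 - ‖(q + y.1 • y.2).1‖ ^ 2)) (dilationFilter z₀)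
      (𝓝 (-(2 * inner ℝ q.1 z₀.1))) :=
  tendsto_inv_mul_one_sub_norm_sq (mem_corner_iff.1 hq).1 tendsto_dilation_fst
    eventually_dilation_pos ((continuous_fst.tendsto z₀).comp Filter.tendsto_snd)

theorem tendsto_dilation_one_sub_snd (hq : q ∈ corner m₁ m₂) :
    Filter.Tendsto (fun y => y.1⁻¹ * (1 - ‖(q + y.1 • y.2).2‖ ^ 2)) (dilationFilter z₀)
      (𝓝 (-(2 * inner ℝ q.2 z₀.2))) :=
  tendsto_inv_mul_one_sub_norm_sq (mem_corner_iff.1 hq).2 tendsto_dilation_fst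
    eventually_dilation_pos ((continuous_snd.tendsto z₀).comp Filter.tendsto_snd)

/-- The direction `z₀` points from `q` into the domain. -/
def PointsInward (q z₀ : Euc m₁ × Euc m₂) : Prop := inner ℝ q.1 z₀.1 < 0 ∧ inner ℝ q.2 z₀.2 < 0

theorem eventually_dilation_mem (hq : q ∈ corner m₁ m₂) (hz : PointsInward q z₀) :
    ∀ᶠ y in dilationFilter z₀, q + y.1 • y.2 ∈ domain m₁ m₂ := by
  filter_upwards [eventually_dilation_pos,
    (tendsto_dilation_one_sub_fst hq).eventually (lt_mem_nhds (by linarith [hz.1] :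
      (0 : ℝ) < -(2 * inner ℝ q.1 z₀.1))),
    (tendsto_dilation_one_sub_snd hq).eventually (lt_mem_nhds (by linarith [hz.2] :
      (0 : ℝ) < -(2 * inner ℝ q.2 z₀.2)))] with y h0 h1 h2
  have g {k : ℕ} {x : Euc k} (h : 0 < y.1⁻¹ * (1 - ‖x‖ ^ 2)) : ‖x‖ < 1 := by
    have h3 : 0 < 1 - ‖x‖ ^ 2 := (pos_iff_pos_of_mul_pos h).1 (inv_pos.2 h0)
    nlinarith [norm_nonneg x]
  exact mem_domain_iff.2 ⟨g h1, g h2⟩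

theorem tendsto_dilation : Filter.Tendsto (fun y : ℝ × (Euc m₁ × Euc m₂) => q + y.1 • y.2)
    (dilationFilter z₀) (𝓝 q) := by
  have := (tendsto_dilation_fst (z₀ := z₀)).smul Filter.tendsto_snd
  simpa using this.const_add q

theorem tendsto_dilation_within (hq : q ∈ corner m₁ m₂) (hz : PointsInward q z₀) :
    Filter.Tendsto (fun y : ℝ × (Euc m₁ × Euc m₂) => q + y.1 • y.2)
      (dilationFilter z₀) (𝓝[domain m₁ m₂] q) :=
  tendsto_nhdsWithin_iff.2 ⟨tendsto_dilation, eventually_dilation_mem hq hz⟩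

/-- The limit of the weights of the Laplacian rescaled about `q`. -/
def limWeight (q z₀ : Euc m₁ × Euc m₂) : Fin (m₁ + 1) ⊕ Fin (m₂ + 1) → ℝ :=
  Sum.elim (fun _ => inner ℝ q.1 z₀.1 ^ 2) (fun _ => inner ℝ q.2 z₀.2 ^ 2)

/-- The limit of the drift of the Laplacian rescaled about `q`. -/
def limDrift (q z₀ : Euc m₁ × Euc m₂) : Euc m₁ × Euc m₂ :=
  ((((m₁ : ℝ) - 1) / 2 * -(2 * inner ℝ q.1 z₀.1)) • q.1,
    (((m₂ : ℝ) - 1) / 2 * -(2 * inner ℝ q.2 z₀.2)) • q.2)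

theorem tendsto_dilation_weight (hq : q ∈ corner m₁ m₂) (i) :
    Filter.Tendsto (fun y => (y.1⁻¹) ^ 2 * weight (q + y.1 • y.2) i) (dilationFilter z₀)
      (𝓝 (limWeight q z₀ i)) := by
  rcases i with i | i
  · have h := ((tendsto_dilation_one_sub_fst (z₀ := z₀) hq).pow 2).div_const 4
    simp only [weight, limWeight, Sum.elim_inl]
    convert h using 2 <;> ring
  · have h := ((tendsto_dilation_one_sub_snd (z₀ := z₀) hq).pow 2).div_const 4
    simp only [weight, limWeight, Sum.elim_inr]
    convert h using 2 <;> ring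

theorem tendsto_dilation_drift (hq : q ∈ corner m₁ m₂) :
    Filter.Tendsto (fun y => y.1⁻¹ • drift (q + y.1 • y.2)) (dilationFilter z₀)
      (𝓝 (limDrift q z₀)) := by
  have t1 : Filter.Tendsto (fun y : ℝ × (Euc m₁ × Euc m₂) => (q + y.1 • y.2).1)
      (dilationFilter z₀) (𝓝 q.1) := (continuous_fst.tendsto q).comp tendsto_dilation
  have t2 : Filter.Tendsto (fun y : ℝ × (Euc m₁ × Euc m₂) => (q + y.1 • y.2).2)
      (dilationFilter z₀) (𝓝 q.2) := (continuous_snd.tendsto q).comp tendsto_dilation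
  have h1 := ((tendsto_dilation_one_sub_fst (z₀ := z₀) hq).const_mul (((m₁ : ℝ) - 1) / 2)).smul t1
  have h2 := ((tendsto_dilation_one_sub_snd (z₀ := z₀) hq).const_mul (((m₂ : ℝ) - 1) / 2)).smul t2
  refine (h1.prodMk_nhds h2).congr fun y => ?_
  simp only [drift, Prod.smul_mk, smul_smul]
  congr 2 <;> ring

/-- The derivative of `u` at a corner point. -/
def cornerDeriv (u : Euc m₁ × Euc m₂ → Euc n) (q : Euc m₁ × Euc m₂) :
    Euc m₁ × Euc m₂ →L[ℝ] Euc n :=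
  fderivWithin ℝ u (closedDomain m₁ m₂) q

/-- The derivative of `1 - ‖u‖²` at a corner point. -/
def heightDeriv (u : Euc m₁ × Euc m₂ → Euc n) (q : Euc m₁ × Euc m₂) :
    Euc m₁ × Euc m₂ →L[ℝ] ℝ :=
  -((2 : ℝ) • (innerSL ℝ (u q)).comp (cornerDeriv u q))

theorem heightDeriv_apply (z : Euc m₁ × Euc m₂) :
    heightDeriv u q z = -(2 * inner ℝ (u q) (cornerDeriv u q z)) := by
  simp [heightDeriv]

theorem Admissible.hasFDerivWithinAt (hu : Admissible u) (hq : q ∈ closedDomain m₁ m₂) :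
    HasFDerivWithinAt u (cornerDeriv u q) (closedDomain m₁ m₂) q :=
  (hu.contDiffOn_one.differentiableOn (by norm_num) q hq).hasFDerivWithinAt

theorem Admissible.norm_eq_one (hu : Admissible u) (hq : q ∈ corner m₁ m₂) : ‖u q‖ = 1 := by
  simpa using hu.mapsTo_corner hq

theorem Admissible.hasFDerivWithinAt_height (hu : Admissible u) (hq : q ∈ closedDomain m₁ m₂) :
    HasFDerivWithinAt (fun x => 1 - ‖u x‖ ^ 2) (heightDeriv u q) (closedDomain m₁ m₂) q := by
  refine ((hu.hasFDerivWithinAt hq).norm_sq.const_sub 1).congr_fderiv ?_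
  refine ContinuousLinearMap.ext fun z => ?_
  simp [heightDeriv]

/-- This is where `C¹` regularity up to the corner enters the limit equations. All terms of the
harmonic map equation other than the Laplacian involve at most first derivatives and are controlled
by it. -/
theorem Admissible.tendsto_fderiv (hu : Admissible u) (hq : q ∈ corner m₁ m₂)
    (hz : PointsInward q z₀) :
    Filter.Tendsto (fun y => fderiv ℝ u (q + y.1 • y.2)) (dilationFilter z₀)
      (𝓝 (cornerDeriv u q)) := by
  have h1 : ContinuousWithinAt (fderivWithin ℝ u (closedDomain m₁ m₂)) (domain m₁ m₂) q :=
    (hu.contDiffOn_one.continuousOn_fderivWithin uniqueDiffOn_closedDomain (by norm_num) q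
      (corner_subset_closedDomain hq)).mono domain_subset_closedDomain
  refine (h1.tendsto.comp (tendsto_dilation_within hq hz)).congr' ?_
  filter_upwards [eventually_dilation_mem hq hz] with y hy
  exact fderivWithin_of_mem_nhds
    (Filter.mem_of_superset (isOpen_domain.mem_nhds hy) domain_subset_closedDomain)

theorem tendsto_of_hasFDerivWithinAt {F : Type*} [NormedAddCommGroup F] [NormedSpace ℝ F]
    {f : Euc m₁ × Euc m₂ → F} {f' : Euc m₁ × Euc m₂ →L[ℝ] F}
    (hf : HasFDerivWithinAt f f' (closedDomain m₁ m₂) q) (hq : q ∈ corner m₁ m₂)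
    (hz : PointsInward q z₀) :
    Filter.Tendsto (fun y => y.1⁻¹ • (f (q + y.1 • y.2) - f q)) (dilationFilter z₀)
      (𝓝 (f' z₀)) := by
  refine hf.lim (d := fun y : ℝ × (Euc m₁ × Euc m₂) => y.1 • y.2) ?_ ?_ ?_
  · simpa using (tendsto_dilation_fst (z₀ := z₀)).smul Filter.tendsto_snd
  · filter_upwards [eventually_dilation_mem hq hz] with y hy
    exact domain_subset_closedDomain hy
  · refine (Filter.tendsto_snd (f := 𝓝[>] (0 : ℝ)) (g := 𝓝 z₀)).congr' ?_
    filter_upwards [eventually_dilation_pos] with y hy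
    exact (inv_smul_smul₀ hy.ne' y.2).symm

theorem Admissible.tendsto_height (hu : Admissible u) (hq : q ∈ corner m₁ m₂)
    (hz : PointsInward q z₀) :
    Filter.Tendsto (fun y => y.1⁻¹ * (1 - ‖u (q + y.1 • y.2)‖ ^ 2)) (dilationFilter z₀)
      (𝓝 (heightDeriv u q z₀)) := by
  have h := tendsto_of_hasFDerivWithinAt
    (hu.hasFDerivWithinAt_height (corner_subset_closedDomain hq)) hq hz
  simpa [hu.norm_eq_one hq] using h

theorem Admissible.tendsto_value (hu : Admissible u) (hq : q ∈ corner m₁ m₂)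
    (hz : PointsInward q z₀) :
    Filter.Tendsto (fun y => u (q + y.1 • y.2)) (dilationFilter z₀) (𝓝 (u q)) :=
  ((hu.contDiffOn_one.continuousOn q (corner_subset_closedDomain hq)).mono
    domain_subset_closedDomain).tendsto.comp (tendsto_dilation_within hq hz)

theorem heightDeriv_nonneg (hu : IsHarmonic u) (hu' : Admissible u) (hq : q ∈ corner m₁ m₂)
    (hz : PointsInward q z₀) : 0 ≤ heightDeriv u q z₀ := by
  refine ge_of_tendsto (hu'.tendsto_height hq hz) ?_
  filter_upwards [eventually_dilation_pos, eventually_dilation_mem hq hz] with y h1 h2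
  exact mul_nonneg (inv_nonneg.2 h1.le) (one_sub_sq_pos (hu.isHarmonicAt h2).norm_lt).le

theorem isLittleO_height (hu : Admissible u) (hq : q ∈ corner m₁ m₂) :
    (fun p => (1 - ‖u p‖ ^ 2) - heightDeriv u q (p - q)) =o[𝓝[domain m₁ m₂] q]
      fun p => ‖p - q‖ := by
  have h := (hu.hasFDerivWithinAt_height (corner_subset_closedDomain hq)).isLittleO.mono
    (nhdsWithin_mono q domain_subset_closedDomain)
  simpa [hu.norm_eq_one hq] using h.norm_right

/-- Squaring cancels the division by the height in `laplacian_one_sub_norm_sq`. The limit at the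
corner can then be taken before the slope of the height is known to be nonzero. -/
theorem laplacian_height_sq {p : Euc m₁ × Euc m₂} (hu : IsHarmonicAt u p) :
    laplacian (fun x => (1 - ‖u x‖ ^ 2) * (1 - ‖u x‖ ^ 2)) p = ∑ i, weight p i *
      (6 * (2 * inner ℝ (u p) (fderiv ℝ u p (prodBasis m₁ m₂ i))) ^ 2
        - 8 * ‖fderiv ℝ u p (prodBasis m₁ m₂ i)‖ ^ 2
        + 4 * (1 - ‖u p‖ ^ 2) * ‖fderiv ℝ u p (prodBasis m₁ m₂ i)‖ ^ 2) := by
  have h0 := (one_sub_sq_pos hu.norm_lt).ne'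
  have h1 := contDiffAt_one_sub_norm_sq hu.contDiffAt
  rw [laplacian_mul h1 h1, hu.laplacian_one_sub_norm_sq]
  simp only [fderiv_one_sub_norm_sq (hu.contDiffAt.differentiableAt (by norm_num)),
    Finset.mul_sum, Finset.sum_mul, ← Finset.sum_add_distrib]
  refine Finset.sum_congr rfl fun i _ => ?_
  field_simp
  ring

theorem fderiv_clm_sub (A : Euc m₁ × Euc m₂ →L[ℝ] ℝ) (p e : Euc m₁ × Euc m₂) :
    fderiv ℝ (fun x => A (x - q)) p e = A e := by
  simp only [map_sub]
  rw [fderiv_sub_const, A.fderiv]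

theorem laplacian_clm_sub (A : Euc m₁ × Euc m₂ →L[ℝ] ℝ) (p : Euc m₁ × Euc m₂) :
    laplacian (fun x => A (x - q)) p = A (drift p) := by
  simp only [map_sub]
  exact (secondOrderOp_sub A.contDiff.contDiffAt contDiffAt_const _ _ _).trans
    (by rw [secondOrderOp_const, secondOrderOp_clm, sub_zero])

theorem contDiff_clm_sub (A : Euc m₁ × Euc m₂ →L[ℝ] ℝ) :
    ContDiff ℝ 2 (fun x => A (x - q)) := A.contDiff.comp (contDiff_id.sub contDiff_const)

/-- The harmonic map equation for the square of the height, in the limit at the corner. -/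
theorem corner_height_equation (hu : IsHarmonic u) (hu' : Admissible u) (hq : q ∈ corner m₁ m₂)
    (hz : PointsInward q z₀) :
    ∑ i, limWeight q z₀ i * (6 * (2 * inner ℝ (u q) (cornerDeriv u q (prodBasis m₁ m₂ i))) ^ 2
        - 8 * ‖cornerDeriv u q (prodBasis m₁ m₂ i)‖ ^ 2)
      = 2 * (heightDeriv u q z₀ * heightDeriv u q (limDrift q z₀))
        + 2 * ∑ i, limWeight q z₀ i * heightDeriv u q (prodBasis m₁ m₂ i) ^ 2 := by
  set A := heightDeriv u q with hA
  -- The height squared minus its quadratic leading part. As a difference of squares it is `o(|p -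
  -- q|) * O(|p - q|)`, so the order is `s = 2`.
  refine sub_eq_zero.1 (limit_laplacian_eq_zero (G := fun x =>
    (1 - ‖u x‖ ^ 2) * (1 - ‖u x‖ ^ 2) - A (x - q) * A (x - q)) ?_ hq 2 ?_
    (eventually_dilation_mem hq hz) ?_)
  · have h1 : ContDiffOn ℝ 2 (fun x => 1 - ‖u x‖ ^ 2) (domain m₁ m₂) :=
      contDiffOn_const.sub (hu.contDiffOn.norm_sq ℝ)
    exact (h1.mul h1).sub
      ((contDiff_clm_sub A).contDiffOn.mul (contDiff_clm_sub A).contDiffOn)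
  · have h1 := isLittleO_height hu' hq
    have h2 : (fun p => A (p - q)) =O[𝓝[domain m₁ m₂] q] fun p => ‖p - q‖ :=
      (A.isBigO_sub _ _).norm_right
    have h3 : (fun p => (1 - ‖u p‖ ^ 2) + A (p - q)) =O[𝓝[domain m₁ m₂] q]
        fun p => ‖p - q‖ := by
      refine (h1.isBigO.add (h2.const_mul_left 2)).congr_left fun p => ?_
      rw [hA]; ring
    refine (h1.mul_isBigO h3).congr (fun p => ?_) (fun p => ?_)
    · rw [hA]; ring
    · ring
  · have hval := hu'.tendsto_value hq hz
    have hder (i) : Filter.Tendsto (fun y => fderiv ℝ u (q + y.1 • y.2) (prodBasis m₁ m₂ i))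
        (dilationFilter z₀) (𝓝 (cornerDeriv u q (prodBasis m₁ m₂ i))) :=
      ((ContinuousLinearMap.apply ℝ (Euc n) (prodBasis m₁ m₂ i)).continuous.tendsto _).comp
        (hu'.tendsto_fderiv hq hz)
    have hw := tendsto_dilation_weight (z₀ := z₀) hq
    have hheight : Filter.Tendsto (fun y => 1 - ‖u (q + y.1 • y.2)‖ ^ 2) (dilationFilter z₀)
        (𝓝 0) := by
      have := (hval.norm.pow 2).const_sub 1
      simpa [hu'.norm_eq_one hq] using this
    have T1 : Filter.Tendsto (fun y => ∑ i, ((y.1⁻¹) ^ 2 * weight (q + y.1 • y.2) i) *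
        (6 * (2 * inner ℝ (u (q + y.1 • y.2))
            (fderiv ℝ u (q + y.1 • y.2) (prodBasis m₁ m₂ i))) ^ 2
          - 8 * ‖fderiv ℝ u (q + y.1 • y.2) (prodBasis m₁ m₂ i)‖ ^ 2
          + 4 * (1 - ‖u (q + y.1 • y.2)‖ ^ 2)
            * ‖fderiv ℝ u (q + y.1 • y.2) (prodBasis m₁ m₂ i)‖ ^ 2))
        (dilationFilter z₀) (𝓝 (∑ i, limWeight q z₀ i *
          (6 * (2 * inner ℝ (u q) (cornerDeriv u q (prodBasis m₁ m₂ i))) ^ 2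
          - 8 * ‖cornerDeriv u q (prodBasis m₁ m₂ i)‖ ^ 2
          + 4 * 0 * ‖cornerDeriv u q (prodBasis m₁ m₂ i)‖ ^ 2))) :=
      tendsto_finsetSum _ fun i _ => (hw i).mul
        ((((((hval.inner (hder i)).const_mul 2).pow 2).const_mul 6).sub
          (((hder i).norm.pow 2).const_mul 8)).add
          ((hheight.const_mul 4).mul ((hder i).norm.pow 2)))
    have hlin : Filter.Tendsto (fun y : ℝ × (Euc m₁ × Euc m₂) => A y.2) (dilationFilter z₀)
        (𝓝 (A z₀)) := (A.continuous.tendsto z₀).comp Filter.tendsto_snd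
    have hdr : Filter.Tendsto (fun y => A (y.1⁻¹ • drift (q + y.1 • y.2))) (dilationFilter z₀)
        (𝓝 (A (limDrift q z₀))) := (A.continuous.tendsto _).comp (tendsto_dilation_drift hq)
    have T2 : Filter.Tendsto (fun y => 2 * (A y.2 * A (y.1⁻¹ • drift (q + y.1 • y.2)))
        + 2 * ∑ i, ((y.1⁻¹) ^ 2 * weight (q + y.1 • y.2) i) * A (prodBasis m₁ m₂ i) ^ 2)
        (dilationFilter z₀) (𝓝 (2 * (A z₀ * A (limDrift q z₀))
          + 2 * ∑ i, limWeight q z₀ i * A (prodBasis m₁ m₂ i) ^ 2)) :=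
      ((hlin.mul hdr).const_mul 2).add
        ((tendsto_finsetSum _ fun i _ => (hw i).mul_const _).const_mul 2)
    simp only [mul_zero, zero_mul, add_zero] at T1
    refine (T1.sub T2).congr' ?_
    filter_upwards [eventually_dilation_pos, eventually_dilation_mem hq hz] with y hy hmem
    set p := q + y.1 • y.2 with hp
    have hup := hu.isHarmonicAt hmem
    have hsq : ContDiffAt ℝ 2 (fun x => (1 - ‖u x‖ ^ 2) * (1 - ‖u x‖ ^ 2)) p :=
      (contDiffAt_one_sub_norm_sq hup.contDiffAt).mul (contDiffAt_one_sub_norm_sq hup.contDiffAt)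
    have hAc := (contDiff_clm_sub (q := q) A).contDiffAt (x := p)
    have e1 : laplacian (fun x => (1 - ‖u x‖ ^ 2) * (1 - ‖u x‖ ^ 2) - A (x - q) * A (x - q)) p
        = laplacian (fun x => (1 - ‖u x‖ ^ 2) * (1 - ‖u x‖ ^ 2)) p
          - laplacian (fun x => A (x - q) * A (x - q)) p :=
      secondOrderOp_sub hsq (hAc.mul hAc) _ _ _
    have e2 : A (p - q) = y.1 * A y.2 := by
      rw [hp, add_sub_cancel_left, map_smul, smul_eq_mul]
    rw [e1, laplacian_height_sq hup, laplacian_mul hAc hAc, laplacian_clm_sub, e2, map_smul]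
    simp only [fderiv_clm_sub, smul_eq_mul, mul_sub, Finset.mul_sum, mul_add]
    congr 1
    · refine Finset.sum_congr rfl fun i _ => ?_
      ring
    · congr 1
      · field_simp
        ring
      · refine Finset.sum_congr rfl fun i _ => ?_
        ring

/-- The harmonic map equation for the components tangent to the sphere, in the limit at the
corner. -/
theorem corner_tangential_equation (hu : IsHarmonic u) (hu' : Admissible u)
    (hq : q ∈ corner m₁ m₂) (hz : PointsInward q z₀) (hne : heightDeriv u q z₀ ≠ 0) {e : Euc n}
    (he : inner ℝ e (u q) = 0) :
    -∑ i, limWeight q z₀ i * (2 / heightDeriv u q z₀ *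
        (2 * inner ℝ (u q) (cornerDeriv u q (prodBasis m₁ m₂ i))
          * inner ℝ e (cornerDeriv u q (prodBasis m₁ m₂ i))))
      = inner ℝ e (cornerDeriv u q (limDrift q z₀)) := by
  set A := (innerSL ℝ e).comp (cornerDeriv u q) with hA
  -- The tangential component minus its linear part, so the order is `s = 1`. One factor `t⁻¹`
  -- rescales the Laplacian; the weights supply `t²`, and the division by the height supplies `t⁻¹`.
  refine sub_eq_zero.1 (limit_laplacian_eq_zero (G := fun x =>
    innerSL ℝ e (u x) - A (x - q)) ?_ hq 1 ?_
    (eventually_dilation_mem hq hz) ?_)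
  · exact ((innerSL ℝ e).contDiff.comp_contDiffOn hu.contDiffOn).sub
      (contDiff_clm_sub A).contDiffOn
  · have h1 := (((innerSL ℝ e).hasFDerivAt.comp_hasFDerivWithinAt q
      (hu'.hasFDerivWithinAt (corner_subset_closedDomain hq))).isLittleO.mono
      (nhdsWithin_mono q domain_subset_closedDomain)).norm_right
    simp only [pow_one]
    refine h1.congr_left fun p => ?_
    simp [he, hA]
  · have hval := hu'.tendsto_value hq hz
    have hder (i) : Filter.Tendsto (fun y => fderiv ℝ u (q + y.1 • y.2) (prodBasis m₁ m₂ i))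
        (dilationFilter z₀) (𝓝 (cornerDeriv u q (prodBasis m₁ m₂ i))) :=
      ((ContinuousLinearMap.apply ℝ (Euc n) (prodBasis m₁ m₂ i)).continuous.tendsto _).comp
        (hu'.tendsto_fderiv hq hz)
    have hw := tendsto_dilation_weight (z₀ := z₀) hq
    have hh := hu'.tendsto_height hq hz
    -- This removes the term with `‖du‖²` in the limit, as it carries the factor `⟨e, u⟩`.
    have hev : Filter.Tendsto (fun y => inner ℝ e (u (q + y.1 • y.2))) (dilationFilter z₀)
        (𝓝 0) := by
      have : Filter.Tendsto (fun y => inner ℝ e (u (q + y.1 • y.2))) (dilationFilter z₀)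
        (𝓝 (inner ℝ e (u q))) := tendsto_const_nhds.inner hval
      rwa [he] at this
    have T1 : Filter.Tendsto (fun y => -∑ i, ((y.1⁻¹) ^ 2 * weight (q + y.1 • y.2) i) *
        (2 / (y.1⁻¹ * (1 - ‖u (q + y.1 • y.2)‖ ^ 2)) *
          (2 * inner ℝ (u (q + y.1 • y.2)) (fderiv ℝ u (q + y.1 • y.2) (prodBasis m₁ m₂ i))
          * inner ℝ e (fderiv ℝ u (q + y.1 • y.2) (prodBasis m₁ m₂ i))
          - ‖fderiv ℝ u (q + y.1 • y.2) (prodBasis m₁ m₂ i)‖ ^ 2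
            * inner ℝ e (u (q + y.1 • y.2)))))
        (dilationFilter z₀) (𝓝 (-∑ i, limWeight q z₀ i * (2 / heightDeriv u q z₀ *
        (2 * inner ℝ (u q) (cornerDeriv u q (prodBasis m₁ m₂ i))
          * inner ℝ e (cornerDeriv u q (prodBasis m₁ m₂ i))
          - ‖cornerDeriv u q (prodBasis m₁ m₂ i)‖ ^ 2 * 0)))) :=
      (tendsto_finsetSum _ fun i _ => (hw i).mul
        ((tendsto_const_nhds.div hh hne).mul
          ((((hval.inner (hder i)).const_mul 2).mul (tendsto_const_nhds.inner (hder i))).sub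
            (((hder i).norm.pow 2).mul hev)))).neg
    have hdr : Filter.Tendsto (fun y => A (y.1⁻¹ • drift (q + y.1 • y.2))) (dilationFilter z₀)
        (𝓝 (A (limDrift q z₀))) := (A.continuous.tendsto _).comp (tendsto_dilation_drift hq)
    simp only [mul_zero, sub_zero] at T1
    refine (T1.sub hdr).congr' ?_
    filter_upwards [eventually_dilation_pos, eventually_dilation_mem hq hz] with y hy hmem
    set p := q + y.1 • y.2 with hp
    have hup := hu.isHarmonicAt hmem
    have hpos := (one_sub_sq_pos hup.norm_lt).ne'
    have hAc := (contDiff_clm_sub (q := q) A).contDiffAt (x := p)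
    have e1 : laplacian (fun x => innerSL ℝ e (u x) - A (x - q)) p
        = inner ℝ e (laplacian u p) - laplacian (fun x => A (x - q)) p :=
      (secondOrderOp_sub ((innerSL ℝ e).contDiff.contDiffAt.comp p hup.contDiffAt) hAc _ _ _).trans
        (by
          rw [show secondOrderOp (prodBasis m₁ m₂) (weight p) (drift p) (⇑(innerSL ℝ e) ∘ u) p = _
            from secondOrderOp_clm_comp _ hup.contDiffAt _ _ _]
          rfl)
    rw [e1, hup.inner_laplacian, laplacian_clm_sub, map_smul]
    simp only [smul_eq_mul, mul_sub, pow_one, mul_neg, Finset.mul_sum]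
    congr 2
    refine Finset.sum_congr rfl fun i _ => ?_
    field_simp

end CornerLimits

/-! ### Tangential derivatives and nondegeneracy at the corner -/

section CornerJet

variable {m₁ m₂ n : ℕ} {u v : Euc m₁ × Euc m₂ → Euc n} {q : Euc m₁ × Euc m₂}

theorem exists_sphere_curve {k : ℕ} {q ξ : Euc k} (hq : ‖q‖ = 1) (hξ : inner ℝ q ξ = 0) :
    ∃ c : ℝ → Euc k, (∀ t, ‖c t‖ = 1) ∧ c 0 = q ∧ HasDerivAt c ξ 0 := by
  rcases eq_or_ne ξ 0 with rfl | h0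
  · exact ⟨fun _ => q, fun _ => hq, rfl, hasDerivAt_const _ _⟩
  have hω : ‖ξ‖ ≠ 0 := norm_ne_zero_iff.2 h0
  -- The great circle through `q` with velocity `ξ`.
  refine ⟨fun t => Real.cos (‖ξ‖ * t) • q + (Real.sin (‖ξ‖ * t) * ‖ξ‖⁻¹) • ξ, fun t => ?_, ?_, ?_⟩
  · have : ‖Real.cos (‖ξ‖ * t) • q + (Real.sin (‖ξ‖ * t) * ‖ξ‖⁻¹) • ξ‖ ^ 2 = 1 := by
      rw [norm_add_sq_real, real_inner_smul_left, real_inner_smul_right, hξ, norm_smul, norm_smul,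
        hq, mul_pow, mul_pow, Real.norm_eq_abs, Real.norm_eq_abs, sq_abs, sq_abs, mul_pow, inv_pow,
        mul_assoc (_ ^ 2), inv_mul_cancel₀ (pow_ne_zero 2 hω)]
      linarith [Real.sin_sq_add_cos_sq (‖ξ‖ * t)]
    exact (pow_eq_one_iff_of_nonneg (norm_nonneg _) two_ne_zero).1 this
  · simp
  · have h1 : HasDerivAt (fun t : ℝ => ‖ξ‖ * t) ‖ξ‖ 0 := by
      simpa using (hasDerivAt_id' (0 : ℝ)).const_mul ‖ξ‖
    have h2 := (h1.cos.smul_const q).add ((h1.sin.mul_const ‖ξ‖⁻¹).smul_const ξ)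
    refine h2.congr_deriv ?_
    simp [hω]

/-- Both components of `ξ` are tangent to the respective spheres at `q`. -/
def IsTangent (q ξ : Euc m₁ × Euc m₂) : Prop := inner ℝ q.1 ξ.1 = 0 ∧ inner ℝ q.2 ξ.2 = 0

theorem exists_corner_curve {ξ : Euc m₁ × Euc m₂} (hq : q ∈ corner m₁ m₂) (hξ : IsTangent q ξ) :
    ∃ c : ℝ → Euc m₁ × Euc m₂, (∀ t, c t ∈ corner m₁ m₂) ∧ c 0 = q ∧ HasDerivAt c ξ 0 := by
  obtain ⟨c₁, h₁, h₁0, h₁d⟩ := exists_sphere_curve (mem_corner_iff.1 hq).1 hξ.1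
  obtain ⟨c₂, h₂, h₂0, h₂d⟩ := exists_sphere_curve (mem_corner_iff.1 hq).2 hξ.2
  exact ⟨fun t => (c₁ t, c₂ t), fun t => mem_corner_iff.2 ⟨h₁ t, h₂ t⟩, Prod.ext h₁0 h₂0,
    h₁d.prodMk h₂d⟩

theorem hasDerivAt_comp_corner_curve (hu : Admissible u) {c : ℝ → Euc m₁ × Euc m₂}
    {ξ : Euc m₁ × Euc m₂} (hc : ∀ t, c t ∈ corner m₁ m₂) (hd : HasDerivAt c ξ 0) :
    HasDerivAt (fun t => u (c t)) (cornerDeriv u (c 0) ξ) 0 := by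
  have h1 := hu.hasFDerivWithinAt (corner_subset_closedDomain (hc 0))
  have h2 := h1.comp_hasDerivWithinAt_of_eq (s := Set.univ) 0 hd.hasDerivWithinAt
    (fun t _ => corner_subset_closedDomain (hc t)) rfl
  exact hasDerivWithinAt_univ.1 h2

/-- A tangent vector is the velocity of a curve inside the corner, along which `u` and `v` coincide.
-/
theorem cornerDeriv_eq_of_isTangent (hu : Admissible u) (hv : Admissible v)
    (huv : Set.EqOn u v (corner m₁ m₂)) (hq : q ∈ corner m₁ m₂) {ξ : Euc m₁ × Euc m₂}
    (hξ : IsTangent q ξ) : cornerDeriv u q ξ = cornerDeriv v q ξ := by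
  obtain ⟨c, hc, rfl, hd⟩ := exists_corner_curve hq hξ
  have h1 := hasDerivAt_comp_corner_curve hu hc hd
  have h2 := hasDerivAt_comp_corner_curve hv hc hd
  simp only [huv (hc _)] at h1
  exact h1.unique h2

theorem inner_cornerDeriv_of_isTangent (hu : Admissible u) (hq : q ∈ corner m₁ m₂)
    {ξ : Euc m₁ × Euc m₂} (hξ : IsTangent q ξ) : inner ℝ (u q) (cornerDeriv u q ξ) = 0 := by
  obtain ⟨c, hc, rfl, hd⟩ := exists_corner_curve hq hξ
  have h1 := (hasDerivAt_comp_corner_curve hu hc hd).norm_sq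
  simp only [hu.norm_eq_one (hc _)] at h1
  have := h1.unique (hasDerivAt_const 0 _)
  linarith

/-- Translates the intrinsic nondegeneracy condition into one on the ambient derivative: the
differential of the inclusion of the sphere has range `x⊥`, so a derivative that kills `x⊥`
restricts to zero. -/
theorem mfderiv_sphere_eq_zero {k : ℕ} {F : Type*} [NormedAddCommGroup F] [NormedSpace ℝ F]
    {g : Euc k → F} {g' : Euc k →L[ℝ] F} {x : unitSphere k}
    (hg : HasFDerivWithinAt g g' (closedUnitBall k) x)
    (h : ∀ ξ : Euc k, inner ℝ (x : Euc k) ξ = 0 → g' ξ = 0) :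
    mfderiv (𝓡 k) 𝓘(ℝ, F) (fun y : unitSphere k => g y) x = 0 := by
  have : Fact (Module.finrank ℝ (Euc k) = k + 1) := ⟨finrank_euclideanSpace_fin⟩
  have hι : HasMFDerivAt (𝓡 k) 𝓘(ℝ, Euc k) ((↑) : unitSphere k → Euc k) x
      (mfderiv (𝓡 k) 𝓘(ℝ, Euc k) ((↑) : unitSphere k → Euc k) x) :=
    ((contMDiff_coe_sphere (n := k) (m := 1)).mdifferentiableAt one_ne_zero).hasMFDerivAt
  have hg' : HasMFDerivWithinAt 𝓘(ℝ, Euc k) 𝓘(ℝ, F) g (closedUnitBall k) x g' :=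
    hasMFDerivWithinAt_iff_hasFDerivWithinAt.2 hg
  have hst : (Set.univ : Set (unitSphere k)) ⊆ ((↑) : unitSphere k → Euc k) ⁻¹' closedUnitBall k := by
    intro y _
    rw [Set.mem_preimage, closedUnitBall, mem_closedBall_zero_iff]
    exact (norm_eq_of_mem_sphere y).le
  have hcomp := HasMFDerivWithinAt.comp (s := Set.univ) x hg' hι.hasMFDerivWithinAt hst
  have hm := (hasMFDerivWithinAt_univ.1 hcomp).mfderiv
  refine Eq.trans hm ?_
  refine ContinuousLinearMap.ext fun w => ?_
  have hr : mvfderiv (𝓡 k) ((↑) : unitSphere k → Euc k) x w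
      ∈ (mvfderiv (𝓡 k) ((↑) : unitSphere k → Euc k) x).range := LinearMap.mem_range_self _ w
  rw [range_mvfderiv_subtypeVal (n := k) x] at hr
  exact h _ (Submodule.mem_orthogonal_singleton_iff_inner_right.1 hr)

theorem exists_isTangent_fst_ne_zero (hu : Admissible u) (hq : q ∈ corner m₁ m₂) :
    ∃ ξ : Euc m₁, inner ℝ q.1 ξ = 0 ∧ cornerDeriv u q (ξ, 0) ≠ 0 := by
  by_contra! h
  refine (hu.nondegenerate (⟨q.1, hq.1⟩, ⟨q.2, hq.2⟩)).1 ?_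
  refine mfderiv_sphere_eq_zero (g := fun y : Euc m₁ => u (y, q.2))
    (g' := (cornerDeriv u q).comp (ContinuousLinearMap.inl ℝ (Euc m₁) (Euc m₂))) ?_ h
  refine HasFDerivWithinAt.comp q.1 (t := closedDomain m₁ m₂)
    (hu.hasFDerivWithinAt (corner_subset_closedDomain hq))
    (hasFDerivAt_prodMk_left q.1 q.2).hasFDerivWithinAt ?_
  exact fun y hy => ⟨hy, (corner_subset_closedDomain hq).2⟩

theorem exists_isTangent_snd_ne_zero (hu : Admissible u) (hq : q ∈ corner m₁ m₂) :
    ∃ ξ : Euc m₂, inner ℝ q.2 ξ = 0 ∧ cornerDeriv u q (0, ξ) ≠ 0 := by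
  by_contra! h
  refine (hu.nondegenerate (⟨q.1, hq.1⟩, ⟨q.2, hq.2⟩)).2 ?_
  refine mfderiv_sphere_eq_zero (g := fun y : Euc m₂ => u (q.1, y))
    (g' := (cornerDeriv u q).comp (ContinuousLinearMap.inr ℝ (Euc m₁) (Euc m₂))) ?_ h
  refine HasFDerivWithinAt.comp q.2 (t := closedDomain m₁ m₂)
    (hu.hasFDerivWithinAt (corner_subset_closedDomain hq))
    (hasFDerivAt_prodMk_right q.1 q.2).hasFDerivWithinAt ?_
  exact fun y hy => ⟨(corner_subset_closedDomain hq).1, hy⟩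

end CornerJet

/-! ### Solving the limit equations for the normal derivatives -/

section CornerAlgebra

variable {m₁ m₂ n : ℕ} {u v : Euc m₁ × Euc m₂ → Euc n} {q : Euc m₁ × Euc m₂}

/-- The slope of the height `1 - ‖u‖²` at `q` in the inward normal direction of the first factor. -/
def slopeFst (u : Euc m₁ × Euc m₂ → Euc n) (q : Euc m₁ × Euc m₂) : ℝ :=
  2 * inner ℝ (u q) (cornerDeriv u q (q.1, 0))

/-- The slope of the height `1 - ‖u‖²` at `q` in the inward normal direction of the second
factor. -/
def slopeSnd (u : Euc m₁ × Euc m₂ → Euc n) (q : Euc m₁ × Euc m₂) : ℝ :=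
  2 * inner ℝ (u q) (cornerDeriv u q (0, q.2))

/-- The squared norm of the derivative at `q` with respect to the first factor. -/
def energyFst (u : Euc m₁ × Euc m₂ → Euc n) (q : Euc m₁ × Euc m₂) : ℝ :=
  ∑ i, ‖cornerDeriv u q (prodBasis m₁ m₂ (Sum.inl i))‖ ^ 2

/-- The squared norm of the derivative at `q` with respect to the second factor. -/
def energySnd (u : Euc m₁ × Euc m₂ → Euc n) (q : Euc m₁ × Euc m₂) : ℝ :=
  ∑ i, ‖cornerDeriv u q (prodBasis m₁ m₂ (Sum.inr i))‖ ^ 2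

theorem isTangent_inl (hq : q ∈ corner m₁ m₂) (i : Fin (m₁ + 1)) :
    IsTangent q (prodBasis m₁ m₂ (Sum.inl i) - q.1 i • (q.1, (0 : Euc m₂))) := by
  rw [prodBasis_inl]
  constructor
  · simp [inner_sub_right, inner_stdBasis_right, real_inner_smul_right,
      (mem_corner_iff.1 hq).1]
  · simp

theorem isTangent_inr (hq : q ∈ corner m₁ m₂) (i : Fin (m₂ + 1)) :
    IsTangent q (prodBasis m₁ m₂ (Sum.inr i) - q.2 i • ((0 : Euc m₁), q.2)) := by
  rw [prodBasis_inr]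
  constructor
  · simp
  · simp [inner_sub_right, inner_stdBasis_right, real_inner_smul_right,
      (mem_corner_iff.1 hq).2]

theorem two_mul_inner_cornerDeriv_inl (hu : Admissible u) (hq : q ∈ corner m₁ m₂)
    (i : Fin (m₁ + 1)) :
    2 * inner ℝ (u q) (cornerDeriv u q (prodBasis m₁ m₂ (Sum.inl i))) = q.1 i * slopeFst u q := by
  have h := inner_cornerDeriv_of_isTangent hu hq (isTangent_inl hq i)
  rw [map_sub, map_smul, inner_sub_right, real_inner_smul_right] at h
  unfold slopeFst
  linarith

theorem two_mul_inner_cornerDeriv_inr (hu : Admissible u) (hq : q ∈ corner m₁ m₂)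
    (i : Fin (m₂ + 1)) :
    2 * inner ℝ (u q) (cornerDeriv u q (prodBasis m₁ m₂ (Sum.inr i))) = q.2 i * slopeSnd u q := by
  have h := inner_cornerDeriv_of_isTangent hu hq (isTangent_inr hq i)
  rw [map_sub, map_smul, inner_sub_right, real_inner_smul_right] at h
  unfold slopeSnd
  linarith

theorem cornerDeriv_fst_smul_snd_smul (s t : ℝ) :
    cornerDeriv u q (s • q.1, t • q.2)
      = s • cornerDeriv u q (q.1, 0) + t • cornerDeriv u q (0, q.2) := by
  rw [← map_smul, ← map_smul, ← map_add]
  simp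

theorem heightDeriv_fst_smul_snd_smul (s t : ℝ) :
    heightDeriv u q (s • q.1, t • q.2) = -(s * slopeFst u q + t * slopeSnd u q) := by
  rw [heightDeriv_apply, cornerDeriv_fst_smul_snd_smul, inner_add_right, real_inner_smul_right,
    real_inner_smul_right, slopeFst, slopeSnd]
  ring

theorem inner_fst_smul (hq : q ∈ corner m₁ m₂) (s : ℝ) : inner ℝ q.1 (s • q.1) = s := by
  rw [real_inner_smul_right, real_inner_self_eq_norm_sq, (mem_corner_iff.1 hq).1]; ring

theorem inner_snd_smul (hq : q ∈ corner m₁ m₂) (s : ℝ) : inner ℝ q.2 (s • q.2) = s := by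
  rw [real_inner_smul_right, real_inner_self_eq_norm_sq, (mem_corner_iff.1 hq).2]; ring

theorem pointsInward_smul (hq : q ∈ corner m₁ m₂) {y₁ y₂ : ℝ} (h₁ : 0 < y₁) (h₂ : 0 < y₂) :
    PointsInward q (-y₁ • q.1, -y₂ • q.2) := by
  refine ⟨?_, ?_⟩
  · change inner ℝ q.1 (-y₁ • q.1) < 0
    rw [inner_fst_smul hq]; linarith
  · change inner ℝ q.2 (-y₂ • q.2) < 0
    rw [inner_snd_smul hq]; linarith

theorem limDrift_smul (hq : q ∈ corner m₁ m₂) (y₁ y₂ : ℝ) :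
    limDrift q (-y₁ • q.1, -y₂ • q.2)
      = ((((m₁ : ℝ) - 1) * y₁) • q.1, (((m₂ : ℝ) - 1) * y₂) • q.2) := by
  unfold limDrift
  simp only [inner_fst_smul hq, inner_snd_smul hq]
  congr 2 <;> ring

theorem sum_sq_fst (hq : q ∈ corner m₁ m₂) : ∑ i, q.1 i ^ 2 = 1 := by
  rw [← EuclideanSpace.real_norm_sq_eq, (mem_corner_iff.1 hq).1, one_pow]

theorem sum_sq_snd (hq : q ∈ corner m₁ m₂) : ∑ i, q.2 i ^ 2 = 1 := by
  rw [← EuclideanSpace.real_norm_sq_eq, (mem_corner_iff.1 hq).2, one_pow]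

/-- The limit equation for the height along `(-y₁ q₁, -y₂ q₂)`. Keeping both inward components free
makes it a quadratic form in `(y₁, y₂)` vanishing on the positive quadrant. -/
theorem slope_equation (hu : IsHarmonic u) (hu' : Admissible u) (hq : q ∈ corner m₁ m₂)
    {y₁ y₂ : ℝ} (h₁ : 0 < y₁) (h₂ : 0 < y₂) :
    y₁ ^ 2 * (4 * slopeFst u q ^ 2 - 8 * energyFst u q)
      + y₂ ^ 2 * (4 * slopeSnd u q ^ 2 - 8 * energySnd u q)
      + 2 * (y₁ * slopeFst u q + y₂ * slopeSnd u q)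
        * ((m₁ - 1) * y₁ * slopeFst u q + (m₂ - 1) * y₂ * slopeSnd u q) = 0 := by
  have h := corner_height_equation hu hu' hq (pointsInward_smul hq h₁ h₂)
  rw [limDrift_smul hq, heightDeriv_fst_smul_snd_smul, heightDeriv_fst_smul_snd_smul] at h
  simp only [limWeight, Fintype.sum_sum_type, Sum.elim_inl, Sum.elim_inr, inner_fst_smul hq,
    inner_snd_smul hq, heightDeriv_apply, two_mul_inner_cornerDeriv_inl hu' hq,
    two_mul_inner_cornerDeriv_inr hu' hq, ← Finset.mul_sum, Finset.sum_sub_distrib] at h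
  have e1 (c : ℝ) : ∑ i, (q.1 i * c) ^ 2 = c ^ 2 := by
    simp only [mul_pow, ← Finset.sum_mul, sum_sq_fst hq, one_mul]
  have e2 (c : ℝ) : ∑ i, (q.2 i * c) ^ 2 = c ^ 2 := by
    simp only [mul_pow, ← Finset.sum_mul, sum_sq_snd hq, one_mul]
  simp only [neg_sq, e1, e2] at h
  unfold energyFst energySnd
  linarith

theorem slope_sq_eq (hu : IsHarmonic u) (hu' : Admissible u) (hq : q ∈ corner m₁ m₂) :
    (m₁ + 1) * slopeFst u q ^ 2 = 4 * energyFst u q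
      ∧ (m₂ + 1) * slopeSnd u q ^ 2 = 4 * energySnd u q := by
  -- Three values of `(y₁, y₂)` determine a quadratic form, so all its coefficients vanish. The two
  -- pure squares give the claim.
  have a := slope_equation hu hu' hq one_pos one_pos
  have b := slope_equation hu hu' hq one_pos two_pos
  have c := slope_equation hu hu' hq one_pos three_pos
  constructor <;> linarith

theorem slope_nonneg (hu : IsHarmonic u) (hu' : Admissible u) (hq : q ∈ corner m₁ m₂) :
    0 ≤ slopeFst u q ∧ 0 ≤ slopeSnd u q := by
  have h {y₁ y₂ : ℝ} (h₁ : 0 < y₁) (h₂ : 0 < y₂) :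
      0 ≤ y₁ * slopeFst u q + y₂ * slopeSnd u q := by
    have := heightDeriv_nonneg hu hu' hq (pointsInward_smul hq h₁ h₂)
    rw [heightDeriv_fst_smul_snd_smul] at this
    linarith
  -- The height is nonnegative only in strictly inward directions, so a single slope is reached by
  -- letting the other component tend to zero.
  have g {a b : ℝ} (h : ∀ t : ℝ, 0 < t → 0 ≤ a + t * b) : 0 ≤ a := by
    have hc : Continuous fun t : ℝ => a + t * b := by fun_prop
    have h1 : Filter.Tendsto (fun t : ℝ => a + t * b) (𝓝[>] 0) (𝓝 (a + 0 * b)) :=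
      hc.continuousWithinAt
    rw [zero_mul, add_zero] at h1
    exact ge_of_tendsto h1 (by filter_upwards [self_mem_nhdsWithin] with t ht using h t ht)
  exact ⟨g (b := slopeSnd u q) fun t ht => by simpa using h one_pos ht,
    g (b := slopeFst u q) fun t ht => by simpa [add_comm] using h ht one_pos⟩

/-- By `slope_sq_eq` a zero slope would annihilate the whole derivative in the first factor,
contrary to nondegeneracy of the corner value. -/
theorem slopeFst_pos (hu : IsHarmonic u) (hu' : Admissible u) (hq : q ∈ corner m₁ m₂) :
    0 < slopeFst u q := by
  refine lt_of_le_of_ne (slope_nonneg hu hu' hq).1 fun h0 => ?_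
  have h1 := (slope_sq_eq hu hu' hq).1
  rw [← h0] at h1
  have h2 : energyFst u q = 0 := by linarith
  have h3 := (Finset.sum_eq_zero_iff_of_nonneg fun i _ => sq_nonneg _).1 h2
  obtain ⟨ξ, -, hξ⟩ := exists_isTangent_fst_ne_zero hu' hq
  refine hξ ?_
  rw [clm_eq_sum_stdBasis]
  have h4 (i) : cornerDeriv u q (prodBasis m₁ m₂ (Sum.inl i)) = 0 := by
    simpa using h3 i (Finset.mem_univ i)
  simp [h4]

theorem slopeSnd_pos (hu : IsHarmonic u) (hu' : Admissible u) (hq : q ∈ corner m₁ m₂) :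
    0 < slopeSnd u q := by
  refine lt_of_le_of_ne (slope_nonneg hu hu' hq).2 fun h0 => ?_
  have h1 := (slope_sq_eq hu hu' hq).2
  rw [← h0] at h1
  have h2 : energySnd u q = 0 := by linarith
  have h3 := (Finset.sum_eq_zero_iff_of_nonneg fun i _ => sq_nonneg _).1 h2
  obtain ⟨ξ, -, hξ⟩ := exists_isTangent_snd_ne_zero hu' hq
  refine hξ ?_
  rw [clm_eq_sum_stdBasis]
  have h4 (i) : cornerDeriv u q (prodBasis m₁ m₂ (Sum.inr i)) = 0 := by
    simpa using h3 i (Finset.mem_univ i)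
  simp [h4]

theorem sum_smul_cornerDeriv_inl :
    ∑ i, q.1 i • cornerDeriv u q (prodBasis m₁ m₂ (Sum.inl i)) = cornerDeriv u q (q.1, 0) := by
  rw [clm_eq_sum_stdBasis (cornerDeriv u q) (q.1, 0)]
  simp

theorem sum_smul_cornerDeriv_inr :
    ∑ i, q.2 i • cornerDeriv u q (prodBasis m₁ m₂ (Sum.inr i)) = cornerDeriv u q (0, q.2) := by
  rw [clm_eq_sum_stdBasis (cornerDeriv u q) (0, q.2)]
  simp

theorem tangential_equation (hu : IsHarmonic u) (hu' : Admissible u) (hq : q ∈ corner m₁ m₂)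
    {e : Euc n} (he : inner ℝ e (u q) = 0) {y₁ y₂ : ℝ} (h₁ : 0 < y₁) (h₂ : 0 < y₂) :
    -(2 * (y₁ ^ 2 * (slopeFst u q * inner ℝ e (cornerDeriv u q (q.1, 0)))
        + y₂ ^ 2 * (slopeSnd u q * inner ℝ e (cornerDeriv u q (0, q.2)))))
      = (y₁ * slopeFst u q + y₂ * slopeSnd u q) *
        ((m₁ - 1) * y₁ * inner ℝ e (cornerDeriv u q (q.1, 0))
          + (m₂ - 1) * y₂ * inner ℝ e (cornerDeriv u q (0, q.2))) := by
  have ha : heightDeriv u q (-y₁ • q.1, -y₂ • q.2) = y₁ * slopeFst u q + y₂ * slopeSnd u q := by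
    rw [heightDeriv_fst_smul_snd_smul]; ring
  have hpos : 0 < y₁ * slopeFst u q + y₂ * slopeSnd u q :=
    add_pos (mul_pos h₁ (slopeFst_pos hu hu' hq)) (mul_pos h₂ (slopeSnd_pos hu hu' hq))
  have h := corner_tangential_equation hu hu' hq (pointsInward_smul hq h₁ h₂)
    (by rw [ha]; exact hpos.ne') he
  rw [limDrift_smul hq, cornerDeriv_fst_smul_snd_smul, ha] at h
  simp only [limWeight, Fintype.sum_sum_type, Sum.elim_inl, Sum.elim_inr, inner_fst_smul hq,
    inner_snd_smul hq, two_mul_inner_cornerDeriv_inl hu' hq,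
    two_mul_inner_cornerDeriv_inr hu' hq, ← Finset.mul_sum, inner_add_right,
    real_inner_smul_right] at h
  have e1 : ∑ i, q.1 i * slopeFst u q * inner ℝ e (cornerDeriv u q (prodBasis m₁ m₂ (Sum.inl i)))
      = slopeFst u q * inner ℝ e (cornerDeriv u q (q.1, 0)) := by
    rw [← sum_smul_cornerDeriv_inl, inner_sum, Finset.mul_sum]
    refine Finset.sum_congr rfl fun i _ => ?_
    rw [real_inner_smul_right]; ring
  have e2 : ∑ i, q.2 i * slopeSnd u q * inner ℝ e (cornerDeriv u q (prodBasis m₁ m₂ (Sum.inr i)))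
      = slopeSnd u q * inner ℝ e (cornerDeriv u q (0, q.2)) := by
    rw [← sum_smul_cornerDeriv_inr, inner_sum, Finset.mul_sum]
    refine Finset.sum_congr rfl fun i _ => ?_
    rw [real_inner_smul_right]; ring
  rw [e1, e2, neg_sq, neg_sq] at h
  have h' := congrArg (fun s => (y₁ * slopeFst u q + y₂ * slopeSnd u q) * s) h
  rw [← h']
  field_simp

/-- Comparing coefficients of `y₁²` and `y₂²` leaves `(mⱼ + 1) aⱼ Nⱼ = 0` for the tangential
component `Nⱼ` of a normal derivative. The slopes `aⱼ` are positive, so the image meets the sphere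
orthogonally. -/
theorem inner_normal_eq_zero (hu : IsHarmonic u) (hu' : Admissible u) (hq : q ∈ corner m₁ m₂)
    {e : Euc n} (he : inner ℝ e (u q) = 0) :
    inner ℝ e (cornerDeriv u q (q.1, 0)) = 0 ∧ inner ℝ e (cornerDeriv u q (0, q.2)) = 0 := by
  have a := tangential_equation hu hu' hq he one_pos one_pos
  have b := tangential_equation hu hu' hq he one_pos two_pos
  have c := tangential_equation hu hu' hq he one_pos three_pos
  have h1 : (m₁ + 1) * slopeFst u q * inner ℝ e (cornerDeriv u q (q.1, 0)) = 0 := by linarith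
  have h2 : (m₂ + 1) * slopeSnd u q * inner ℝ e (cornerDeriv u q (0, q.2)) = 0 := by linarith
  have k1 := slopeFst_pos hu hu' hq
  have k2 := slopeSnd_pos hu hu' hq
  exact ⟨(mul_eq_zero_iff_left (by positivity)).1 h1, (mul_eq_zero_iff_left (by positivity)).1 h2⟩

theorem eq_smul_of_inner_eq_zero {F : Type*} [NormedAddCommGroup F] [InnerProductSpace ℝ F]
    {x w : F} (hx : ‖x‖ = 1) (h : ∀ e, inner ℝ e x = 0 → inner ℝ e w = 0) :
    w = inner ℝ x w • x := by
  have h1 : inner ℝ (w - inner ℝ x w • x) x = 0 := by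
    rw [inner_sub_left, real_inner_smul_left, real_inner_self_eq_norm_sq, hx, real_inner_comm]
    ring
  have h2 := h _ h1
  have h3 : inner ℝ (w - inner ℝ x w • x) (w - inner ℝ x w • x) = 0 := by
    rw [inner_sub_right, h2, real_inner_smul_right, h1]; ring
  exact sub_eq_zero.1 (inner_self_eq_zero.1 h3)

theorem cornerDeriv_normal (hu : IsHarmonic u) (hu' : Admissible u) (hq : q ∈ corner m₁ m₂) :
    cornerDeriv u q (q.1, 0) = (slopeFst u q / 2) • u q ∧
      cornerDeriv u q (0, q.2) = (slopeSnd u q / 2) • u q := by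
  have h1 := eq_smul_of_inner_eq_zero (hu'.norm_eq_one hq) fun e he =>
    (inner_normal_eq_zero hu hu' hq he).1
  have h2 := eq_smul_of_inner_eq_zero (hu'.norm_eq_one hq) fun e he =>
    (inner_normal_eq_zero hu hu' hq he).2
  constructor
  · conv_lhs => rw [h1]
    unfold slopeFst; congr 1; ring
  · conv_lhs => rw [h2]
    unfold slopeSnd; congr 1; ring

/-- The normal derivative is orthogonal to the tangential ones and contributes `slope² / 4` to the
energy. Removing it from `slope_sq_eq` turns `m + 1` into `m` and leaves a right side that depends
on corner values only. -/
theorem slope_sq_eq_tangential (hu : IsHarmonic u) (hu' : Admissible u) (hq : q ∈ corner m₁ m₂) :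
    m₁ * slopeFst u q ^ 2 = 4 * ∑ i, ‖cornerDeriv u q
        (prodBasis m₁ m₂ (Sum.inl i) - q.1 i • (q.1, (0 : Euc m₂)))‖ ^ 2 ∧
      m₂ * slopeSnd u q ^ 2 = 4 * ∑ i, ‖cornerDeriv u q
        (prodBasis m₁ m₂ (Sum.inr i) - q.2 i • ((0 : Euc m₁), q.2))‖ ^ 2 := by
  have key {ξ : Euc m₁ × Euc m₂} {w : Euc n} {c s : ℝ} (hw : w = (s / 2) • u q)
      (h : IsTangent q ξ) :
      ‖cornerDeriv u q ξ + c • w‖ ^ 2 = ‖cornerDeriv u q ξ‖ ^ 2 + c ^ 2 * (s ^ 2 / 4) := by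
    rw [norm_add_sq_real, hw, real_inner_smul_right, real_inner_smul_right,
      real_inner_comm (u q), inner_cornerDeriv_of_isTangent hu' hq h, norm_smul, norm_smul,
      hu'.norm_eq_one hq, mul_pow, mul_pow, Real.norm_eq_abs, Real.norm_eq_abs, sq_abs, sq_abs]
    ring
  obtain ⟨n1, n2⟩ := cornerDeriv_normal hu hu' hq
  obtain ⟨s1, s2⟩ := slope_sq_eq hu hu' hq
  have k1 (i) : ‖cornerDeriv u q (prodBasis m₁ m₂ (Sum.inl i))‖ ^ 2 = _ :=
    (by rw [← map_smul, ← map_add, sub_add_cancel] :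
      ‖cornerDeriv u q (prodBasis m₁ m₂ (Sum.inl i))‖ ^ 2
        = ‖cornerDeriv u q (prodBasis m₁ m₂ (Sum.inl i) - q.1 i • (q.1, (0 : Euc m₂)))
          + q.1 i • cornerDeriv u q (q.1, 0)‖ ^ 2).trans (key n1 (isTangent_inl hq i))
  have k2 (i) : ‖cornerDeriv u q (prodBasis m₁ m₂ (Sum.inr i))‖ ^ 2 = _ :=
    (by rw [← map_smul, ← map_add, sub_add_cancel] :
      ‖cornerDeriv u q (prodBasis m₁ m₂ (Sum.inr i))‖ ^ 2
        = ‖cornerDeriv u q (prodBasis m₁ m₂ (Sum.inr i) - q.2 i • ((0 : Euc m₁), q.2))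
          + q.2 i • cornerDeriv u q (0, q.2)‖ ^ 2).trans (key n2 (isTangent_inr hq i))
  unfold energyFst at s1
  unfold energySnd at s2
  simp only [k1, k2, Finset.sum_add_distrib, ← Finset.sum_mul, sum_sq_fst hq, sum_sq_snd hq]
    at s1 s2
  constructor <;> linarith

/-- The derivative at the corner is determined by the values on the corner. -/
theorem cornerDeriv_eq (hm₁ : 1 ≤ m₁) (hm₂ : 1 ≤ m₂) (hu : IsHarmonic u) (hv : IsHarmonic v)
    (hu' : Admissible u) (hv' : Admissible v) (huv : Set.EqOn u v (corner m₁ m₂))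
    (hq : q ∈ corner m₁ m₂) : cornerDeriv u q = cornerDeriv v q := by
  have ht {ξ} (h : IsTangent q ξ) := cornerDeriv_eq_of_isTangent hu' hv' huv hq h
  obtain ⟨u1, u2⟩ := slope_sq_eq_tangential hu hu' hq
  obtain ⟨v1, v2⟩ := slope_sq_eq_tangential hv hv' hq
  simp only [ht (isTangent_inl hq _), ht (isTangent_inr hq _)] at u1 u2
  have k1 : (m₁ : ℝ) ≠ 0 := by positivity
  have k2 : (m₂ : ℝ) ≠ 0 := by positivity
  have e1 : slopeFst u q = slopeFst v q :=
    (pow_left_inj₀ (slope_nonneg hu hu' hq).1 (slope_nonneg hv hv' hq).1 two_ne_zero).1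
      (mul_left_cancel₀ k1 (u1.trans v1.symm))
  have e2 : slopeSnd u q = slopeSnd v q :=
    (pow_left_inj₀ (slope_nonneg hu hu' hq).2 (slope_nonneg hv hv' hq).2 two_ne_zero).1
      (mul_left_cancel₀ k2 (u2.trans v2.symm))
  have d1 : cornerDeriv u q (q.1, 0) = cornerDeriv v q (q.1, 0) := by
    rw [(cornerDeriv_normal hu hu' hq).1, (cornerDeriv_normal hv hv' hq).1, e1, huv hq]
  have d2 : cornerDeriv u q (0, q.2) = cornerDeriv v q (0, q.2) := by
    rw [(cornerDeriv_normal hu hu' hq).2, (cornerDeriv_normal hv hv' hq).2, e2, huv hq]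
  refine ContinuousLinearMap.ext fun x => ?_
  have b1 (i) : cornerDeriv u q (prodBasis m₁ m₂ (Sum.inl i))
      = cornerDeriv v q (prodBasis m₁ m₂ (Sum.inl i)) := by
    have h := ht (isTangent_inl hq i)
    rwa [map_sub, map_sub, map_smul, map_smul, d1, sub_left_inj] at h
  have b2 (i) : cornerDeriv u q (prodBasis m₁ m₂ (Sum.inr i))
      = cornerDeriv v q (prodBasis m₁ m₂ (Sum.inr i)) := by
    have h := ht (isTangent_inr hq i)
    rwa [map_sub, map_sub, map_smul, map_smul, d2, sub_left_inj] at h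
  rw [clm_eq_sum_stdBasis (cornerDeriv u q), clm_eq_sum_stdBasis (cornerDeriv v q)]
  simp only [b1, b2]

end CornerAlgebra

/-! ### Decay of the distance at the corner and conclusion -/

section Conclusion

variable {m₁ m₂ n : ℕ} {u v : Euc m₁ × Euc m₂ → Euc n} {q : Euc m₁ × Euc m₂}

/-- Strict differentiability relative to the convex closed domain. Both points may vary, which
allows estimates from the radial projection of `p` rather than from `q`: the error is then small
against the distance to the corner, not just against the distance to `q`. -/
theorem exists_ball_norm_sub_le {F : Type*} [NormedAddCommGroup F] [NormedSpace ℝ F]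
    {f : Euc m₁ × Euc m₂ → F} (hf : ContDiffOn ℝ 1 f (closedDomain m₁ m₂))
    (hq : q ∈ closedDomain m₁ m₂) {ε : ℝ} (hε : 0 < ε) :
    ∃ δ > 0, ∀ x ∈ closedDomain m₁ m₂ ∩ Metric.ball q δ,
      ∀ y ∈ closedDomain m₁ m₂ ∩ Metric.ball q δ,
      ‖f y - f x - fderivWithin ℝ f (closedDomain m₁ m₂) q (y - x)‖ ≤ ε * ‖y - x‖ := by
  have hc := hf.continuousOn_fderivWithin uniqueDiffOn_closedDomain (by norm_num) q hq
  obtain ⟨δ, hδ, hsub⟩ := Metric.mem_nhdsWithin_iff.1 (hc.eventually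
    (Metric.closedBall_mem_nhds (fderivWithin ℝ f (closedDomain m₁ m₂) q) hε))
  refine ⟨δ, hδ, fun x hx y hy => ?_⟩
  refine (convex_closedDomain.inter (convex_ball q δ)).norm_image_sub_le_of_norm_hasFDerivWithin_le'
    (f' := fderivWithin ℝ f (closedDomain m₁ m₂)) (fun z hz => ?_) (fun z hz => ?_) hx hy
  · exact ((hf.differentiableOn (by norm_num) z hz.1).hasFDerivWithinAt).mono Set.inter_subset_left
  · rw [← dist_eq_norm]
    exact hsub ⟨hz.2, hz.1⟩

/-- The radial projection to the corner. -/
def cornerProj (p : Euc m₁ × Euc m₂) : Euc m₁ × Euc m₂ := (‖p.1‖⁻¹ • p.1, ‖p.2‖⁻¹ • p.2)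

theorem tendsto_cornerProj (hq : q ∈ corner m₁ m₂) :
    Filter.Tendsto cornerProj (𝓝 q) (𝓝 q) := by
  have h := mem_corner_iff.1 hq
  have h1 : ContinuousAt (fun p : Euc m₁ × Euc m₂ => ‖p.1‖⁻¹ • p.1) q :=
    (continuousAt_fst.norm.inv₀ (by rw [h.1]; exact one_ne_zero)).smul continuousAt_fst
  have h2 : ContinuousAt (fun p : Euc m₁ × Euc m₂ => ‖p.2‖⁻¹ • p.2) q :=
    (continuousAt_snd.norm.inv₀ (by rw [h.2]; exact one_ne_zero)).smul continuousAt_snd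
  have h3 : ContinuousAt cornerProj q := h1.prodMk h2
  have h4 : cornerProj q = q := by simp [cornerProj, h.1, h.2]
  simpa [ContinuousAt, h4] using h3

theorem eventually_ne_zero (hq : q ∈ corner m₁ m₂) : ∀ᶠ p in 𝓝 q, p.1 ≠ 0 ∧ p.2 ≠ 0 := by
  have h := mem_corner_iff.1 hq
  exact (continuousAt_fst.eventually_ne (norm_ne_zero_iff.1 (by rw [h.1]; exact one_ne_zero))).and
    (continuousAt_snd.eventually_ne (norm_ne_zero_iff.1 (by rw [h.2]; exact one_ne_zero)))

theorem cornerProj_mem {p : Euc m₁ × Euc m₂} (h1 : p.1 ≠ 0) (h2 : p.2 ≠ 0) :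
    cornerProj p ∈ corner m₁ m₂ :=
  mem_corner_iff.2 ⟨norm_smul_inv_norm (𝕜 := ℝ) h1, norm_smul_inv_norm (𝕜 := ℝ) h2⟩

theorem sub_cornerProj {p : Euc m₁ × Euc m₂} (h1 : p.1 ≠ 0) (h2 : p.2 ≠ 0) :
    p - cornerProj p
      = (-(1 - ‖p.1‖) • (cornerProj p).1, -(1 - ‖p.2‖) • (cornerProj p).2) := by
  have g {k : ℕ} {x : Euc k} (hx : x ≠ 0) : x - ‖x‖⁻¹ • x = -(1 - ‖x‖) • ‖x‖⁻¹ • x := by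
    have : ‖x‖ ≠ 0 := norm_ne_zero_iff.2 hx
    rw [neg_sub, sub_smul, one_smul, smul_inv_smul₀ this]
  exact Prod.ext (g h1) (g h2)

theorem norm_sub_cornerProj {p : Euc m₁ × Euc m₂} (hp : p ∈ closedDomain m₁ m₂) (h1 : p.1 ≠ 0)
    (h2 : p.2 ≠ 0) : ‖p - cornerProj p‖ = max (1 - ‖p.1‖) (1 - ‖p.2‖) := by
  have hc := mem_corner_iff.1 (cornerProj_mem h1 h2)
  have hp' := mem_closedDomain_iff.1 hp
  rw [sub_cornerProj h1 h2, Prod.norm_mk, norm_smul, norm_smul, hc.1, hc.2, norm_neg, norm_neg,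
    Real.norm_eq_abs, Real.norm_eq_abs, abs_of_nonneg (by linarith), abs_of_nonneg (by linarith),
    mul_one, mul_one]

/-- If the derivatives of `u` and `v` agree at a corner point `q`, then near `q` the distance of
`u` and `v` is small compared with the distance to the corner. -/
theorem eventually_norm_sub_le (hu : Admissible u) (hv : Admissible v)
    (huv : Set.EqOn u v (corner m₁ m₂)) (hq : q ∈ corner m₁ m₂)
    (hD : cornerDeriv u q = cornerDeriv v q) {ε : ℝ} (hε : 0 < ε) :
    ∀ᶠ p in 𝓝[closedDomain m₁ m₂] q, ‖u p - v p‖ ≤ ε * ‖p - cornerProj p‖ := by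
  have hqc := corner_subset_closedDomain hq
  obtain ⟨δ, hδ, h⟩ := exists_ball_norm_sub_le (hu.contDiffOn_one.sub hv.contDiffOn_one) hqc hε
  have h0 : fderivWithin ℝ (fun x => u x - v x) (closedDomain m₁ m₂) q = 0 := by
    rw [((hu.hasFDerivWithinAt hqc).fun_sub (hv.hasFDerivWithinAt hqc)).fderivWithin
      (uniqueDiffOn_closedDomain q hqc), hD, sub_self]
  have hball := Metric.ball_mem_nhds q hδ
  have hproj := ((tendsto_cornerProj hq).eventually_mem hball).filter_mono
    (nhdsWithin_le_nhds (s := closedDomain m₁ m₂))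
  filter_upwards [self_mem_nhdsWithin, mem_nhdsWithin_of_mem_nhds hball,
    hproj, nhdsWithin_le_nhds (eventually_ne_zero hq)]
    with p hp hpb hpp hp0
  have hc := cornerProj_mem hp0.1 hp0.2
  have h1 := h _ ⟨corner_subset_closedDomain hc, hpp⟩ _ ⟨hp, hpb⟩
  simpa [h0, huv hc] using h1

/-- Near a corner point the height `1 - ‖u‖²` is at least comparable to the distance to the
corner. -/
theorem exists_eventually_le_height (hu : IsHarmonic u) (hu' : Admissible u)
    (hq : q ∈ corner m₁ m₂) :
    ∃ c > 0, ∀ᶠ p in 𝓝[closedDomain m₁ m₂] q, c * ‖p - cornerProj p‖ ≤ 1 - ‖u p‖ ^ 2 := by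
  have hqc := corner_subset_closedDomain hq
  have ha1 := slopeFst_pos hu hu' hq
  have ha2 := slopeSnd_pos hu hu' hq
  set a := min (slopeFst u q) (slopeSnd u q) with ha
  have ha0 : 0 < a := lt_min ha1 ha2
  have hA : ContDiffOn ℝ 1 (fun x => 1 - ‖u x‖ ^ 2) (closedDomain m₁ m₂) :=
    contDiffOn_const.sub (hu'.contDiffOn_one.norm_sq ℝ)
  obtain ⟨δ, hδ, h⟩ := exists_ball_norm_sub_le hA hqc (by positivity : 0 < a / 4)
  rw [(hu'.hasFDerivWithinAt_height hqc).fderivWithin (uniqueDiffOn_closedDomain q hqc)] at h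
  set A := heightDeriv u q with hAdef
  have c1 : Filter.Tendsto (fun p => A ((cornerProj p).1, (0 : Euc m₂))) (𝓝 q)
      (𝓝 (-slopeFst u q)) := by
    have e : A (q.1, 0) = -slopeFst u q := by
      rw [hAdef, heightDeriv_apply]; rfl
    rw [← e]
    have hc : Continuous fun p : Euc m₁ × Euc m₂ => A (p.1, 0) :=
      A.continuous.comp (continuous_fst.prodMk continuous_const)
    exact (hc.tendsto q).comp (tendsto_cornerProj hq)
  have c2 : Filter.Tendsto (fun p => A ((0 : Euc m₁), (cornerProj p).2)) (𝓝 q)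
      (𝓝 (-slopeSnd u q)) := by
    have e : A (0, q.2) = -slopeSnd u q := by
      rw [hAdef, heightDeriv_apply]; rfl
    rw [← e]
    have hc : Continuous fun p : Euc m₁ × Euc m₂ => A (0, p.2) :=
      A.continuous.comp (continuous_const.prodMk continuous_snd)
    exact (hc.tendsto q).comp (tendsto_cornerProj hq)
  have ha1' : a ≤ slopeFst u q := min_le_left _ _
  have ha2' : a ≤ slopeSnd u q := min_le_right _ _
  have l1 := c1.eventually (gt_mem_nhds (by linarith : -slopeFst u q < -(a / 2)))
  have l2 := c2.eventually (gt_mem_nhds (by linarith : -slopeSnd u q < -(a / 2)))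
  have hball := Metric.ball_mem_nhds q hδ
  have hproj := ((tendsto_cornerProj hq).eventually_mem hball).filter_mono
    (nhdsWithin_le_nhds (s := closedDomain m₁ m₂))
  -- Near `q` the linear part is at least `(a / 2) ((1 - ‖p.1‖) + (1 - ‖p.2‖))`, hence at least `a /
  -- 2` times the distance to the projection. The error term costs at most `a / 4` times that
  -- distance.
  refine ⟨a / 4, by positivity, ?_⟩
  filter_upwards [self_mem_nhdsWithin, mem_nhdsWithin_of_mem_nhds hball,
    hproj, nhdsWithin_le_nhds (eventually_ne_zero hq),
    nhdsWithin_le_nhds l1, nhdsWithin_le_nhds l2] with p hp hpb hpp hp0 hp1 hp2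
  have hc := cornerProj_mem hp0.1 hp0.2
  have hp' := mem_closedDomain_iff.1 hp
  have h1 := h _ ⟨corner_subset_closedDomain hc, hpp⟩ _ ⟨hp, hpb⟩
  have e : A (p - cornerProj p) = -((1 - ‖p.1‖) * A ((cornerProj p).1, 0)
      + (1 - ‖p.2‖) * A (0, (cornerProj p).2)) := by
    rw [sub_cornerProj hp0.1 hp0.2]
    have : ((-(1 - ‖p.1‖) • (cornerProj p).1, -(1 - ‖p.2‖) • (cornerProj p).2) :
        Euc m₁ × Euc m₂) = -(1 - ‖p.1‖) • ((cornerProj p).1, (0 : Euc m₂))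
          + -(1 - ‖p.2‖) • ((0 : Euc m₁), (cornerProj p).2) := by simp
    rw [this, map_add, map_smul, map_smul, smul_eq_mul, smul_eq_mul]
    ring
  simp only [hu'.norm_eq_one hc, Real.norm_eq_abs, e] at h1
  have hs1 : 0 ≤ 1 - ‖p.1‖ := by linarith
  have hs2 : 0 ≤ 1 - ‖p.2‖ := by linarith
  have g1 := mul_le_mul_of_nonneg_left hp1.le hs1
  have g2 := mul_le_mul_of_nonneg_left hp2.le hs2
  have g3 : ‖p - cornerProj p‖ ≤ (1 - ‖p.1‖) + (1 - ‖p.2‖) := by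
    rw [norm_sub_cornerProj hp hp0.1 hp0.2]
    exact max_le (by linarith) (by linarith)
  have g4 := (abs_le.1 h1).1
  nlinarith

theorem tendsto_distFun_corner (hm₁ : 1 ≤ m₁) (hm₂ : 1 ≤ m₂) (hu : IsHarmonic u)
    (hv : IsHarmonic v) (hu' : Admissible u) (hv' : Admissible v)
    (huv : Set.EqOn u v (corner m₁ m₂)) (hq : q ∈ corner m₁ m₂) :
    Filter.Tendsto (distFun u v) (𝓝[offCorner m₁ m₂] q) (𝓝 0) := by
  obtain ⟨c, hc, hcu⟩ := exists_eventually_le_height hu hu' hq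
  obtain ⟨d, hd, hdv⟩ := exists_eventually_le_height hv hv' hq
  have hsub : offCorner m₁ m₂ ⊆ closedDomain m₁ m₂ := Set.sdiff_subset
  rw [Metric.tendsto_nhds]
  intro η hη
  obtain ⟨ε, hε, hεη⟩ : ∃ ε : ℝ, 0 < ε ∧ ε ^ 2 < η * (c * d) := by
    refine ⟨min 1 (η * (c * d) / 2), by positivity, ?_⟩
    have h1 : min 1 (η * (c * d) / 2) ≤ 1 := min_le_left _ _
    have h2 : min 1 (η * (c * d) / 2) ≤ η * (c * d) / 2 := min_le_right _ _
    have h3 : 0 < min 1 (η * (c * d) / 2) := by positivity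
    have h4 : 0 < η * (c * d) := by positivity
    nlinarith
  have hN := eventually_norm_sub_le hu' hv' huv hq
    (cornerDeriv_eq hm₁ hm₂ hu hv hu' hv' huv hq) hε
  filter_upwards [nhdsWithin_mono q hsub hcu, nhdsWithin_mono q hsub hdv, nhdsWithin_mono q hsub hN,
    nhdsWithin_le_nhds (eventually_ne_zero hq), self_mem_nhdsWithin] with p h1 h2 h3 h4 hp
  have hs : 0 < ‖p - cornerProj p‖ := norm_pos_iff.2 fun h => hp.2 (by
    rw [sub_eq_zero.1 h]; exact cornerProj_mem h4.1 h4.2)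
  set s := ‖p - cornerProj p‖
  have hA : 0 < 1 - ‖u p‖ ^ 2 := lt_of_lt_of_le (mul_pos hc hs) h1
  have hB : 0 < 1 - ‖v p‖ ^ 2 := lt_of_lt_of_le (mul_pos hd hs) h2
  have h0 : 0 ≤ distFun u v p := by unfold distFun; positivity
  rw [Real.dist_eq, sub_zero, abs_of_nonneg h0]
  unfold distFun
  -- The two powers of `s` gained in the numerator are exactly those lost to the two heights.
  calc _ ≤ (ε * s) ^ 2 * ((c * s)⁻¹ * (d * s)⁻¹) := by gcongr
    _ = ε ^ 2 / (c * d) := by field_simp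
    _ < η := by rwa [div_lt_iff₀ (by positivity)]

theorem Admissible.norm_lt_one (hu : Admissible u) {p : Euc m₁ × Euc m₂}
    (hp : p ∈ offCorner m₁ m₂) : ‖u p‖ < 1 := by
  simpa [openBall] using hu.mapsTo_off_corner hp

theorem contDiffOn_distFun (hu : Admissible u) (hv : Admissible v) :
    ContDiffOn ℝ 2 (distFun u v) (offCorner m₁ m₂) := by
  have hu2 : ContDiffOn ℝ 2 u (offCorner m₁ m₂) := hu.contDiffOn_two
  have hv2 : ContDiffOn ℝ 2 v (offCorner m₁ m₂) := hv.contDiffOn_two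
  exact ((hu2.sub hv2).norm_sq ℝ).mul
    (((contDiffOn_const.sub (hu2.norm_sq ℝ)).inv fun p hp =>
      (one_sub_sq_pos (hu.norm_lt_one hp)).ne').mul
    ((contDiffOn_const.sub (hv2.norm_sq ℝ)).inv fun p hp =>
      (one_sub_sq_pos (hv.norm_lt_one hp)).ne'))

theorem eqOn_domain (hm₁ : 1 ≤ m₁) (hm₂ : 1 ≤ m₂) (hu : IsHarmonic u) (hv : IsHarmonic v)
    (hu' : Admissible u) (hv' : Admissible v) (huv : Set.EqOn u v (corner m₁ m₂)) :
    Set.EqOn u v (domain m₁ m₂) := by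
  intro p hp
  have h := nonpos_of_laplacian_nonneg hm₁ hm₂ (contDiffOn_distFun hu' hv')
    (fun x hx => laplacian_distFun_nonneg (hu.isHarmonicAt hx) (hv.isHarmonicAt hx))
    (fun x hx => tendsto_distFun_corner hm₁ hm₂ hu hv hu' hv' huv hx) (domain_subset_offCorner hp)
  have hA := inv_pos.2 (one_sub_sq_pos (hu.isHarmonicAt hp).norm_lt)
  have hB := inv_pos.2 (one_sub_sq_pos (hv.isHarmonicAt hp).norm_lt)
  have h1 : ‖u p - v p‖ ^ 2 ≤ 0 := nonpos_of_mul_nonpos_left h (mul_pos hA hB)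
  have h2 : ‖u p - v p‖ = 0 := by nlinarith [norm_nonneg (u p - v p)]
  exact sub_eq_zero.1 (norm_eq_zero.1 h2)

end Conclusion

end CornerHarmonic

end

theorem mainTheorem3 (m₁ m₂ n : ℕ) (hm₁ : 1 ≤ m₁) (hm₂ : 1 ≤ m₂) (hn : 1 ≤ n)
    (u v : EuclideanSpace ℝ (Fin (m₁ + 1)) × EuclideanSpace ℝ (Fin (m₂ + 1)) →
      EuclideanSpace ℝ (Fin (n + 1)))
    (hu : CornerHarmonic.IsHarmonic u) (hv : CornerHarmonic.IsHarmonic v)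
    (hu' : CornerHarmonic.Admissible u) (hv' : CornerHarmonic.Admissible v)
    (huv : Set.EqOn u v (CornerHarmonic.corner m₁ m₂)) :
    Set.EqOn u v (CornerHarmonic.domain m₁ m₂) :=
  CornerHarmonic.eqOn_domain hm₁ hm₂ hu hv hu' hv' huv
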